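/- Let $B$ be a finite dimensional C$^*$-algebra, let $I$ be a nonempty set, and for every $\iota\in I$ let $A_\iota$ be a finite dimensional C$^*$-algebra containing $B$ as a unital C$^*$-subalgebra and having a conditional expectation $\phi_\iota:A_\iota\to B$ whose GNS representation (on the Hilbert $B$-module $L^2(A_\iota,\phi_\iota)$) is faithful. Let $A$ be the C$^*$-algebra of the reduced amalgamated free product over $B$ of the family $(A_\iota,\phi_\iota)_{\iota\in I}$ (Voiculescu's construction), and let $\lambda_\iota:A_\iota\hookrightarrow A$ be the canonical embeddings. Let $\sigma$ be a permutation of $I$ and for every $\iota\in I$ let $\alpha_\iota:A_\iota\to A_{\sigma(\iota)}$ be a $*$-isomorphism such that $\alpha_\iota(B)=B$ and $\phi_{\sigma(\iota)}\circ\alpha_\iota=\alpha_\iota\circ\phi_\iota$; assume that the automorphism $\beta=\alpha_\iota{\restriction}_B$ of $B$ does not depend on $\iota$. Then there is a unique automorphism $\alpha$ of $A$ such that $$\alpha\circ\lambda_\iota=\lambda_{\sigma(\iota)}\circ\alpha_\iota\qquad(\iota\in I),$$ and its Brown--Voiculescu topological entropy is $ht(\alpha)=0$. Here $ht(\alpha)=ht(\pi,\alpha)$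 for any faithful representation $\pi:A\to\mathcal L(\mathcal H)$ on a Hilbert space, where $$ht(\pi,\alpha)=\sup_{\omega}\,\sup_{\delta>0}\ \limsup_{n\to\infty}\frac1n\log rcp\bigl(\pi,\omega\cup\alpha(\omega)\cup\cdots\cup\alpha^{n-1}(\omega),\delta\bigr),$$ the first supremum being over all finite subsets $\omega$ of $A$, and $rcp(\pi,\omega,\delta)$ is the least rank (dimension of a maximal abelian $*$-subalgebra) of a nonzero finite dimensional C$^*$-algebra $D$ for which there are contractive completely positive maps $f:A\to D$ and $g:D\to\mathcal L(\mathcal H)$ with $\|g(f(a))-\pi(a)\|<\delta$ for all $a\in\omega$. The assertion is that $ht(\pi,\alpha)=0$ for every faithful $\pi$. -/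

import Mathlib

/-- A unital inclusion of C⋆-algebras `B → A` together with a conditional expectation of `A`
onto the image of `B`, written as a map `A → B`. -/
structure CondExpInclusion (B A : Type*) [CStarAlgebra B] [PartialOrder B] [StarOrderedRing B]
    [CStarAlgebra A] where
  /-- the unital inclusion of `B` in `A` -/
  incl : B →⋆ₐ[ℂ] A
  /-- the conditional expectation -/
  exp : A →ₗ[ℂ] B
  exp_incl : ∀ b, exp (incl b) = b
  exp_incl_mul : ∀ b a, exp (incl b * a) = b * exp a
  exp_mul_incl : ∀ a b, exp (a * incl b) = exp a * b
  exp_star_mul_self_nonneg : ∀ a, 0 ≤ exp (star a * a)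

namespace CondExpInclusion

section Single

variable {B A : Type*} [CStarAlgebra B] [PartialOrder B] [StarOrderedRing B] [CStarAlgebra A]
  (p : CondExpInclusion B A)

/-- The GNS representation of `A` on the Hilbert `B`-module `L²(A, exp)` is faithful: `a` acts
as zero only if `a = 0`. -/
def FaithfulGNS : Prop :=
  ∀ a : A, (∀ x : A, p.exp (star (a * x) * (a * x)) = 0) → a = 0

theorem exp_one : p.exp 1 = 1 := by
  simpa using p.exp_incl 1

theorem exp_star (a : A) : p.exp (star a) = star (p.exp a) := by
  let _ := CStarAlgebra.spectralOrder A
  have := CStarAlgebra.spectralOrderedRing A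
  obtain ⟨x, hx, -, h⟩ := CStarAlgebra.exists_sum_four_nonneg a
  have e (i : Fin 4) : star (p.exp (x i)) = p.exp (x i) := by
    obtain ⟨y, hy⟩ := CStarAlgebra.nonneg_iff_eq_star_mul_self.mp (hx i)
    rw [hy]
    exact IsSelfAdjoint.of_nonneg (p.exp_star_mul_self_nonneg y)
  rw [h]
  simp only [star_sum, map_sum, map_smul, star_smul, (hx _).isSelfAdjoint.star_eq, e]

/-- The projection of `A` onto the kernel of the conditional expectation. -/
noncomputable def center : A →ₗ[ℂ] LinearMap.ker p.exp :=
  LinearMap.codRestrict _ (LinearMap.id - p.incl.toAlgHom.toLinearMap ∘ₗ p.exp) fun a => by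
    simp [p.exp_incl]

theorem coe_center (a : A) : (p.center a : A) = a - p.incl (p.exp a) := rfl

end Single

end CondExpInclusion

namespace AmalgamatedFreeProduct

section PosKernel

variable {B : Type*} [CStarAlgebra B] [PartialOrder B] [StarOrderedRing B]

/-- Positive semidefiniteness of a square matrix over a C⋆-algebra. -/
def PosKernel {F : Type*} [Fintype F] (M : F → F → B) : Prop :=
  (∀ i j, star (M i j) = M j i) ∧ ∀ c : F → B, 0 ≤ ∑ i, ∑ j, star (c i) * M i j * c j

theorem exists_eq_star_mul_self {C : Type*} [NonUnitalCStarAlgebra C] [PartialOrder C]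
    [StarOrderedRing C] {T : C} (hT : 0 ≤ T) : ∃ S : C, T = star S * S :=
  CStarAlgebra.nonneg_iff_eq_star_mul_self.mp hT

theorem exists_pos_sub_pos {C : Type*} [NonUnitalCStarAlgebra C] [PartialOrder C]
    [StarOrderedRing C] {T : C} (hT : IsSelfAdjoint T) :
    ∃ P R : C, 0 ≤ P ∧ 0 ≤ R ∧ R * P = 0 ∧ P - R = T :=
  ⟨T⁺, T⁻, CFC.posPart_nonneg T, CFC.negPart_nonneg T, CFC.negPart_mul_posPart T,
    CFC.posPart_sub_negPart T⟩

theorem PosKernel.exists_gram {F : Type*} [Fintype F] {M : F → F → B} (h : PosKernel M) :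
    ∃ N : F → F → B, ∀ i j, M i j = ∑ k, star (N k i) * N k j := by
  classical
  let T : CStarMatrix F F B := CStarMatrix.ofMatrix M
  have hT : IsSelfAdjoint T := by
    ext i j
    exact h.1 j i
  obtain ⟨P, R, hP, hR, hRP, hPR⟩ := exists_pos_sub_pos hT
  have hRs : star R = R := IsSelfAdjoint.of_nonneg hR
  have hTR : R * T * R = - (star R * R * R) := by
    rw [← hPR, hRs, mul_sub, sub_mul, hRP, zero_mul, zero_sub]
  have hR3 : 0 ≤ star R * R * R := by
    have := star_left_conjugate_nonneg hR R
    rw [hRs] at this ⊢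
    exact this
  obtain ⟨S, hS⟩ := exists_eq_star_mul_self hR3
  have hdiag (j : F) : ∑ k, star (S k j) * S k j = 0 := by
    have h1 := h.2 (fun i => R i j)
    have h2 : ∑ i, ∑ k, star (R i j) * M i k * R k j = (star R * T * R) j j := by
      simp only [CStarMatrix.mul_apply, Finset.sum_mul, CStarMatrix.star_apply]
      rw [Finset.sum_comm]
      rfl
    rw [h2, hRs, hTR, hS] at h1
    have h3 : (star S * S) j j = ∑ k, star (S k j) * S k j := by
      simp only [CStarMatrix.mul_apply, CStarMatrix.star_apply]
    have h4 : 0 ≤ ∑ k, star (S k j) * S k j := Finset.sum_nonneg fun k _ => star_mul_self_nonneg _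
    refine le_antisymm ?_ h4
    rw [← h3]
    have : (-(star S * S)) j j = -((star S * S) j j) := rfl
    rw [this] at h1
    exact neg_nonneg.mp h1
  have hS0 : S = 0 := by
    ext k j
    have := (Finset.sum_eq_zero_iff_of_nonneg (fun k _ => star_mul_self_nonneg (S k j))).mp
      (hdiag j) k (Finset.mem_univ k)
    exact CStarRing.star_mul_self_eq_zero_iff _ |>.mp this
  have hR0 : R = 0 := by
    have h0 : R * R * R = 0 := by rw [hRs] at hS; rw [hS, hS0]; simp
    have h1 : star (R * R) * (R * R) = 0 := by
      rw [star_mul, hRs, ← mul_assoc, h0, zero_mul]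
    have h2 : R * R = 0 := CStarRing.star_mul_self_eq_zero_iff _ |>.mp h1
    have h3 : star R * R = 0 := by rw [hRs, h2]
    exact CStarRing.star_mul_self_eq_zero_iff _ |>.mp h3
  have hTn : 0 ≤ T := by
    rw [← hPR, hR0, sub_zero]
    exact hP
  obtain ⟨N, hN⟩ := exists_eq_star_mul_self hTn
  refine ⟨fun i j => N i j, fun i j => ?_⟩
  have : M i j = T i j := rfl
  rw [this, hN]
  simp only [CStarMatrix.mul_apply, CStarMatrix.star_apply]

theorem PosKernel.exp {F : Type*} [Fintype F] {M : F → F → B} (h : PosKernel M)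
    {A : Type*} [CStarAlgebra A] (p : CondExpInclusion B A) (a : F → A) :
    PosKernel fun i j => p.exp (star (a i) * p.incl (M i j) * a j) := by
  constructor
  · intro i j
    rw [← p.exp_star, star_mul, star_mul, star_star, ← map_star, h.1, ← mul_assoc]
  · intro c
    obtain ⟨N, hN⟩ := h.exists_gram
    have : ∑ i, ∑ j, star (c i) * p.exp (star (a i) * p.incl (M i j) * a j) * c j =
        ∑ k, p.exp (star (∑ i, p.incl (N k i) * a i * p.incl (c i)) *
          (∑ i, p.incl (N k i) * a i * p.incl (c i))) := by
      have e (i j : F) : star (c i) * p.exp (star (a i) * p.incl (M i j) * a j) * c j =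
          ∑ k, p.exp (star (p.incl (N k i) * a i * p.incl (c i)) *
            (p.incl (N k j) * a j * p.incl (c j))) := by
        rw [← p.exp_incl_mul, ← p.exp_mul_incl, ← map_sum]
        congr 1
        simp only [hN, star_mul, map_sum, map_mul, ← map_star, Finset.mul_sum, Finset.sum_mul,
          mul_assoc]
      simp only [e, star_sum, Finset.sum_mul_sum, map_sum]
      rw [Finset.sum_comm_cycle]
    rw [this]
    exact Finset.sum_nonneg fun k _ => p.exp_star_mul_self_nonneg _

theorem PosKernel.sum {F K : Type*} [Fintype F] (s : Finset K) {M : K → F → F → B}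
    (h : ∀ k ∈ s, PosKernel (M k)) : PosKernel fun i j => ∑ k ∈ s, M k i j := by
  constructor
  · intro i j
    rw [star_sum]
    exact Finset.sum_congr rfl fun k hk => (h k hk).1 i j
  · intro c
    have : ∑ i, ∑ j, star (c i) * (∑ k ∈ s, M k i j) * c j =
        ∑ k ∈ s, ∑ i, ∑ j, star (c i) * M k i j * c j := by
      simp only [Finset.mul_sum, Finset.sum_mul]
      rw [Finset.sum_comm_cycle]
    rw [this]
    exact Finset.sum_nonneg fun k hk => (h k hk).2 c

theorem PosKernel.add {F : Type*} [Fintype F] {M N : F → F → B} (hM : PosKernel M)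
    (hN : PosKernel N) : PosKernel fun i j => M i j + N i j := by
  refine ⟨fun i j => by rw [star_add, hM.1, hN.1], fun c => ?_⟩
  simpa only [mul_add, add_mul, Finset.sum_add_distrib] using add_nonneg (hM.2 c) (hN.2 c)

theorem PosKernel.cut {F : Type*} [Fintype F] {M : F → F → B} (h : PosKernel M) (q : F → Prop)
    [DecidablePred q] : PosKernel fun i j => if q i ∧ q j then M i j else 0 := by
  constructor
  · intro i j
    by_cases hi : q i <;> by_cases hj : q j <;> simp [hi, hj, h.1 i j]
  · intro c
    have := h.2 fun i => if q i then c i else 0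
    refine this.trans_eq (Finset.sum_congr rfl fun i _ => Finset.sum_congr rfl fun j _ => ?_)
    by_cases hi : q i <;> by_cases hj : q j <;> simp [hi, hj]

end PosKernel

open CondExpInclusion

section Words

variable {B : Type*} [CStarAlgebra B] [PartialOrder B] [StarOrderedRing B]
  {I : Type*} {A : I → Type*} [∀ i, CStarAlgebra (A i)] (P : ∀ i, CondExpInclusion B (A i))

/-- A letter: an index `i` and an element of the kernel of the `i`-th conditional expectation. -/
abbrev Letter := Σ i, LinearMap.ker (P i).exp

variable {P}

open Classical in
/-- The letter `x` viewed in `A i`; it is replaced by `0` if it comes from another algebra. -/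
noncomputable def Letter.at (x : Letter P) (i : I) : A i :=
  if h : x.1 = i then h ▸ (x.2 : A x.1) else 0

theorem Letter.at_self (i : I) (a : LinearMap.ker (P i).exp) :
    Letter.at (⟨i, a⟩ : Letter P) i = a := by
  simp [Letter.at]

theorem Letter.at_of_ne {x : Letter P} {i : I} (h : x.1 ≠ i) : x.at i = 0 := by
  simp [Letter.at, h]

/-- One step of the inner product of tensors: `φ (x* b y)` for letters `x`, `y` from the same
algebra, with `φ` its conditional expectation, and `0` for letters from different algebras. -/
noncomputable def step (x : Letter P) (b : B) (y : Letter P) : B :=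
  (P y.1).exp (star (x.at y.1) * (P y.1).incl b * y.at y.1)

theorem step_mk (i : I) (a c : LinearMap.ker (P i).exp) (b : B) :
    step (⟨i, a⟩ : Letter P) b ⟨i, c⟩ = (P i).exp (star (a : A i) * (P i).incl b * c) := by
  simp only [step, Letter.at_self]

theorem step_of_ne {x y : Letter P} (h : x.1 ≠ y.1) (b : B) : step x b y = 0 := by
  simp [step, Letter.at_of_ne h]

theorem step_zero (x y : Letter P) : step x 0 y = 0 := by
  simp [step]

theorem step_add (x y : Letter P) (b c : B) : step x (b + c) y = step x b y + step x c y := by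
  simp [step, mul_add, add_mul]

theorem step_smul (x y : Letter P) (z : ℂ) (b : B) : step x (z • b) y = z • step x b y := by
  simp [step]

theorem star_step (x y : Letter P) (b : B) : star (step x b y) = step y (star b) x := by
  obtain ⟨i, a⟩ := x
  obtain ⟨j, c⟩ := y
  by_cases h : i = j
  · subst h
    rw [step_mk, step_mk, ← exp_star, star_mul, star_mul, star_star, map_star, mul_assoc]
  · rw [step_of_ne (by exact h), step_of_ne (by exact fun e => h e.symm), star_zero]

/-- The `B`-valued inner product of the elementary tensors given by two words, with an element of
`B` inserted:
`⟪x₁ ⊗ ⋯ ⊗ xₙ, b · (y₁ ⊗ ⋯ ⊗ yₙ)⟫ = φ (xₙ* ⋯ φ (x₂* φ (x₁* b y₁) y₂) ⋯ yₙ)`. -/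
noncomputable def kernel : List (Letter P) → B → List (Letter P) → B
  | [], b, [] => b
  | x :: u, b, y :: v => kernel u (step x b y) v
  | [], _, _ :: _ => 0
  | _ :: _, _, [] => 0

theorem kernel_zero (u v : List (Letter P)) : kernel u 0 v = 0 := by
  induction u generalizing v with
  | nil => cases v <;> simp [kernel]
  | cons x u ih => cases v <;> simp [kernel, step_zero, ih]

theorem kernel_add (u v : List (Letter P)) (b c : B) :
    kernel u (b + c) v = kernel u b v + kernel u c v := by
  induction u generalizing v b c with
  | nil => cases v <;> simp [kernel]
  | cons x u ih => cases v <;> simp [kernel, step_add, ih]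

theorem kernel_smul (u v : List (Letter P)) (z : ℂ) (b : B) :
    kernel u (z • b) v = z • kernel u b v := by
  induction u generalizing v b with
  | nil => cases v <;> simp [kernel]
  | cons x u ih => cases v <;> simp [kernel, step_smul, ih]

theorem star_kernel (u v : List (Letter P)) (b : B) :
    star (kernel u b v) = kernel v (star b) u := by
  induction u generalizing v b with
  | nil => cases v <;> simp [kernel]
  | cons x u ih => cases v <;> simp [kernel, star_step, ih]

theorem posKernel_kernel {F : Type*} [Fintype F] (n : ℕ) (u : F → List (Letter P))
    (hu : ∀ i, (u i).length ≤ n) {M : F → F → B} (hM : PosKernel M) :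
    PosKernel fun i j => kernel (u i) (M i j) (u j) := by
  classical
  induction n generalizing u M with
  | zero =>
    have h (i : F) : u i = [] := List.length_eq_zero_iff.mp (Nat.le_zero.mp (hu i))
    simpa only [h, kernel] using hM
  | succ n ih =>
    let S : Finset I := Finset.univ.biUnion fun i => ((u i).map Sigma.fst).toFinset
    let a (k : I) (i : F) : A k := (u i).head?.elim 0 fun x => x.at k
    have h1 : PosKernel fun i j =>
        ∑ k ∈ S, (P k).exp (star (a k i) * (P k).incl (M i j) * a k j) :=
      PosKernel.sum S fun k _ => hM.exp (P k) (a k)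
    have h2 := ih (fun i => (u i).tail)
      (fun i => by rw [List.length_tail]; exact Nat.sub_le_of_le_add (hu i)) h1
    have h3 := (h2.cut fun i => u i ≠ []).add (hM.cut fun i => u i = [])
    convert h3 using 3 with i j
    cases hi : u i with
    | nil => cases hj : u j <;> simp [kernel]
    | cons x s =>
      cases hj : u j with
      | nil => simp [kernel]
      | cons y t =>
        simp only [kernel, ne_eq, reduceCtorEq, not_false_eq_true, and_self, if_true, if_false,
          add_zero, List.tail_cons]
        congr 1
        rw [Finset.sum_eq_single y.1]
        · simp [a, hi, hj, step]
        · intro k _ hk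
          simp [a, hj, Letter.at_of_ne (Ne.symm hk)]
        · intro hk
          refine absurd ?_ hk
          simp only [S, Finset.mem_biUnion, Finset.mem_univ, true_and]
          exact ⟨j, by simp [hj]⟩

variable (P) in
/-- Reduced words: neighbouring letters come from different algebras. -/
structure Word where
  /-- the letters of the word -/
  letters : List (Letter P)
  isChain : letters.IsChain fun x y => x.1 ≠ y.1

variable (P) in
/-- The words that do not begin with a letter from `A i`. -/
structure AvoidingWord (i : I) where
  /-- the word -/
  word : Word P
  head_ne : ∀ x ∈ word.letters.head?, x.1 ≠ i

/-- The word `a :: u`. -/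
def consWord (i : I) (a : LinearMap.ker (P i).exp) (u : AvoidingWord P i) : Word P :=
  ⟨⟨i, a⟩ :: u.1.1, by
    obtain ⟨⟨u, hu⟩, h⟩ := u
    cases u with
    | nil => simp
    | cons y t => exact List.isChain_cons_cons.mpr ⟨(h y (by simp)).symm, hu⟩⟩

open Classical in
/-- The decomposition of a word into its head in `A i` and the rest; the head is `1` if the word
does not begin with a letter from `A i`. -/
noncomputable def split (i : I) : Word P → A i × AvoidingWord P i
  | ⟨[], h⟩ => (1, ⟨⟨[], h⟩, by simp⟩)
  | ⟨x :: u, h⟩ =>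
    if hx : x.1 = i then
      (x.at i, ⟨⟨u, h.tail⟩, by
        subst hx
        cases u with
        | nil => simp
        | cons y t =>
          intro z hz
          obtain rfl : y = z := by simpa using hz
          exact (List.isChain_cons_cons.mp h).1.symm⟩)
    else (1, ⟨⟨x :: u, h⟩, by simpa using hx⟩)

variable (P) in
/-- The pre-Hilbert `B`-module spanned by the elementary tensors `x₁ ⊗ ⋯ ⊗ xₙ · b`, where
`x₁ ⋯ xₙ` is a reduced word and `b ∈ B`. -/
def PreFock := Word P →₀ B

noncomputable instance : AddCommGroup (PreFock P) := inferInstanceAs (AddCommGroup (Word P →₀ B))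
noncomputable instance : Module ℂ (PreFock P) := inferInstanceAs (Module ℂ (Word P →₀ B))

/-- The elementary tensor `x₁ ⊗ ⋯ ⊗ xₙ · b`. -/
noncomputable def tensor (u : Word P) : B →ₗ[ℂ] PreFock P := Finsupp.lsingle u

theorem PreFock.induction {p : PreFock P → Prop} (f : PreFock P) (h0 : p 0)
    (hadd : ∀ f g, p f → p g → p (f + g)) (ht : ∀ u b, p (tensor u b)) : p f :=
  Finsupp.induction_linear (motive := p) f h0 hadd ht

/-- The `ℂ`-linear extension of maps given on the elementary tensors. -/
noncomputable def lift {M : Type*} [AddCommGroup M] [Module ℂ M] (T : Word P → B →ₗ[ℂ] M) :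
    PreFock P →ₗ[ℂ] M := Finsupp.lsum ℂ T

theorem lift_tensor {M : Type*} [AddCommGroup M] [Module ℂ M] (T : Word P → B →ₗ[ℂ] M)
    (u : Word P) (b : B) : lift T (tensor u b) = T u b := by
  exact Finsupp.sum_single_index (map_zero (T u))

/-- The right action of `B`. -/
noncomputable def rightMul (b : B) : PreFock P →ₗ[ℂ] PreFock P :=
  lift fun u => tensor u ∘ₗ LinearMap.mulRight ℂ b

theorem rightMul_tensor (b c : B) (u : Word P) : rightMul c (tensor u b) = tensor u (b * c) := by
  simp [rightMul, lift_tensor]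

/-- The right `B`-linear extension of a map given on words. -/
noncomputable def rightLift (T : Word P → PreFock P) : PreFock P →ₗ[ℂ] PreFock P :=
  lift fun u =>
    { toFun := fun b => rightMul b (T u)
      map_add' := fun b c => by
        induction T u using PreFock.induction with
        | h0 => simp
        | hadd f g hf hg => rw [map_add, map_add, map_add, hf, hg]; abel
        | ht v d => simp [rightMul_tensor, mul_add]
      map_smul' := fun z b => by
        induction T u using PreFock.induction with
        | h0 => simp
        | hadd f g hf hg => rw [map_add, map_add, hf, hg, smul_add]
        | ht v d => simp [rightMul_tensor] }

theorem rightLift_tensor (T : Word P → PreFock P) (u : Word P) (b : B) :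
    rightLift T (tensor u b) = rightMul b (T u) := by
  simp [rightLift, lift_tensor]

/-- The sesquilinear extension of a `B`-valued kernel on words. -/
noncomputable def sesq (k : Word P → Word P → B) (f g : PreFock P) : B :=
  Finsupp.sum f fun u b => Finsupp.sum g fun v c => star b * k u v * c

theorem sesq_zero_left (k : Word P → Word P → B) (g : PreFock P) : sesq k 0 g = 0 :=
  Finsupp.sum_zero_index

theorem sesq_zero_right (k : Word P → Word P → B) (f : PreFock P) : sesq k f 0 = 0 := by
  refine (Finsupp.sum_congr (g2 := fun _ _ => (0 : B)) fun u _ => ?_).trans ?_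
  · exact Finsupp.sum_zero_index
  · exact Finset.sum_const_zero

theorem sesq_add_left (k : Word P → Word P → B) (f f' g : PreFock P) :
    sesq k (f + f') g = sesq k f g + sesq k f' g := by
  classical
  refine Finsupp.sum_add_index' (fun u => ?_) fun u b c => ?_
  · simp [Finsupp.sum]
  · simp only [star_add, add_mul]
    exact Finsupp.sum_add

theorem sesq_add_right (k : Word P → Word P → B) (f g g' : PreFock P) :
    sesq k f (g + g') = sesq k f g + sesq k f g' := by
  classical
  refine (Finsupp.sum_congr fun u _ => ?_).trans Finsupp.sum_add
  exact Finsupp.sum_add_index' (by simp) fun v b c => by simp [mul_add]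

theorem sesq_tensor (k : Word P → Word P → B) (u v : Word P) (b c : B) :
    sesq k (tensor u b) (tensor v c) = star b * k u v * c := by
  refine (Finsupp.sum_single_index ?_).trans (Finsupp.sum_single_index ?_)
  · simp [Finsupp.sum]
  · simp

theorem sesq_smul_right (k : Word P → Word P → B) (z : ℂ) (f g : PreFock P) :
    sesq k f (z • g) = z • sesq k f g := by
  induction f using PreFock.induction with
  | h0 => simp [sesq_zero_left]
  | hadd f f' hf hf' => rw [sesq_add_left, sesq_add_left, hf, hf', smul_add]
  | ht u b =>
    induction g using PreFock.induction with
    | h0 => simp [sesq_zero_right]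
    | hadd g g' hg hg' => rw [smul_add, sesq_add_right, sesq_add_right, hg, hg', smul_add]
    | ht v c => rw [← map_smul, sesq_tensor, sesq_tensor, mul_smul_comm]

theorem sesq_rightMul (k : Word P → Word P → B) (b : B) (f g : PreFock P) :
    sesq k f (rightMul b g) = sesq k f g * b := by
  induction f using PreFock.induction with
  | h0 => simp [sesq_zero_left]
  | hadd f f' hf hf' => rw [sesq_add_left, sesq_add_left, hf, hf', add_mul]
  | ht u b =>
    induction g using PreFock.induction with
    | h0 => simp [sesq_zero_right]
    | hadd g g' hg hg' => rw [map_add, sesq_add_right, sesq_add_right, hg, hg', add_mul]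
    | ht v c => rw [rightMul_tensor, sesq_tensor, sesq_tensor, mul_assoc, mul_assoc, mul_assoc]

theorem star_sesq (k : Word P → Word P → B) (hk : ∀ u v, star (k u v) = k v u)
    (f g : PreFock P) : star (sesq k f g) = sesq k g f := by
  induction f using PreFock.induction with
  | h0 => simp [sesq_zero_left, sesq_zero_right]
  | hadd f f' hf hf' => rw [sesq_add_left, sesq_add_right, star_add, hf, hf']
  | ht u b =>
    induction g using PreFock.induction with
    | h0 => simp [sesq_zero_left, sesq_zero_right]
    | hadd g g' hg hg' => rw [sesq_add_left, sesq_add_right, star_add, hg, hg']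
    | ht v c => rw [sesq_tensor, sesq_tensor, star_mul, star_mul, star_star, hk, mul_assoc]

/-- The `B`-valued inner product on the span of the elementary tensors, linear in the second
variable. -/
noncomputable def preInner (f g : PreFock P) : B := sesq (fun u v => kernel u.1 1 v.1) f g

theorem star_preInner (f g : PreFock P) : star (preInner f g) = preInner g f :=
  star_sesq _ (fun u v => by rw [star_kernel, star_one]) f g

theorem preInner_self_nonneg (f : PreFock P) : 0 ≤ preInner f f := by
  classical
  let F : Finset (Word P) := Finsupp.support f
  have h1 : PosKernel (fun _ _ : F => (1 : B)) := by
    refine ⟨fun i j => star_one B, fun c => ?_⟩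
    have : ∑ i, ∑ j, star (c i) * 1 * c j = star (∑ i, c i) * ∑ i, c i := by
      simp [star_sum, Finset.sum_mul_sum]
    rw [this]
    exact star_mul_self_nonneg _
  have h2 := posKernel_kernel (F.sup fun u => u.1.length) (fun i : F => i.1.1)
    (fun i => Finset.le_sup (f := fun u : Word P => u.1.length) i.2) h1
  have h3 := h2.2 fun i => (DFunLike.coe (F := Word P →₀ B) f) i.1
  refine h3.trans_eq ?_
  simp only [preInner, sesq, Finsupp.sum]
  rw [Finset.univ_eq_attach, Finset.sum_attach F fun u => ∑ j ∈ F.attach,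
    star ((DFunLike.coe (F := Word P →₀ B) f) u) * kernel u.1 1 j.1.1 * (DFunLike.coe (F := Word P →₀ B) f) j.1]
  refine Finset.sum_congr rfl fun u _ => ?_
  exact Finset.sum_attach F fun v =>
    star ((DFunLike.coe (F := Word P →₀ B) f) u) * kernel u.1 1 v.1 * (DFunLike.coe (F := Word P →₀ B) f) v

end Words

section PreFockNorm

variable {B : Type*} [CStarAlgebra B] [PartialOrder B] [StarOrderedRing B]
  {I : Type*} {A : I → Type*} [∀ i, CStarAlgebra (A i)] {P : ∀ i, CondExpInclusion B (A i)}

theorem preInner_add_left (f f' g : PreFock P) :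
    preInner (f + f') g = preInner f g + preInner f' g := sesq_add_left _ _ _ _

theorem preInner_add_right (f g g' : PreFock P) :
    preInner f (g + g') = preInner f g + preInner f g' := sesq_add_right _ _ _ _

theorem preInner_smul_right (z : ℂ) (f g : PreFock P) :
    preInner f (z • g) = z • preInner f g := sesq_smul_right _ _ _ _

theorem preInner_smul_left (z : ℂ) (f g : PreFock P) :
    preInner (z • f) g = star z • preInner f g := by
  rw [← star_preInner, preInner_smul_right, star_smul, star_preInner]

theorem preInner_rightMul (b : B) (f g : PreFock P) :
    preInner f (rightMul b g) = preInner f g * b := sesq_rightMul _ _ _ _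

theorem preInner_rightMul_left (b : B) (f g : PreFock P) :
    preInner (rightMul b f) g = star b * preInner f g := by
  rw [← star_preInner, preInner_rightMul, star_mul, star_preInner]

theorem cauchy_schwarz_aux (f g : PreFock P) (t : ℝ) :
    (2 * t - t ^ 2 * ‖preInner f f‖) * ‖preInner f g‖ ^ 2 ≤ ‖preInner g g‖ := by
  set p := preInner f g with hp
  set s : ℝ := 2 * t - t ^ 2 * ‖preInner f f‖ with hs
  by_cases hs0 : s ≤ 0
  · exact (mul_nonpos_of_nonpos_of_nonneg hs0 (sq_nonneg _)).trans (norm_nonneg _)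
  have h1 : star p * preInner f f * p ≤ ‖preInner f f‖ • (star p * p) :=
    CStarAlgebra.star_left_conjugate_le_norm_smul (hb := (preInner_self_nonneg f).isSelfAdjoint)
  have h2 : 0 ≤ t ^ 2 • (star p * preInner f f * p) - (2 * t) • (star p * p) + preInner g g := by
    have h := preInner_self_nonneg (((t : ℂ) • rightMul p f) + (-1 : ℂ) • g)
    refine h.trans_eq ?_
    simp only [preInner_add_left, preInner_add_right, preInner_smul_left, preInner_smul_right,
      preInner_rightMul, preInner_rightMul_left]
    have hg : preInner g f = star p := by rw [hp, star_preInner]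
    rw [← hp, hg]
    simp only [Complex.star_def, Complex.conj_ofReal, map_neg, map_one, neg_smul, one_smul,
      smul_neg, Complex.coe_smul, add_mul, neg_mul, smul_mul_assoc, smul_add, smul_smul, pow_two,
      two_mul, add_smul, mul_assoc, neg_neg]
    abel
  have h3 : s • (star p * p) ≤ preInner g g := by
    have h4 : t ^ 2 • (star p * preInner f f * p) ≤ t ^ 2 • (‖preInner f f‖ • (star p * p)) :=
      smul_le_smul_of_nonneg_left h1 (sq_nonneg t)
    rw [smul_smul] at h4
    rw [hs, sub_smul]
    rw [← sub_nonneg]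
    refine h2.trans ?_
    rw [← sub_nonneg] at h4 ⊢
    refine h4.trans_eq ?_
    abel
  have h5 := CStarAlgebra.norm_le_norm_of_nonneg_of_le
    (smul_nonneg (not_le.mp hs0).le (star_mul_self_nonneg p)) h3
  rwa [norm_smul, CStarRing.norm_star_mul_self, Real.norm_of_nonneg (not_le.mp hs0).le,
    ← pow_two] at h5

theorem norm_preInner_sq_le (f g : PreFock P) :
    ‖preInner f g‖ ^ 2 ≤ ‖preInner f f‖ * ‖preInner g g‖ := by
  by_cases h : ‖preInner f f‖ = 0
  · have h1 (t : ℝ) := cauchy_schwarz_aux f g t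
    rw [h] at h1 ⊢
    have h2 : ‖preInner f g‖ ^ 2 = 0 := by
      by_contra hne
      have := h1 ((‖preInner g g‖ + 1) / ‖preInner f g‖ ^ 2)
      rw [mul_zero, sub_zero, mul_assoc, div_mul_cancel₀ _ hne] at this
      linarith [norm_nonneg (preInner g g)]
    rw [h2]
    simp
  · have hpos : 0 < ‖preInner f f‖ := lt_of_le_of_ne (norm_nonneg _) (Ne.symm h)
    have := cauchy_schwarz_aux f g ‖preInner f f‖⁻¹
    have e : 2 * ‖preInner f f‖⁻¹ - ‖preInner f f‖⁻¹ ^ 2 * ‖preInner f f‖ =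
        ‖preInner f f‖⁻¹ := by
      field_simp
      norm_num
    rw [e, inv_mul_le_iff₀ hpos] at this
    exact this

/-- The seminorm of the pre-Hilbert module. -/
noncomputable instance : Norm (PreFock P) := ⟨fun f => √‖preInner f f‖⟩

theorem PreFock.norm_sq (f : PreFock P) : ‖f‖ ^ 2 = ‖preInner f f‖ :=
  Real.sq_sqrt (norm_nonneg _)

theorem PreFock.norm_nonneg' (f : PreFock P) : 0 ≤ ‖f‖ := Real.sqrt_nonneg _

theorem norm_preInner_le (f g : PreFock P) : ‖preInner f g‖ ≤ ‖f‖ * ‖g‖ := by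
  refine abs_le_of_sq_le_sq' ?_ (mul_nonneg f.norm_nonneg' g.norm_nonneg') |>.2
  rw [mul_pow, PreFock.norm_sq, PreFock.norm_sq]
  exact norm_preInner_sq_le f g

theorem PreFock.core : SeminormedSpace.Core ℂ (PreFock P) where
  norm_nonneg := PreFock.norm_nonneg'
  norm_smul z f := by
    refine (sq_eq_sq₀ (PreFock.norm_nonneg' _)
      (mul_nonneg (norm_nonneg z) f.norm_nonneg')).mp ?_
    rw [mul_pow, PreFock.norm_sq, PreFock.norm_sq, preInner_smul_left, preInner_smul_right,
      norm_smul, norm_smul, norm_star, pow_two, mul_assoc]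
  norm_triangle f g := by
    refine abs_le_of_sq_le_sq' ?_ (add_nonneg f.norm_nonneg' g.norm_nonneg') |>.2
    rw [PreFock.norm_sq, preInner_add_left, preInner_add_right, preInner_add_right]
    calc _ ≤ ‖preInner f f‖ + ‖preInner f g‖ + (‖preInner g f‖ + ‖preInner g g‖) :=
          (norm_add_le _ _).trans (add_le_add (norm_add_le _ _) (norm_add_le _ _))
      _ ≤ ‖f‖ ^ 2 + ‖f‖ * ‖g‖ + (‖g‖ * ‖f‖ + ‖g‖ ^ 2) := by
          rw [PreFock.norm_sq, PreFock.norm_sq]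
          gcongr <;> exact norm_preInner_le _ _
      _ = _ := by ring

noncomputable instance : SeminormedAddCommGroup (PreFock P) :=
  SeminormedAddCommGroup.ofCore PreFock.core

noncomputable instance : NormedSpace ℂ (PreFock P) where
  norm_smul_le z f := (PreFock.core.norm_smul z f).le

/-- The inner product as a bounded sesquilinear map. -/
noncomputable def preInnerL : PreFock P →L⋆[ℂ] PreFock P →L[ℂ] B :=
  LinearMap.mkContinuous₂
    (LinearMap.mk₂'ₛₗ (starRingEnd ℂ) (RingHom.id ℂ) (fun f g : PreFock P => preInner f g)
      preInner_add_left preInner_smul_left preInner_add_right preInner_smul_right) 1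
    fun f g => by
      simpa using norm_preInner_le f g

theorem preInnerL_apply (f g : PreFock P) : preInnerL f g = preInner f g := rfl

variable (P) in
/-- The free product Hilbert `B`-module
`E = ξ B ⊕ ⨁ E°_{i₁} ⊗_B ⋯ ⊗_B E°_{iₙ}`, the sum over all `n ≥ 1` and all indices with
`i₁ ≠ i₂`, …, `iₙ₋₁ ≠ iₙ`, where `E_i = L²(A i, φ i)` and `E°_i` is the complement of `1 · B`:
the Hausdorff completion of the span of the elementary tensors. -/
abbrev Fock := UniformSpace.Completion (PreFock P)

/-- The `B`-valued inner product of the free product Hilbert module. -/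
noncomputable def fockInner : Fock P →L⋆[ℂ] Fock P →L[ℂ] B :=
  ContinuousLinearMap.fromCompletion
    ((LinearMap.mkContinuous
      { toFun := fun f : PreFock P => (preInnerL f).fromCompletion
        map_add' := fun f g => by
          ext x
          induction x using UniformSpace.Completion.induction_on with
          | hp => exact isClosed_eq (by fun_prop) (by fun_prop)
          | ih x => simp
        map_smul' := fun z f => by
          ext x
          induction x using UniformSpace.Completion.induction_on with
          | hp => exact isClosed_eq (by fun_prop) (by fun_prop)
          | ih x => simp } 1 (fun f => by
        rw [one_mul]
        refine ContinuousLinearMap.opNorm_le_bound _ f.norm_nonneg' fun x => ?_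
        induction x using UniformSpace.Completion.induction_on with
        | hp => exact isClosed_le (by fun_prop) (by fun_prop)
        | ih x => simpa [preInnerL_apply] using norm_preInner_le f x)) : PreFock P →L⋆[ℂ] Fock P →L[ℂ] B)

theorem fockInner_coe (f g : PreFock P) : fockInner (f : Fock P) (g : Fock P) = preInner f g := by
  simp [fockInner, preInnerL_apply]

theorem star_fockInner (x y : Fock P) : star (fockInner x y) = fockInner y x := by
  induction x, y using UniformSpace.Completion.induction_on₂ with
  | hp => exact isClosed_eq (by fun_prop) (by fun_prop)
  | ih x y => rw [fockInner_coe, fockInner_coe, star_preInner]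

theorem norm_fockInner_self (x : Fock P) : ‖fockInner x x‖ = ‖x‖ ^ 2 := by
  induction x using UniformSpace.Completion.induction_on with
  | hp => exact isClosed_eq (by fun_prop) (by fun_prop)
  | ih x => rw [fockInner_coe, UniformSpace.Completion.norm_coe, PreFock.norm_sq]

theorem norm_fockInner_le (x y : Fock P) : ‖fockInner x y‖ ≤ ‖x‖ * ‖y‖ := by
  induction x, y using UniformSpace.Completion.induction_on₂ with
  | hp => exact isClosed_le (by fun_prop) (by fun_prop)
  | ih x y =>
    rw [fockInner_coe, UniformSpace.Completion.norm_coe, UniformSpace.Completion.norm_coe]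
    exact norm_preInner_le x y

theorem fock_ext {x y : Fock P} (h : ∀ z, fockInner z x = fockInner z y) : x = y := by
  rw [← sub_eq_zero, ← norm_eq_zero, ← sq_eq_zero_iff, ← norm_fockInner_self, map_sub, h, sub_self,
    norm_zero]

theorem fock_ext_pre {x y : Fock P} (h : ∀ z : PreFock P, fockInner (z : Fock P) x = fockInner (z : Fock P) y) : x = y := by
  refine fock_ext fun z => ?_
  induction z using UniformSpace.Completion.induction_on with
  | hp => exact isClosed_eq (by fun_prop) (by fun_prop)
  | ih z => exact h z

end PreFockNorm

section Adjointable

variable {B : Type*} [CStarAlgebra B] [PartialOrder B] [StarOrderedRing B]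
  {I : Type*} {A : I → Type*} [∀ i, CStarAlgebra (A i)] (P : ∀ i, CondExpInclusion B (A i))

/-- The algebra of adjointable operators on the free product Hilbert module. (Such operators are
automatically right `B`-linear.) -/
def Adjointable : Subalgebra ℂ (Fock P →L[ℂ] Fock P) where
  carrier := {T | ∃ S : Fock P →L[ℂ] Fock P, ∀ x y, fockInner (T x) y = fockInner x (S y)}
  mul_mem' := by
    rintro T T' ⟨S, hS⟩ ⟨S', hS'⟩
    exact ⟨S' * S, fun x y => by
      rw [mul_apply_eq_comp, mul_apply_eq_comp, hS, hS']⟩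
  add_mem' := by
    rintro T T' ⟨S, hS⟩ ⟨S', hS'⟩
    exact ⟨S + S', fun x y => by simp [hS, hS']⟩
  algebraMap_mem' z := ⟨star z • 1, fun x y => by simp [Algebra.algebraMap_eq_smul_one]⟩

variable {P}

theorem adjoint_unique {T S S' : Fock P →L[ℂ] Fock P}
    (h : ∀ x y, fockInner (T x) y = fockInner x (S y))
    (h' : ∀ x y, fockInner (T x) y = fockInner x (S' y)) : S = S' := by
  ext y
  exact fock_ext fun z => by rw [← h, ← h']

namespace Adjointable

/-- The adjoint of an adjointable operator. -/
noncomputable def adj (T : Adjointable P) : Fock P →L[ℂ] Fock P := T.2.choose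

theorem fockInner_adj (T : Adjointable P) (x y : Fock P) :
    fockInner (T.1 x) y = fockInner x (adj T y) := T.2.choose_spec x y

theorem adj_fockInner (T : Adjointable P) (x y : Fock P) :
    fockInner (adj T x) y = fockInner x (T.1 y) := by
  rw [← star_fockInner, ← fockInner_adj, star_fockInner]

theorem adj_eq (T : Adjointable P) {S : Fock P →L[ℂ] Fock P}
    (h : ∀ x y, fockInner (T.1 x) y = fockInner x (S y)) : adj T = S :=
  adjoint_unique (fockInner_adj T) h

noncomputable instance : Star (Adjointable P) := ⟨fun T => ⟨adj T, T.1, adj_fockInner T⟩⟩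

theorem coe_star (T : Adjointable P) : ((star T : Adjointable P) : Fock P →L[ℂ] Fock P) = adj T :=
  rfl

noncomputable instance : StarRing (Adjointable P) where
  star_involutive T := Subtype.ext (adj_eq (star T) (adj_fockInner T))
  star_mul T S := Subtype.ext (adj_eq (T * S) fun x y => by
    rw [Subalgebra.coe_mul, Subalgebra.coe_mul, mul_apply_eq_comp,
      mul_apply_eq_comp, fockInner_adj, fockInner_adj, coe_star, coe_star])
  star_add T S := Subtype.ext (adj_eq (T + S) fun x y => by
    simp [coe_star, fockInner_adj])

instance : StarModule ℂ (Adjointable P) where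
  star_smul z T := Subtype.ext (adj_eq (z • T) fun x y => by
    simp [coe_star, fockInner_adj])

theorem norm_sq_apply_le (T : Adjointable P) (x : Fock P) :
    ‖T.1 x‖ ^ 2 ≤ ‖star T * T‖ * ‖x‖ ^ 2 := by
  rw [← norm_fockInner_self, fockInner_adj]
  have h : adj T (T.1 x) = (star T * T : Adjointable P).1 x := rfl
  rw [h]
  calc _ ≤ ‖x‖ * ‖(star T * T : Adjointable P).1 x‖ := norm_fockInner_le _ _
    _ ≤ ‖x‖ * (‖(star T * T : Adjointable P).1‖ * ‖x‖) := by
      gcongr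
      exact ContinuousLinearMap.le_opNorm _ _
    _ = ‖(star T * T : Adjointable P).1‖ * ‖x‖ ^ 2 := by ring

noncomputable instance : CStarRing (Adjointable P) where
  norm_mul_self_le T := by
    have h : ‖T‖ ≤ √‖star T * T‖ := by
      refine ContinuousLinearMap.opNorm_le_bound _ (Real.sqrt_nonneg _) fun x => ?_
      refine abs_le_of_sq_le_sq' ?_ (by positivity) |>.2
      rw [mul_pow, Real.sq_sqrt (norm_nonneg (star T * T))]
      exact norm_sq_apply_le T x
    calc ‖T‖ * ‖T‖ ≤ √‖star T * T‖ * √‖star T * T‖ := by gcongr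
      _ = _ := Real.mul_self_sqrt (norm_nonneg _)

instance : CompleteSpace (Adjointable P) := by
  refine Metric.complete_of_cauchySeq_tendsto fun u hu => ?_
  have hu1 : CauchySeq fun n => (u n).1 :=
    uniformContinuous_subtype_val.comp_cauchySeq hu
  have hu2 : CauchySeq fun n => (star (u n)).1 := by
    refine uniformContinuous_subtype_val.comp_cauchySeq (u := fun n => star (u n)) ?_
    rw [Metric.cauchySeq_iff] at hu ⊢
    intro ε hε
    obtain ⟨N, hN⟩ := hu ε hε
    refine ⟨N, fun m hm n hn => ?_⟩
    have e : star (u m) - star (u n) = star (u m - u n) := (star_sub (u m) (u n)).symm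
    calc dist (star (u m)) (star (u n)) = ‖star (u m) - star (u n)‖ := dist_eq_norm _ _
      _ = ‖u m - u n‖ := by rw [e]; exact norm_star (E := Adjointable P) _
      _ = dist (u m) (u n) := (dist_eq_norm _ _).symm
      _ < ε := hN m hm n hn
  obtain ⟨T, hT⟩ := cauchySeq_tendsto_of_complete hu1
  obtain ⟨S, hS⟩ := cauchySeq_tendsto_of_complete hu2
  have h (x y : Fock P) : fockInner (T x) y = fockInner x (S y) := by
    have h1 : Filter.Tendsto (fun n => fockInner ((u n).1 x) y) Filter.atTop
        (nhds (fockInner (T x) y)) := by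
      have := ((ContinuousLinearMap.apply ℂ (Fock P) x).continuous.tendsto T).comp hT
      exact (Continuous.tendsto (by fun_prop : Continuous fun z => fockInner z y) _).comp this
    have h2 : Filter.Tendsto (fun n => fockInner x ((star (u n)).1 y)) Filter.atTop
        (nhds (fockInner x (S y))) := by
      have := ((ContinuousLinearMap.apply ℂ (Fock P) y).continuous.tendsto S).comp hS
      exact ((fockInner x).continuous.tendsto _).comp this
    refine tendsto_nhds_unique h1 (h2.congr fun n => ?_)
    exact (fockInner_adj (u n) x y).symm
  exact ⟨⟨T, S, h⟩, tendsto_subtype_rng.mpr hT⟩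

noncomputable instance : CStarAlgebra (Adjointable P) where

end Adjointable

end Adjointable

section Action

variable {B : Type*} [CStarAlgebra B] [PartialOrder B] [StarOrderedRing B]
  {I : Type*} {A : I → Type*} [∀ i, CStarAlgebra (A i)] {P : ∀ i, CondExpInclusion B (A i)}

/-- The left action of `B` on elementary tensors:
`b · ξ = ξ · b` and `b · (x₁ ⊗ ⋯ ⊗ xₙ) = (b x₁) ⊗ x₂ ⊗ ⋯ ⊗ xₙ`. -/
noncomputable def leftMul (b : B) : Word P → PreFock P
  | ⟨[], h⟩ => tensor ⟨[], h⟩ b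
  | ⟨⟨i, a⟩ :: u, h⟩ =>
    tensor ⟨⟨i, ⟨(P i).incl b * a, by
      rw [LinearMap.mem_ker, exp_incl_mul, LinearMap.mem_ker.mp a.2, mul_zero]⟩⟩ :: u, by
        cases u with
        | nil => simp
        | cons y t => exact List.isChain_cons_cons.mpr (List.isChain_cons_cons.mp h)⟩ 1

/-- The tensor `â ⊗ u` for `a ∈ A i` and a word `u` not beginning in `A i`; with `φ` the
conditional expectation of `A i` it is `(a - φ a) ⊗ u + φ a · u`. -/
noncomputable def merge (i : I) (a : A i) (u : AvoidingWord P i) : PreFock P :=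
  tensor (consWord i ((P i).center a) u) 1 + leftMul ((P i).exp a) u.1

variable (P) in
/-- The action of `a ∈ A i` on the free product module before completion: it multiplies the head
in `A i`, that is, it acts as `a ⊗ 1` in the decomposition of `E` as `E_i ⊗_B E(i)`, with `E(i)`
spanned by the words not beginning in `A i`. -/
noncomputable def preAct (i : I) (a : A i) : PreFock P →ₗ[ℂ] PreFock P :=
  rightLift fun u => merge i (a * (split i u).1) (split i u).2

theorem preInner_tensor (u v : Word P) (b c : B) :
    preInner (tensor u b) (tensor v c) = star b * kernel u.1 1 v.1 * c := sesq_tensor _ _ _ _ _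

theorem preInner_leftMul (b c : B) (u v : Word P) :
    preInner (leftMul b u) (leftMul c v) = kernel u.1 (star b * c) v.1 := by
  obtain ⟨u, hu⟩ := u
  obtain ⟨v, hv⟩ := v
  cases u with
  | nil =>
    cases v with
    | nil => simp [leftMul, preInner_tensor, kernel]
    | cons y v => simp [leftMul, preInner_tensor, kernel]
  | cons x u =>
    cases v with
    | nil => simp [leftMul, preInner_tensor, kernel]
    | cons y v =>
      obtain ⟨i, a⟩ := x
      obtain ⟨j, c⟩ := y
      simp only [leftMul, preInner_tensor, kernel, star_one, one_mul, mul_one]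
      by_cases h : i = j
      · subst h
        rw [step_mk, step_mk]
        simp only [star_mul, map_mul, map_one, mul_one, mul_assoc, map_star]
      · rw [step_of_ne (by exact h), step_of_ne (by exact h)]

theorem preInner_cons_leftMul (i : I) (a : LinearMap.ker (P i).exp) (u v : AvoidingWord P i)
    (b c : B) : preInner (tensor (consWord i a u) b) (leftMul c v.1) = 0 := by
  obtain ⟨⟨v, hv⟩, h⟩ := v
  cases v with
  | nil => simp [leftMul, preInner_tensor, kernel, consWord]
  | cons y v =>
    simp only [leftMul, preInner_tensor, kernel, consWord]
    rw [step_of_ne (by exact (h y (by simp)).symm), kernel_zero, mul_zero, zero_mul]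

theorem preInner_leftMul_cons (i : I) (a : LinearMap.ker (P i).exp) (u v : AvoidingWord P i)
    (b c : B) : preInner (leftMul c v.1) (tensor (consWord i a u) b) = 0 := by
  rw [← star_preInner, preInner_cons_leftMul, star_zero]

theorem exp_center_mul_center (i : I) (a c : A i) :
    (P i).exp (star ((P i).center a : A i) * ((P i).center c : A i)) =
      (P i).exp (star a * c) - star ((P i).exp a) * (P i).exp c := by
  simp only [coe_center, star_sub, sub_mul, mul_sub, map_sub, ← map_star, exp_incl_mul,
    exp_mul_incl, exp_star, ← map_mul, exp_incl]
  simp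

theorem preInner_merge (i : I) (a c : A i) (u v : AvoidingWord P i) :
    preInner (merge i a u) (merge i c v) = kernel u.1.1 ((P i).exp (star a * c)) v.1.1 := by
  rw [merge, merge, preInner_add_left, preInner_add_right, preInner_add_right,
    preInner_cons_leftMul, preInner_leftMul_cons, preInner_leftMul, preInner_tensor]
  simp only [consWord, kernel, star_one, one_mul, mul_one, add_zero, zero_add]
  rw [step_mk, map_one, mul_one, exp_center_mul_center, ← kernel_add, sub_add_cancel]

theorem preInner_cons_zero (i : I) (u : AvoidingWord P i) (b : B) (g : PreFock P) :
    preInner (tensor (consWord i 0 u) b) g = 0 := by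
  induction g using PreFock.induction with
  | h0 => exact sesq_zero_right _ _
  | hadd f g hf hg => rw [preInner_add_right, hf, hg, add_zero]
  | ht v c =>
    obtain ⟨v, hv⟩ := v
    rw [preInner_tensor]
    cases v with
    | nil => simp [kernel, consWord]
    | cons y v =>
      have : step (⟨i, 0⟩ : Letter P) 1 y = 0 := by
        obtain ⟨j, c⟩ := y
        by_cases h : i = j
        · subst h
          rw [step_mk]
          simp
        · exact step_of_ne (by exact h) 1
      simp [kernel, consWord, this, kernel_zero]

theorem preInner_leftMul_zero (u : Word P) (g : PreFock P) : preInner (leftMul 0 u) g = 0 := by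
  have h1 : ‖leftMul (0 : B) u‖ = 0 := by
    have := PreFock.norm_sq (leftMul (0 : B) u)
    rwa [preInner_leftMul, mul_zero, kernel_zero, norm_zero, sq_eq_zero_iff] at this
  have h2 := norm_preInner_le (leftMul 0 u) g
  rw [h1, zero_mul] at h2
  exact norm_le_zero_iff.mp h2

theorem leftMul_one (u : Word P) : leftMul 1 u = tensor u 1 := by
  obtain ⟨u, hu⟩ := u
  cases u with
  | nil => rfl
  | cons x u =>
    obtain ⟨i, a⟩ := x
    simp only [leftMul, map_one, one_mul]

theorem center_coe (i : I) (a : LinearMap.ker (P i).exp) : (P i).center (a : A i) = a := by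
  ext
  rw [coe_center, LinearMap.mem_ker.mp a.2, map_zero, sub_zero]

theorem center_one (i : I) : (P i).center 1 = 0 := by
  ext
  rw [coe_center, exp_one, map_one, sub_self]
  rfl

/-- Splitting off the head of a word and putting it back gives the same vector. -/
theorem preInner_merge_split (i : I) (u : Word P) (g : PreFock P) :
    preInner (merge i (split i u).1 (split i u).2) g = preInner (tensor u 1) g := by
  obtain ⟨u, hu⟩ := u
  cases u with
  | nil =>
    rw [split, merge, preInner_add_left, center_one, preInner_cons_zero, exp_one, leftMul_one,
      zero_add]
  | cons x u =>
    by_cases h : x.1 = i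
    · obtain ⟨j, a⟩ := x
      obtain rfl : j = i := h
      rw [merge, preInner_add_left]
      simp only [split, dif_pos, Letter.at_self, center_coe]
      rw [LinearMap.mem_ker.mp a.2, preInner_leftMul_zero, add_zero]
      rfl
    · rw [merge, preInner_add_left]
      simp only [split, dif_neg h]
      rw [center_one, preInner_cons_zero, exp_one, leftMul_one, zero_add]

/-- The inner product `⟪f, d · g⟫` for `d ∈ A i`. -/
noncomputable def form (i : I) (d : A i) (f g : PreFock P) : B :=
  sesq (fun u v => kernel (split i u).2.1.1
    ((P i).exp (star (split i u).1 * d * (split i v).1)) (split i v).2.1.1) f g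

theorem preAct_tensor (i : I) (a : A i) (u : Word P) (b : B) :
    preAct P i a (tensor u b) = rightMul b (merge i (a * (split i u).1) (split i u).2) :=
  rightLift_tensor _ _ _

theorem preInner_preAct (i : I) (a c : A i) (f g : PreFock P) :
    preInner (preAct P i a f) (preAct P i c g) = form i (star a * c) f g := by
  induction f using PreFock.induction with
  | h0 => rw [map_zero]; exact (sesq_zero_left _ _).trans (sesq_zero_left _ _).symm
  | hadd f f' hf hf' =>
    rw [map_add, preInner_add_left, hf, hf', form, form, form, sesq_add_left]
  | ht u b =>
    induction g using PreFock.induction with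
    | h0 => rw [map_zero]; exact (sesq_zero_right _ _).trans (sesq_zero_right _ _).symm
    | hadd g g' hg hg' =>
      rw [map_add, preInner_add_right, hg, hg', form, form, form, sesq_add_right]
    | ht v d =>
      rw [preAct_tensor, preAct_tensor, preInner_rightMul, preInner_rightMul_left, preInner_merge,
        form, sesq_tensor, star_mul]
      simp only [mul_assoc]

theorem preInner_preAct_one (i : I) (f g : PreFock P) :
    preInner (preAct P i 1 f) g = preInner f g := by
  induction f using PreFock.induction with
  | h0 => rw [map_zero]
  | hadd f f' hf hf' => rw [map_add, preInner_add_left, hf, hf', preInner_add_left]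
  | ht u b =>
    rw [preAct_tensor, preInner_rightMul_left, one_mul, preInner_merge_split,
      ← preInner_rightMul_left, rightMul_tensor, one_mul]

theorem preInner_preAct_right (i : I) (c : A i) (f g : PreFock P) :
    preInner f (preAct P i c g) = form i c f g := by
  rw [← preInner_preAct_one i, preInner_preAct, star_one, one_mul]

theorem preInner_preAct_left (i : I) (a : A i) (f g : PreFock P) :
    preInner (preAct P i a f) g = preInner f (preAct P i (star a) g) := by
  rw [preInner_preAct_right, ← star_preInner, ← preInner_preAct_one i, star_preInner,
    preInner_preAct, mul_one]

theorem form_one (i : I) (f g : PreFock P) : form i 1 f g = preInner f g := by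
  rw [← preInner_preAct_one i, ← star_preInner, ← preInner_preAct_one i, star_preInner,
    preInner_preAct, star_one, one_mul]

theorem form_add (i : I) (d d' : A i) (f g : PreFock P) :
    form i (d + d') f g = form i d f g + form i d' f g := by
  simp only [form, sesq, mul_add, add_mul, map_add, kernel_add, Finsupp.sum,
    Finset.sum_add_distrib]

theorem form_smul (i : I) (z : ℂ) (d : A i) (f g : PreFock P) :
    form i (z • d) f g = z • form i d f g := by
  simp only [form, sesq, mul_smul_comm, smul_mul_assoc, map_smul, kernel_smul, Finsupp.sum,
    Finset.smul_sum]

theorem norm_preAct_le (i : I) (a : A i) (f : PreFock P) : ‖preAct P i a f‖ ≤ ‖a‖ * ‖f‖ := by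
  have h1 : preInner (preAct P i a f) (preAct P i a f) ≤ ((‖a‖ ^ 2 : ℝ) : ℂ) • preInner f f := by
    let _ := CStarAlgebra.spectralOrder (A i)
    have := CStarAlgebra.spectralOrderedRing (A i)
    have h2 : 0 ≤ ((‖a‖ ^ 2 : ℝ) : ℂ) • (1 : A i) + (-1 : ℂ) • (star a * a) := by
      have := IsSelfAdjoint.le_algebraMap_norm_self (a := star a * a) (IsSelfAdjoint.star_mul_self a)
      rw [CStarRing.norm_star_mul_self, ← pow_two, Algebra.algebraMap_eq_smul_one] at this
      rw [Complex.coe_smul, neg_smul, one_smul, ← sub_eq_add_neg]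
      exact sub_nonneg.mpr this
    obtain ⟨c, hc⟩ := exists_eq_star_mul_self h2
    have h3 := preInner_self_nonneg (preAct P i c f)
    rw [preInner_preAct, ← hc, form_add, form_smul, form_smul, form_one, ← preInner_preAct,
      neg_smul, one_smul, ← sub_eq_add_neg] at h3
    exact sub_nonneg.mp h3
  have h4 := CStarAlgebra.norm_le_norm_of_nonneg_of_le (preInner_self_nonneg _) h1
  rw [norm_smul, ← PreFock.norm_sq, ← PreFock.norm_sq, Complex.norm_real,
    Real.norm_of_nonneg (by positivity), ← mul_pow] at h4
  exact abs_le_of_sq_le_sq' h4 (by positivity) |>.2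

variable (P) in
/-- The action of `a ∈ A i` on the free product module. -/
noncomputable def act (i : I) (a : A i) : Fock P →L[ℂ] Fock P :=
  ((preAct P i a).mkContinuous ‖a‖ (norm_preAct_le i a)).completion

theorem act_coe (i : I) (a : A i) (f : PreFock P) :
    act P i a (f : Fock P) = (preAct P i a f : PreFock P) := by
  simp [act]

theorem fockInner_coe_act (i : I) (a : A i) (f g : PreFock P) :
    fockInner (f : Fock P) (act P i a (g : Fock P)) = form i a f g := by
  rw [act_coe, fockInner_coe, preInner_preAct_right]

theorem fockInner_act (i : I) (a : A i) (x y : Fock P) :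
    fockInner (act P i a x) y = fockInner x (act P i (star a) y) := by
  induction x, y using UniformSpace.Completion.induction_on₂ with
  | hp => exact isClosed_eq (by fun_prop) (by fun_prop)
  | ih x y =>
    rw [act_coe, act_coe, fockInner_coe, fockInner_coe, preInner_preAct_left]

theorem act_ext {S T : Fock P →L[ℂ] Fock P} (h : ∀ f g : PreFock P,
    fockInner (f : Fock P) (S (g : Fock P)) = fockInner (f : Fock P) (T (g : Fock P))) :
    S = T := by
  ext y
  induction y using UniformSpace.Completion.induction_on with
  | hp => exact isClosed_eq (by fun_prop) (by fun_prop)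
  | ih g => exact fock_ext_pre fun f => h f g

variable (P) in
/-- The representation of `A i` by adjointable operators on the free product module. -/
noncomputable def rep (i : I) : A i →⋆ₐ[ℂ] Adjointable P where
  toFun a := ⟨act P i a, act P i (star a), fockInner_act i a⟩
  map_one' := Subtype.ext (act_ext fun f g => by
    rw [fockInner_coe_act, form_one, ← fockInner_coe]
    rfl)
  map_mul' a b := Subtype.ext (act_ext fun f g => by
    rw [Subalgebra.coe_mul, mul_apply_eq_comp, fockInner_coe_act, ← star_star a, ← fockInner_act,
      star_star, act_coe, act_coe, fockInner_coe, preInner_preAct, star_star])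
  map_zero' := Subtype.ext (act_ext fun f g => by
    have : form i (0 : A i) f g = 0 := by simpa using form_smul i (0 : ℂ) 0 f g
    rw [fockInner_coe_act, this]
    simp)
  map_add' a b := Subtype.ext (act_ext fun f g => by
    rw [Subalgebra.coe_add, add_apply, map_add, fockInner_coe_act,
      fockInner_coe_act, fockInner_coe_act, form_add])
  commutes' z := Subtype.ext (act_ext fun f g => by
    rw [fockInner_coe_act, Algebra.algebraMap_eq_smul_one, form_smul, form_one, ← fockInner_coe]
    simp [Algebra.algebraMap_eq_smul_one])
  map_star' a := Subtype.ext ((Adjointable.adj_eq (P := P) ⟨act P i a, _⟩ (fockInner_act i a)).symm)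

end Action

section Algebra

variable {B : Type*} [CStarAlgebra B] [PartialOrder B] [StarOrderedRing B]
  {I : Type*} {A : I → Type*} [∀ i, CStarAlgebra (A i)] (P : ∀ i, CondExpInclusion B (A i))

/-- The underlying subalgebra of the reduced amalgamated free product: the C⋆-algebra of operators
on the free product Hilbert module generated by the images of all the algebras `A i`. -/
noncomputable def algebra : StarSubalgebra ℂ (Adjointable P) :=
  (StarAlgebra.adjoin ℂ (⋃ i, Set.range (rep P i))).topologicalClosure

instance : IsClosed (algebra P : Set (Adjointable P)) :=
  StarSubalgebra.isClosed_topologicalClosure _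

end Algebra

end AmalgamatedFreeProduct

section

variable {B : Type*} [CStarAlgebra B] [PartialOrder B] [StarOrderedRing B]
  {I : Type*} {A : I → Type*} [∀ i, CStarAlgebra (A i)] (P : ∀ i, CondExpInclusion B (A i))

/-- The reduced amalgamated free product C⋆-algebra of the family `(A i, φ i)` over `B`, for a
nonempty index set. -/
abbrev ReducedFreeProduct : Type _ := AmalgamatedFreeProduct.algebra P

noncomputable instance : CStarAlgebra (ReducedFreeProduct P) :=
  StarSubalgebra.cstarAlgebra (AmalgamatedFreeProduct.algebra P)

noncomputable instance : PartialOrder (ReducedFreeProduct P) := CStarAlgebra.spectralOrder _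

noncomputable instance : StarOrderedRing (ReducedFreeProduct P) :=
  CStarAlgebra.spectralOrderedRing _

/-- The canonical embedding of `A i` in the reduced amalgamated free product. -/
noncomputable def ReducedFreeProduct.embed (i : I) : A i →⋆ₐ[ℂ] ReducedFreeProduct P :=
  (AmalgamatedFreeProduct.rep P i).codRestrict _ fun a =>
    StarSubalgebra.le_topologicalClosure _
      (StarAlgebra.subset_adjoin ℂ _ (Set.mem_iUnion.mpr ⟨i, a, rfl⟩))

end

section Entropy

open scoped CStarAlgebra

/-- The rank of a finite dimensional C⋆-algebra: the dimension of its maximal abelian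
⋆-subalgebras, i.e. the largest dimension of a commutative ⋆-subalgebra. -/
noncomputable def cstarRank (D : Type*) [CStarAlgebra D] : ℕ :=
  sSup {d | ∃ S : StarSubalgebra ℂ D, (∀ x ∈ S, ∀ y ∈ S, x * y = y * x) ∧
    Module.finrank ℂ S = d}

variable {A : Type*} [CStarAlgebra A] [PartialOrder A] [StarOrderedRing A]
  {H : Type*} [NormedAddCommGroup H] [InnerProductSpace ℂ H] [CompleteSpace H]

/-- The completely positive `δ`-rank `rcp(π, ω, δ)`: the least rank of a nonzero finite dimensional
C⋆-algebra `D` admitting contractive completely positive maps `f : A → D` and `g : D → B(H)` with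
`‖g (f a) - π a‖ < δ` for all `a ∈ ω` (and `⊤` if there is none). Every finite dimensional
C⋆-algebra is isomorphic to one whose underlying type lies in `Type`. -/
noncomputable def cpRank (π : A →⋆ₙₐ[ℂ] (H →L[ℂ] H)) (ω : Set A) (δ : ℝ) : ℕ∞ :=
  sInf {r | ∃ (D : Type) (_ : CStarAlgebra D) (_ : PartialOrder D) (_ : StarOrderedRing D)
    (f : A →CP D) (g : D →CP (H →L[ℂ] H)),
    FiniteDimensional ℂ D ∧ Nontrivial D ∧ (∀ a, ‖f a‖ ≤ ‖a‖) ∧ (∀ d, ‖g d‖ ≤ ‖d‖) ∧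
    (∀ a ∈ ω, ‖g (f a) - π a‖ < δ) ∧ r = (cstarRank D : ℕ∞)}

/-- `ht(π, α, ω, δ)`: the upper exponential growth rate, as `n → ∞`, of
`rcp(π, ω ∪ α(ω) ∪ ⋯ ∪ αⁿ⁻¹(ω), δ)`. -/
noncomputable def cpEntropyAt (π : A →⋆ₙₐ[ℂ] (H →L[ℂ] H)) (α : A ≃⋆ₐ[ℂ] A) (ω : Set A)
    (δ : ℝ) : EReal :=
  ExpGrowth.expGrowthSup fun n : ℕ => (cpRank π (⋃ k ∈ Finset.range n, α^[k] '' ω) δ : ENNReal)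

/-- The Brown–Voiculescu topological entropy `ht(α)` of the automorphism `α`, computed in the
faithful representation `π` of `A`: the supremum of `ht(π, α, ω, δ)` over all finite subsets `ω`
of `A` and all `δ > 0`. -/
noncomputable def topologicalEntropy (π : A →⋆ₙₐ[ℂ] (H →L[ℂ] H)) (α : A ≃⋆ₐ[ℂ] A) : EReal :=
  ⨆ (ω : Finset A) (δ : ℝ) (_ : 0 < δ), cpEntropyAt π α (ω : Set A) δ

end Entropy

/-! The automorphism `γ` acts letter by letter on elementary tensors. The resulting isometry of the
free product module is linear over `B` only up to the twist `β`, and conjugation by it gives `γ`.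
Uniqueness holds because the algebras `A i` generate.

The entropy vanishes because the maps needed for `n` iterates factor through matrix algebras of size
polynomial in `n`. A finite set `ω` is approximated by polynomials in the algebras with index in a
finite set `F`, and `γ^k` moves these into the algebras with index in `σ^k(F)`. So it suffices to
approximate all `A i` with `i` in `J = ⋃ σ^k(F)`, `k < n`, at once; their dimensions add up to at
most a constant times `n`.

The approximation cuts words. Call the longest initial segment of a word with letters indexed by `J`
its `J`-prefix. An element `a` of `A i`, `i ∈ J`, changes the length of the `J`-prefix by at most
one. For fixed `N` and each `s < N` the prefix is cut at a position which, counted from its end, is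
congruent to `s` modulo `N`, leaving a head of at most `N` letters. Letting `a` act on heads alone
and gluing the tails back reproduces `a`, except between words whose tails have different `J`-prefix
lengths. For neighbouring prefix lengths at most one `s` is bad, so averaging over the `N` cuts
gives an error of norm at most `2‖a‖/N` (`IsWordFrame.norm_blockMap_sub_le`). The heads span a space
of dimension at most `(1 + ∑ dim A i)^N dim B` (`exists_wordSpace`), polynomial in `n` since `N`
does not depend on `n`.

Scalars replace `B` through the trace of its regular representation: it makes the module a Hilbert
space, and its dual bases satisfy `∑ e d = 1`, which turns an orthonormal basis into a `B`-valued
frame (`IsWordFrame.sum_mul_coe`). An arbitrary representation `π` is reached by a completely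
positive extension to all operators on that Hilbert space (`exists_kernelPositive_extension`).

Agreement with `π` on the generators passes to all elements by a quantitative multiplicative domain
argument (`tendsto_of_induction`). The estimates on generators do not depend on the iterate, so `N`
and `F` depend on `ω` and `δ` only. Polynomially bounded ranks have zero exponential growth, and
ranks are at least one. -/

section

open scoped CStarAlgebra ComplexOrder InnerProductSpace

/-! ### Completely positive maps into `B(H)` and their multiplicativity defect -/

section CompletePositivity

open AmalgamatedFreeProduct

theorem opNonneg_of_inner {H : Type*} [NormedAddCommGroup H] [InnerProductSpace ℂ H]
    [CompleteSpace H] {T : H →L[ℂ] H} (h : ∀ x, 0 ≤ ⟪x, T x⟫_ℂ) : 0 ≤ T := by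
  rw [ContinuousLinearMap.nonneg_iff_isPositive, ContinuousLinearMap.isPositive_iff_complex]
  intro x
  have h1 := h x
  have h2 : ⟪T x, x⟫_ℂ = ⟪x, T x⟫_ℂ := by
    rw [← inner_conj_symm]
    exact Complex.conj_eq_iff_im.mpr (Complex.nonneg_iff.mp h1).2.symm
  rw [h2]
  obtain ⟨h3, h4⟩ := Complex.nonneg_iff.mp h1
  exact ⟨Complex.ext rfl (by simpa using h4), h3⟩

variable {X : Type*} [CStarAlgebra X] {H : Type*} [NormedAddCommGroup H] [InnerProductSpace ℂ H]
  [CompleteSpace H]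

/-- Complete positivity of a linear map into `B(H)`, in terms of vectors. -/
def KernelPositive (φ : X →ₗ[ℂ] (H →L[ℂ] H)) : Prop :=
  ∀ (n : ℕ) (a : Fin n → X) (h : Fin n → H),
    0 ≤ ∑ i, ∑ j, ⟪h i, φ (star (a i) * a j) (h j)⟫_ℂ

namespace KernelPositive

variable {φ : X →ₗ[ℂ] (H →L[ℂ] H)}

omit [CompleteSpace H] in
theorem sum_nonneg (hφ : KernelPositive φ) {F : Type*} [Fintype F] (a : F → X) (h : F → H) :
    0 ≤ ∑ i, ∑ j, ⟪h i, φ (star (a i) * a j) (h j)⟫_ℂ := by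
  have e := Fintype.equivFin F
  have := hφ _ (a ∘ e.symm) (h ∘ e.symm)
  refine this.trans_eq ?_
  rw [← e.symm.sum_comp]
  refine Finset.sum_congr rfl fun i _ => ?_
  rw [← e.symm.sum_comp]
  rfl

theorem nonneg (hφ : KernelPositive φ) (a : X) : 0 ≤ φ (star a * a) :=
  opNonneg_of_inner fun x => by simpa using hφ.sum_nonneg (fun _ : Unit => a) fun _ => x

theorem map_star (hφ : KernelPositive φ) (a : X) : φ (star a) = star (φ a) := by
  let _ := CStarAlgebra.spectralOrder X
  have := CStarAlgebra.spectralOrderedRing X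
  obtain ⟨x, hx, -, h⟩ := CStarAlgebra.exists_sum_four_nonneg a
  have e (i : Fin 4) : star (φ (x i)) = φ (x i) := by
    obtain ⟨y, hy⟩ := CStarAlgebra.nonneg_iff_eq_star_mul_self.mp (hx i)
    rw [hy]
    exact IsSelfAdjoint.of_nonneg (hφ.nonneg y)
  rw [h]
  simp only [star_sum, map_sum, map_smul, star_smul, (hx _).isSelfAdjoint.star_eq, e]

theorem posKernel (hφ : KernelPositive φ) {F : Type*} [Fintype F] (a : F → X) :
    PosKernel fun i j => φ (star (a i) * a j) := by
  refine ⟨fun i j => by rw [← hφ.map_star, star_mul, star_star], fun c => opNonneg_of_inner fun x => ?_⟩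
  refine (hφ.sum_nonneg a fun i => c i x).trans_eq ?_
  simp only [sum_apply, inner_sum, mul_apply_eq_comp,
    ContinuousLinearMap.star_eq_adjoint, ContinuousLinearMap.adjoint_inner_right]

/-- The bundled completely positive map. -/
noncomputable def toCP [PartialOrder X] [StarOrderedRing X] (hφ : KernelPositive φ) :
    X →CP (H →L[ℂ] H) where
  toLinearMap := φ
  map_cstarMatrix_nonneg' k M hM := by
    obtain ⟨N, rfl⟩ := exists_eq_star_mul_self hM
    -- Entrywise, `φ` of `star N * N` is a sum over the rows of `N` of positive kernels; its Gram
    -- factorization exhibits the image as a positive matrix.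
    have h1 := PosKernel.sum Finset.univ fun l (_ : l ∈ Finset.univ) => hφ.posKernel fun i => N l i
    obtain ⟨N', hN'⟩ := h1.exists_gram
    have : (star N * N).map φ = star (CStarMatrix.ofMatrix N') * CStarMatrix.ofMatrix N' := by
      ext1 i j
      simp only [CStarMatrix.map_apply, CStarMatrix.mul_apply, CStarMatrix.star_apply, map_sum]
      exact hN' i j
    change 0 ≤ (star N * N).map φ
    rw [this]
    exact star_mul_self_nonneg _

theorem toCP_apply [PartialOrder X] [StarOrderedRing X] (hφ : KernelPositive φ) (a : X) :
    hφ.toCP a = φ a := rfl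

/-- The defect of multiplicativity is a positive kernel. -/
theorem posKernel_defect (hφ : KernelPositive φ) (h1 : φ 1 ≤ 1) {F : Type*} [Fintype F]
    (a : F → X) : PosKernel fun i j => φ (star (a i) * a j) - star (φ (a i)) * φ (a j) := by
  refine ⟨fun i j => by
    rw [star_sub, ← hφ.map_star, star_mul, star_star, star_mul, star_star], fun c => ?_⟩
  -- Completing the square: the unit is adjoined to the family with coefficient `-S`. The term `h4`
  -- makes up for `φ 1` being only at most `1`, and the sum of both is the form to be estimated.
  have h2 := (hφ.posKernel fun i : Option F => i.elim 1 a).2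
    fun i => i.elim (-∑ j, φ (a j) * c j) c
  set S := ∑ j, φ (a j) * c j with hS
  have h3 : star S = ∑ j, star (c j) * star (φ (a j)) := by simp [hS]
  have h4 : 0 ≤ star S * (1 - φ 1) * S := star_left_conjugate_nonneg (sub_nonneg.mpr h1) S
  have h5 := add_nonneg h2 h4
  have h6 : star (φ 1) = φ 1 := by rw [← hφ.map_star, star_one]
  refine h5.trans_eq ?_
  simp only [Fintype.sum_option, Option.elim, star_one, one_mul, mul_one, hφ.map_star]
  have e1 : ∑ x, star (-S) * φ (a x) * c x = - (star S * S) := by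
    simp only [star_neg, neg_mul, Finset.sum_neg_distrib, mul_assoc, ← Finset.mul_sum, ← hS]
  have e2 : ∑ x, star (c x) * star (φ (a x)) * -S = - (star S * S) := by
    simp only [mul_neg, Finset.sum_neg_distrib, ← Finset.sum_mul, ← h3]
  have e3 : ∑ i, ∑ j, star (c i) * (star (φ (a i)) * φ (a j)) * c j = star S * S := by
    rw [h3, hS, Finset.sum_mul_sum]
    simp only [mul_assoc]
  rw [Finset.sum_add_distrib, e1, e2]
  simp only [mul_sub, sub_mul, Finset.sum_sub_distrib, e3, star_neg, neg_mul, mul_neg, mul_one, h6]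
  abel

theorem star_mul_self_le (hφ : KernelPositive φ) (h1 : φ 1 ≤ 1) (a : X) :
    star (φ a) * φ a ≤ φ (star a * a) := by
  have := (hφ.posKernel_defect h1 fun _ : Unit => a).2 1
  simpa using this

theorem map_mono (hφ : KernelPositive φ) [PartialOrder X] [StarOrderedRing X] {a b : X}
    (h : a ≤ b) : φ a ≤ φ b := by
  obtain ⟨c, hc⟩ := exists_eq_star_mul_self (sub_nonneg.mpr h)
  have := hφ.nonneg c
  rw [← hc, map_sub] at this
  exact sub_nonneg.mp this

theorem norm_star_mul_self_le (hφ : KernelPositive φ) (h1 : φ 1 ≤ 1) (a : X) :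
    ‖φ (star a * a)‖ ≤ ‖a‖ ^ 2 := by
  let _ := CStarAlgebra.spectralOrder X
  have := CStarAlgebra.spectralOrderedRing X
  have h2 := IsSelfAdjoint.le_algebraMap_norm_self (a := star a * a) (IsSelfAdjoint.star_mul_self a)
  rw [CStarRing.norm_star_mul_self, ← pow_two, Algebra.algebraMap_eq_smul_one] at h2
  have h3 := hφ.map_mono h2
  rw [← Complex.coe_smul, map_smul, Complex.coe_smul] at h3
  have h4 : (‖a‖ ^ 2) • φ 1 ≤ (‖a‖ ^ 2) • (1 : H →L[ℂ] H) :=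
    smul_le_smul_of_nonneg_left h1 (sq_nonneg _)
  have h5 := CStarAlgebra.norm_le_norm_of_nonneg_of_le (hφ.nonneg a) (h3.trans h4)
  refine h5.trans ?_
  rw [norm_smul, Real.norm_of_nonneg (sq_nonneg _)]
  exact mul_le_of_le_one_right (sq_nonneg _) ContinuousLinearMap.norm_id_le

theorem norm_le (hφ : KernelPositive φ) (h1 : φ 1 ≤ 1) (a : X) : ‖φ a‖ ≤ ‖a‖ := by
  have h2 := CStarAlgebra.norm_le_norm_of_nonneg_of_le (star_mul_self_nonneg _)
    (hφ.star_mul_self_le h1 a)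
  rw [CStarRing.norm_star_mul_self, ← pow_two] at h2
  exact abs_le_of_sq_le_sq' (h2.trans (hφ.norm_star_mul_self_le h1 a)) (norm_nonneg _) |>.2

end KernelPositive

/-- Cauchy–Schwarz for the columns of a Gram factorization `M = N* N`: the diagonal entries control
the square sums of the columns, and the off-diagonal entries pair two columns. -/
theorem norm_sq_le_of_posKernel {F : Type*} [Fintype F] {M : F → F → (H →L[ℂ] H)}
    (hM : PosKernel M) (i j : F) : ‖M i j‖ ^ 2 ≤ ‖M i i‖ * ‖M j j‖ := by
  obtain ⟨N, hN⟩ := hM.exists_gram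
  have h1 (i : F) (x : H) : ∑ k, ‖N k i x‖ ^ 2 ≤ ‖M i i‖ * ‖x‖ ^ 2 := by
    have : (∑ k, ‖N k i x‖ ^ 2 : ℝ) = RCLike.re ⟪x, M i i x⟫_ℂ := by
      rw [hN]
      simp only [sum_apply, inner_sum, mul_apply_eq_comp,
        ContinuousLinearMap.star_eq_adjoint, ContinuousLinearMap.adjoint_inner_right, map_sum,
        inner_self_eq_norm_sq]
    rw [this]
    refine (RCLike.re_le_norm _).trans ((norm_inner_le_norm _ _).trans ?_)
    rw [pow_two, mul_comm, ← mul_assoc]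
    gcongr
    exact ContinuousLinearMap.le_opNorm _ _
  have h2 : ‖M i j‖ ≤ √(‖M i i‖ * ‖M j j‖) := by
    refine ContinuousLinearMap.opNorm_le_of_re_inner_le (by positivity) fun x y hx hy => ?_
    have : RCLike.re ⟪M i j x, y⟫_ℂ ≤ ∑ k, ‖N k j x‖ * ‖N k i y‖ := by
      rw [hN]
      simp only [sum_apply, sum_inner, mul_apply_eq_comp,
        ContinuousLinearMap.star_eq_adjoint, ContinuousLinearMap.adjoint_inner_left, map_sum]
      exact Finset.sum_le_sum fun k _ => (RCLike.re_le_norm _).trans (norm_inner_le_norm _ _)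
    refine this.trans (abs_le_of_sq_le_sq' ?_ (by positivity) |>.2)
    refine (Finset.sum_mul_sq_le_sq_mul_sq _ _ _).trans ?_
    have h3 := h1 j x
    have h4 := h1 i y
    rw [hx, one_pow, mul_one] at h3
    rw [hy, one_pow, mul_one] at h4
    rw [Real.sq_sqrt (by positivity), mul_comm ‖M i i‖]
    exact mul_le_mul h3 h4 (by positivity) (by positivity)
  calc _ ≤ √(‖M i i‖ * ‖M j j‖) ^ 2 := by gcongr
    _ = _ := Real.sq_sqrt (by positivity)

/-- A quantitative form of Choi's theorem on multiplicative domains. -/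
theorem KernelPositive.norm_defect_sq_le {φ : X →ₗ[ℂ] (H →L[ℂ] H)} (hφ : KernelPositive φ)
    (h1 : φ 1 ≤ 1) (x y : X) : ‖φ (x * y) - φ x * φ y‖ ^ 2 ≤
      ‖x‖ ^ 2 * ‖φ (star y * y) - star (φ y) * φ y‖ := by
  -- The quantity to be bounded is the off-diagonal entry of the defect kernel of the pair `star x`,
  -- `y`. The diagonal entry at `star x` is at most `φ (x * star x)`.
  have h := norm_sq_le_of_posKernel (hφ.posKernel_defect h1 ![star x, y]) 0 1
  simp only [Matrix.cons_val_zero, Matrix.cons_val_one, star_star, hφ.map_star] at h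
  refine h.trans ?_
  gcongr
  have h2 := hφ.posKernel_defect h1 fun _ : Unit => star x
  have h3 : 0 ≤ φ (x * star x) - φ x * star (φ x) := by
    simpa [hφ.map_star] using h2.2 1
  have h4 : φ (x * star x) - φ x * star (φ x) ≤ φ (star (star x) * star x) := by
    rw [star_star, sub_le_self_iff]
    exact mul_star_self_nonneg _
  refine (CStarAlgebra.norm_le_norm_of_nonneg_of_le h3 h4).trans ?_
  refine (hφ.norm_star_mul_self_le h1 _).trans_eq ?_
  rw [norm_star]

end CompletePositivity

end

section

open scoped CStarAlgebra ComplexOrder InnerProductSpace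

/-! ### Positive kernels over a pair of algebras, towards the extension theorem -/

section Extension

open AmalgamatedFreeProduct

theorem coe_norm_sq {H : Type*} [NormedAddCommGroup H] [InnerProductSpace ℂ H] (x : H) :
    ((‖x‖ ^ 2 : ℝ) : ℂ) = ⟪x, x⟫_ℂ := by
  rw [inner_self_eq_norm_sq_to_K]
  norm_cast

/-- With `a = P - R` the decomposition into orthogonal positive parts, `R a R = -R³`; its image is
both nonnegative and nonpositive, so injectivity gives `R³ = 0` and then `R = 0`. -/
theorem nonneg_of_map_nonneg {A L : Type*} [CStarAlgebra A] [PartialOrder A] [StarOrderedRing A]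
    [CStarAlgebra L] [PartialOrder L] [StarOrderedRing L] (ρ : A →⋆ₐ[ℂ] L)
    (hρ : Function.Injective ρ) {a : A} (ha : 0 ≤ ρ a) : 0 ≤ a := by
  have hs : IsSelfAdjoint a := hρ (by rw [map_star]; exact IsSelfAdjoint.of_nonneg ha)
  obtain ⟨P, R, hP, hR, hRP, hPR⟩ := exists_pos_sub_pos hs
  have hRs : star R = R := IsSelfAdjoint.of_nonneg hR
  have h1 : 0 ≤ ρ (R * a * R) := by
    have := star_left_conjugate_nonneg ha (ρ R)
    rwa [← map_star, hRs, ← map_mul, ← map_mul] at this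
  have h2 : 0 ≤ ρ (R * R * R) := by
    have := star_left_conjugate_nonneg hR R
    rw [hRs] at this
    exact map_nonneg ρ this
  have h3 : R * a * R = -(R * R * R) := by rw [← hPR, mul_sub, hRP, zero_sub, neg_mul]
  rw [h3, map_neg] at h1
  have h4 : R * R * R = 0 := hρ (by rw [map_zero]; exact le_antisymm (neg_nonneg.mp h1) h2)
  have h5 : R * R = 0 := by
    rw [← CStarRing.star_mul_self_eq_zero_iff, star_mul, hRs, ← mul_assoc, h4, zero_mul]
  have h6 : R = 0 := by rw [← CStarRing.star_mul_self_eq_zero_iff, hRs, h5]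
  rw [← hPR, h6, sub_zero]
  exact hP

namespace KernelExtension

variable {A : Type*} [CStarAlgebra A] {L : Type*} [CStarAlgebra L]
  {H : Type*} [NormedAddCommGroup H] [InnerProductSpace ℂ H]

/-- The evaluation of an `L`-valued kernel, supported on finitely many pairs of vectors, at a
linear map `H → L`. -/
noncomputable def ev (c : H →ₗ[ℂ] L) : (H × H →₀ L) →ₗ[ℂ] L :=
  Finsupp.lsum ℂ fun p => LinearMap.mulRight ℂ (c p.2) ∘ₗ LinearMap.mulLeft ℂ (star (c p.1))

theorem ev_single (c : H →ₗ[ℂ] L) (p : H × H) (T : L) :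
    ev c (Finsupp.single p T) = star (c p.1) * T * c p.2 := by
  simp [ev]

variable [PartialOrder L] [StarOrderedRing L]

variable (L H) in
/-- The cone of the kernels with positive real part. -/
def cone : PointedCone ℝ (H × H →₀ L) where
  carrier := {f | ∀ c : H →ₗ[ℂ] L, 0 ≤ ev c f + star (ev c f)}
  zero_mem' c := by simp
  add_mem' {f g} hf hg c := by
    refine (add_nonneg (hf c) (hg c)).trans_eq ?_
    rw [map_add, star_add]
    abel
  smul_mem' r f hf c := by
    have : ev c (r • f) = (r : ℝ) • ev c f := ((ev c).restrictScalars ℝ).map_smul (r : ℝ) f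
    rw [this, star_smul, star_trivial, ← smul_add]
    exact smul_nonneg r.2 (hf c)

theorem mem_cone_of_ev_nonneg {f : H × H →₀ L} (h : ∀ c : H →ₗ[ℂ] L, 0 ≤ ev c f) :
    f ∈ cone L H := fun c => add_nonneg (h c) (star_nonneg_iff.mpr (h c))

/-- Twice the real part of the evaluation at `c` is `|c h + T c k|² + |c h|² + |T c k|²`, with `|x|²
= star x * x`. -/
theorem single_add_mem_cone (h k : H) (T : L) :
    Finsupp.single (h, h) 1 + Finsupp.single (k, k) (star T * T) + Finsupp.single (h, k) T ∈
      cone L H := by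
  intro c
  simp only [map_add, ev_single, mul_one]
  refine (add_nonneg (star_mul_self_nonneg (c h + T * c k)) (add_nonneg
    (star_mul_self_nonneg (c h)) (star_mul_self_nonneg (T * c k)))).trans_eq ?_
  simp only [star_add, star_mul, star_star, mul_add, add_mul, mul_assoc]
  abel

/-- Scalar kernels dominate all kernels. This is the hypothesis of the M. Riesz extension theorem,
since scalar kernels come from `A`. -/
theorem exists_add_mem_cone (y : H × H →₀ L) :
    ∃ x : H × H →₀ ℂ, Finsupp.mapRange.linearMap (Algebra.linearMap ℂ L) x + y ∈ cone L H := by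
  induction y using Finsupp.induction_linear with
  | zero => exact ⟨0, by simp⟩
  | add f g hf hg =>
    obtain ⟨x, hx⟩ := hf
    obtain ⟨y, hy⟩ := hg
    refine ⟨x + y, ?_⟩
    have := add_mem hx hy
    rw [map_add]
    convert this using 1
    abel
  | single p T =>
    obtain ⟨h, k⟩ := p
    -- The weight `‖T‖²` at `(k, k)` dominates the `star T * T` of `single_add_mem_cone`.
    refine ⟨Finsupp.single (h, h) 1 + Finsupp.single (k, k) ((‖T‖ ^ 2 : ℝ) : ℂ), ?_⟩
    have h1 := single_add_mem_cone h k T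
    have h2 : Finsupp.single (k, k) (((‖T‖ ^ 2 : ℝ) : ℂ) • (1 : L) - star T * T) ∈ cone L H := by
      refine mem_cone_of_ev_nonneg fun c => ?_
      rw [ev_single]
      refine star_left_conjugate_nonneg (sub_nonneg.mpr ?_) _
      have := IsSelfAdjoint.le_algebraMap_norm_self (a := star T * T)
        (IsSelfAdjoint.star_mul_self T)
      rwa [CStarRing.norm_star_mul_self, ← pow_two, Algebra.algebraMap_eq_smul_one,
        ← Complex.coe_smul] at this
    have h3 := add_mem h1 h2
    convert h3 using 1
    rw [Finsupp.single_sub]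
    simp only [map_add, Finsupp.mapRange.linearMap_apply, Finsupp.mapRange_single,
      Algebra.linearMap_apply, Algebra.algebraMap_eq_smul_one, one_smul]
    abel

variable (ρ : A →⋆ₐ[ℂ] L)

/-- Kernels with values in `A`, viewed as kernels with values in `L`. -/
noncomputable def mapKernel : (H × H →₀ A) →ₗ[ℝ] (H × H →₀ L) :=
  Finsupp.mapRange.linearMap (ρ.toAlgHom.toLinearMap.restrictScalars ℝ)

omit [NormedAddCommGroup H] [InnerProductSpace ℂ H] in
omit [PartialOrder L] [StarOrderedRing L] in
theorem mapKernel_single (p : H × H) (a : A) :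
    mapKernel ρ (Finsupp.single p a) = Finsupp.single p (ρ a) := by
  simp [mapKernel]

omit [NormedAddCommGroup H] [InnerProductSpace ℂ H] in
omit [PartialOrder L] [StarOrderedRing L] in
theorem mapKernel_injective (hρ : Function.Injective ρ) :
    Function.Injective (mapKernel (H := H) ρ) :=
  Finsupp.mapRange_injective _ (map_zero ρ) hρ

variable [CompleteSpace H] (π : A →⋆ₙₐ[ℂ] (H →L[ℂ] H))

/-- The functional on the kernels with values in `A` given by a representation of `A`. -/
noncomputable def pairing : (H × H →₀ A) →ₗ[ℂ] ℂ :=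
  Finsupp.lsum ℂ fun p =>
    { toFun := fun a => ⟪p.1, π a p.2⟫_ℂ
      map_add' := fun a b => by simp
      map_smul' := fun z a => by simp }

theorem pairing_single (p : H × H) (a : A) :
    pairing π (Finsupp.single p a) = ⟪p.1, π a p.2⟫_ℂ := by
  simp [pairing]

/-- The matrix of a kernel in a family of vectors. -/
noncomputable def matrixIn {ι : Type*} (b : ι → H) (g : H × H →₀ A) (i j : ι) : A :=
  ∑ p ∈ g.support, (star ⟪b i, p.1⟫_ℂ * ⟪b j, p.2⟫_ℂ) • g p

-- Finite rank maps with coefficients in the image of `A` are the only test maps needed to recover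
-- positivity in matrices over `A`.
omit [PartialOrder L] [StarOrderedRing L] [CompleteSpace H] in
theorem ev_mapKernel {ι : Type*} [Fintype ι] (b : ι → H) (g : H × H →₀ A) (c : ι → A) :
    ev (∑ i, (innerₛₗ ℂ (b i)).smulRight (ρ (c i))) (mapKernel ρ g) =
      ρ (∑ i, ∑ j, star (c i) * matrixIn b g i j * c j) := by
  set c' : H →ₗ[ℂ] L := ∑ i, (innerₛₗ ℂ (b i)).smulRight (ρ (c i)) with hc
  have hc' (h : H) : c' h = ρ (∑ i, ⟪b i, h⟫_ℂ • c i) := by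
    simp [hc]
  have h1 : ev c' (mapKernel ρ g) = ∑ p ∈ g.support, star (c' p.1) * ρ (g p) * c' p.2 := by
    conv_lhs => rw [← g.sum_single, Finsupp.sum]
    simp only [map_sum, mapKernel_single, ev_single]
  rw [h1]
  simp only [hc', ← map_star, ← map_mul, ← map_sum, matrixIn]
  congr 1
  simp only [Finset.mul_sum, Finset.sum_mul, star_sum, star_smul, smul_mul_assoc,
    mul_smul_comm, smul_smul, Finset.smul_sum]
  rw [Finset.sum_comm_cycle]
  refine Finset.sum_congr rfl fun i _ => ?_
  rw [Finset.sum_comm]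
  refine Finset.sum_congr rfl fun j _ => Finset.sum_congr rfl fun p _ => ?_
  rw [mul_comm]

omit [CompleteSpace H] in
theorem posKernel_matrixIn [PartialOrder A] [StarOrderedRing A] (hρ : Function.Injective ρ)
    {ι : Type*} [Fintype ι] (b : ι → H) (g : H × H →₀ A) (hg : mapKernel ρ g ∈ cone L H) :
    PosKernel fun i j => matrixIn b g i j + star (matrixIn b g j i) := by
  refine ⟨fun i j => by rw [star_add, star_star, add_comm], fun c => ?_⟩
  refine nonneg_of_map_nonneg ρ hρ ?_
  have h3 : ∑ i, ∑ j, star (c i) * (matrixIn b g i j + star (matrixIn b g j i)) * c j =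
      (∑ i, ∑ j, star (c i) * matrixIn b g i j * c j) +
        star (∑ i, ∑ j, star (c i) * matrixIn b g i j * c j) := by
    simp only [mul_add, add_mul, Finset.sum_add_distrib, star_sum, star_mul, star_star,
      mul_assoc]
    congr 1
    exact Finset.sum_comm
  rw [h3, map_add, map_star, ← ev_mapKernel]
  exact hg _

theorem pairing_eq_sum {ι : Type*} [Fintype ι] (b : ι → H) (g : H × H →₀ A)
    (hb : ∀ p ∈ g.support, ∑ i, ⟪b i, p.1⟫_ℂ • b i = p.1 ∧ ∑ i, ⟪b i, p.2⟫_ℂ • b i = p.2) :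
    pairing π g = ∑ i, ∑ j, ⟪b i, π (matrixIn b g i j) (b j)⟫_ℂ := by
  conv_lhs => rw [← g.sum_single, Finsupp.sum]
  simp only [map_sum, matrixIn, map_smul, sum_apply, smul_apply, inner_sum,
    inner_smul_right]
  rw [Finset.sum_comm_cycle (s := Finset.univ)]
  refine Finset.sum_congr rfl fun p hp => ?_
  rw [pairing_single]
  conv_lhs => rw [← (hb p hp).1, ← (hb p hp).2]
  simp only [map_sum, map_smul, sum_inner, inner_sum, inner_smul_left, inner_smul_right,
    Finset.mul_sum]
  rw [Finset.sum_comm]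
  refine Finset.sum_congr rfl fun i _ => Finset.sum_congr rfl fun j _ => ?_
  rw [Complex.star_def]
  ring

/-- In an orthonormal basis of the span of the vectors involved, the kernel becomes a matrix over
`A` whose double real part is positive, hence of the form `N* N`. Twice the real part of the pairing
is then the sum of the squared norms of `∑ⱼ π(N k j) bⱼ`. -/
theorem re_pairing_nonneg (hρ : Function.Injective ρ) (g : H × H →₀ A)
    (hg : mapKernel ρ g ∈ cone L H) : 0 ≤ (pairing π g).re := by
  classical
  let _ := CStarAlgebra.spectralOrder A
  have := CStarAlgebra.spectralOrderedRing A
  let s : Finset H := g.support.image Prod.fst ∪ g.support.image Prod.snd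
  let S : Submodule ℂ H := Submodule.span ℂ (s : Set H)
  have hS : FiniteDimensional ℂ S := FiniteDimensional.span_finset ℂ s
  let b₀ := stdOrthonormalBasis ℂ S
  obtain ⟨b, hb⟩ : ∃ b : Fin (Module.finrank ℂ S) → H, b = fun i => (b₀ i : H) := ⟨_, rfl⟩
  have hexp (h : H) (hh : h ∈ S) : ∑ i, ⟪b i, h⟫_ℂ • b i = h := by
    have := congrArg Subtype.val (b₀.sum_repr' ⟨h, hh⟩)
    simpa [hb] using this
  have h1 (p : H × H) (hp : p ∈ g.support) : p.1 ∈ S ∧ p.2 ∈ S := by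
    constructor <;> refine Submodule.subset_span ?_
    · exact Finset.mem_coe.mpr (Finset.mem_union_left _ (Finset.mem_image_of_mem _ hp))
    · exact Finset.mem_coe.mpr (Finset.mem_union_right _ (Finset.mem_image_of_mem _ hp))
  obtain ⟨N, hN⟩ := (posKernel_matrixIn ρ hρ b g hg).exists_gram
  have h4 := pairing_eq_sum π b g fun p hp => ⟨hexp _ (h1 p hp).1, hexp _ (h1 p hp).2⟩
  have e2 : star (pairing π g) = ∑ i, ∑ j, ⟪b i, π (star (matrixIn b g j i)) (b j)⟫_ℂ := by
    rw [h4]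
    simp only [star_sum]
    refine Finset.sum_comm.trans (Finset.sum_congr rfl fun i _ => Finset.sum_congr rfl fun j _ => ?_)
    rw [map_star, ContinuousLinearMap.star_eq_adjoint, ContinuousLinearMap.adjoint_inner_right]
    exact inner_conj_symm (𝕜 := ℂ) _ _
  have h5 : pairing π g + star (pairing π g) = ∑ k, ((‖∑ j, π (N k j) (b j)‖ ^ 2 : ℝ) : ℂ) := by
    have e (k) : ((‖∑ j, π (N k j) (b j)‖ ^ 2 : ℝ) : ℂ) =
        ∑ i, ∑ j, ⟪b i, π (star (N k i) * N k j) (b j)⟫_ℂ := by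
      rw [coe_norm_sq]
      simp only [sum_inner, inner_sum, map_mul, map_star, mul_apply_eq_comp,
        ContinuousLinearMap.star_eq_adjoint, ContinuousLinearMap.adjoint_inner_right]
      rw [Finset.sum_comm]
    simp only [e]
    rw [← Finset.sum_comm_cycle, e2, h4, ← Finset.sum_add_distrib]
    refine Finset.sum_congr rfl fun i _ => ?_
    rw [← Finset.sum_add_distrib]
    refine Finset.sum_congr rfl fun j _ => ?_
    rw [← inner_add_right, ← add_apply, ← map_add, hN, map_sum, sum_apply, inner_sum]
  have h6 := congrArg Complex.re h5
  rw [Complex.add_re, Complex.star_def, Complex.conj_re, Complex.re_sum] at h6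
  have h7 : 0 ≤ ∑ k, (((‖∑ j, π (N k j) (b j)‖ ^ 2 : ℝ) : ℂ)).re :=
    Finset.sum_nonneg fun k _ => by rw [Complex.ofReal_re]; positivity
  linarith

end KernelExtension

end Extension

end

section

open scoped CStarAlgebra ComplexOrder InnerProductSpace

/-! ### Extending a representation to a completely positive map -/

section Extension

/-- Scaling both vectors to norm one turns the additive bound into a product bound. -/
theorem norm_le_of_sesquilinear {H : Type*} [NormedAddCommGroup H] [InnerProductSpace ℂ H]
    (b : H →ₗ⋆[ℂ] H →ₗ[ℂ] ℂ) {C D : ℝ} (hb : ∀ h k, ‖b h k‖ ≤ C * ‖h‖ ^ 2 + D * ‖k‖ ^ 2) (h k : H) :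
    ‖b h k‖ ≤ (C + D) * ‖h‖ * ‖k‖ := by
  by_cases hh : h = 0
  · simp [hh]
  by_cases hk : k = 0
  · simp [hk]
  have h1 := hb (((‖h‖⁻¹ : ℝ) : ℂ) • h) (((‖k‖⁻¹ : ℝ) : ℂ) • k)
  have hh' : ‖h‖ ≠ 0 := norm_ne_zero_iff.mpr hh
  have hk' : ‖k‖ ≠ 0 := norm_ne_zero_iff.mpr hk
  simp only [map_smulₛₗ, LinearMap.smul_apply, smul_eq_mul, norm_mul, norm_smul, RingHom.id_apply, Complex.conj_ofReal,
    Complex.norm_real, norm_inv, norm_norm, inv_mul_cancel₀ hh', inv_mul_cancel₀ hk', one_pow,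
    mul_one] at h1
  rw [inv_mul_le_iff₀ (by positivity), inv_mul_le_iff₀ (by positivity)] at h1
  refine h1.trans_eq ?_
  ring

namespace KernelExtension

variable {A : Type*} [CStarAlgebra A] {L : Type*} [CStarAlgebra L]
  {H : Type*} [NormedAddCommGroup H] [InnerProductSpace ℂ H] [CompleteSpace H]

/-- The M. Riesz extension theorem for the cone of kernels with positive real part: the functional
is given on the kernels coming from `A`, where it is positive by `re_pairing_nonneg`. -/
theorem exists_functional [PartialOrder L] [StarOrderedRing L] (ρ : A →⋆ₐ[ℂ] L)
    (hρ : Function.Injective ρ) (π : A →⋆ₙₐ[ℂ] (H →L[ℂ] H)) :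
    ∃ G : (H × H →₀ L) →ₗ[ℝ] ℝ, (∀ g, G (mapKernel ρ g) = (pairing π g).re) ∧
      ∀ f ∈ cone L H, 0 ≤ G f := by
  let e := LinearEquiv.ofInjective (mapKernel (H := H) ρ) (mapKernel_injective ρ hρ)
  let F : (H × H →₀ L) →ₗ.[ℝ] ℝ :=
    ⟨LinearMap.range (mapKernel ρ),
      Complex.reLm ∘ₗ (pairing π).restrictScalars ℝ ∘ₗ e.symm.toLinearMap⟩
  have hF (g : H × H →₀ A) (h : mapKernel ρ g ∈ F.domain) :
      F ⟨mapKernel ρ g, h⟩ = (pairing π g).re := by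
    change (pairing π (e.symm (e g))).re = _
    rw [e.symm_apply_apply]
  obtain ⟨G, hG1, hG2⟩ := riesz_extension (cone L H) F (by
    rintro ⟨_, g, rfl⟩ hg
    exact (re_pairing_nonneg ρ π hρ g hg).trans_eq (hF g ⟨g, rfl⟩).symm) (by
    intro y
    obtain ⟨x, hx⟩ := exists_add_mem_cone y
    refine ⟨⟨mapKernel ρ (Finsupp.mapRange.linearMap (Algebra.linearMap ℂ A) x), ⟨_, rfl⟩⟩, ?_⟩
    convert hx using 2
    ext p
    simp only [mapKernel, Finsupp.mapRange.linearMap_apply, Finsupp.mapRange_apply,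
      Algebra.linearMap_apply]
    exact AlgHomClass.commutes ρ _)
  refine ⟨G, fun g => ?_, hG2⟩
  rw [← hF g ⟨g, rfl⟩, ← hG1]

variable [PartialOrder L] [StarOrderedRing L] {G : (H × H →₀ L) →ₗ[ℝ] ℝ}

omit [CompleteSpace H] in
theorem functional_eq_zero (hG : ∀ f ∈ cone L H, 0 ≤ G f) {f : H × H →₀ L}
    (hf : ∀ c : H →ₗ[ℂ] L, ev c f + star (ev c f) = 0) : G f = 0 := by
  refine le_antisymm ?_ (hG f fun c => (hf c).ge)
  have : 0 ≤ G (-f) := hG (-f) fun c => by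
    rw [map_neg, star_neg, ← neg_add, hf, neg_zero]
  rw [map_neg] at this
  exact neg_nonneg.mp this

-- The functional sees a kernel only through its evaluations, because a kernel with vanishing
-- evaluations lies in the cone together with its negative. Sesquilinearity in the pair of vectors
-- follows, although the kernels themselves are free on pairs.
omit [CompleteSpace H] in
theorem extend_congr (hG : ∀ f ∈ cone L H, 0 ≤ G f) {f g : H × H →₀ L}
    (hf : ∀ c : H →ₗ[ℂ] L, ev c f = ev c g) :
    Module.Dual.extendRCLike (𝕜 := ℂ) G f = Module.Dual.extendRCLike (𝕜 := ℂ) G g := by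
  rw [← sub_eq_zero, ← map_sub, Module.Dual.extendRCLike_apply,
    functional_eq_zero hG fun c => by rw [map_sub, hf, sub_self, star_zero, add_zero],
    functional_eq_zero hG fun c => by
      rw [map_smul, map_sub, hf, sub_self, smul_zero, star_zero, add_zero]]
  simp

/-- The sesquilinear form `(h, k) ↦ ⟪h, Φ T k⟫` of the extended map. -/
noncomputable def form (hG : ∀ f ∈ cone L H, 0 ≤ G f) (T : L) : H →ₗ⋆[ℂ] H →ₗ[ℂ] ℂ :=
  LinearMap.mk₂'ₛₗ (starRingEnd ℂ) (RingHom.id ℂ)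
    (fun h k => Module.Dual.extendRCLike (𝕜 := ℂ) G (Finsupp.single (h, k) T))
    (fun h h' k => by
      rw [← map_add]
      exact extend_congr hG fun c => by simp only [map_add, ev_single, star_add, add_mul])
    (fun z h k => by
      rw [← map_smul]
      exact extend_congr hG fun c => by
        simp only [map_smul, ev_single, star_smul, smul_mul_assoc]
        rfl)
    (fun h k k' => by
      rw [← map_add]
      exact extend_congr hG fun c => by simp only [map_add, ev_single, mul_add])
    (fun z h k => by
      rw [← map_smul]
      exact extend_congr hG fun c => by
        simp only [map_smul, ev_single, mul_smul_comm, RingHom.id_apply])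

theorem form_apply (hG : ∀ f ∈ cone L H, 0 ≤ G f) (T : L) (h k : H) :
    form hG T h k = Module.Dual.extendRCLike (𝕜 := ℂ) G (Finsupp.single (h, k) T) := rfl

theorem form_re (hG : ∀ f ∈ cone L H, 0 ≤ G f) (T : L) (h k : H) :
    (form hG T h k).re = G (Finsupp.single (h, k) T) :=
  Module.Dual.re_extendRCLike_apply (𝕜 := ℂ) G _

theorem form_im (hG : ∀ f ∈ cone L H, 0 ≤ G f) (T : L) (h k : H) :
    (form hG T h k).im = - G (Finsupp.single (h, k) (Complex.I • T)) := by
  rw [← Finsupp.smul_single]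
  exact Module.Dual.im_extendRCLike_apply (𝕜 := ℂ) G _

omit [PartialOrder L] [StarOrderedRing L] in
theorem functional_single_one_le {ρ : A →⋆ₐ[ℂ] L} {π : A →⋆ₙₐ[ℂ] (H →L[ℂ] H)}
    (hG' : ∀ g, G (mapKernel ρ g) = (pairing π g).re) (h : H) :
    G (Finsupp.single (h, h) 1) ≤ ‖π 1‖ * ‖h‖ ^ 2 := by
  have := hG' (Finsupp.single (h, h) 1)
  rw [mapKernel_single, map_one, pairing_single] at this
  rw [this]
  refine (Complex.re_le_norm _).trans ((norm_inner_le_norm _ _).trans ?_)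
  rw [pow_two, mul_comm, ← mul_assoc]
  gcongr
  exact ContinuousLinearMap.le_opNorm _ _

/-- Positivity on `single_add_mem_cone`, for `T` and for `-T`, bounds the value at `(h, k)` by
values at diagonal pairs, and those are known from `π 1`. -/
theorem abs_functional_single_le (hG : ∀ f ∈ cone L H, 0 ≤ G f) {ρ : A →⋆ₐ[ℂ] L}
    {π : A →⋆ₙₐ[ℂ] (H →L[ℂ] H)} (hG' : ∀ g, G (mapKernel ρ g) = (pairing π g).re) (T : L)
    (h k : H) : |G (Finsupp.single (h, k) T)| ≤
      ‖π 1‖ * ‖h‖ ^ 2 + ‖π 1‖ * ‖T‖ ^ 2 * ‖k‖ ^ 2 := by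
  have h1 := functional_single_one_le hG' h
  have h2 : G (Finsupp.single (k, k) (star T * T)) ≤ ‖π 1‖ * ‖T‖ ^ 2 * ‖k‖ ^ 2 := by
    have h3 : 0 ≤ G (Finsupp.single (k, k) ((‖T‖ ^ 2) • (1 : L) - star T * T)) := by
      refine hG _ (mem_cone_of_ev_nonneg fun c => ?_)
      rw [ev_single]
      refine star_left_conjugate_nonneg (sub_nonneg.mpr ?_) _
      have := IsSelfAdjoint.le_algebraMap_norm_self (a := star T * T)
        (IsSelfAdjoint.star_mul_self T)
      rwa [CStarRing.norm_star_mul_self, ← pow_two, Algebra.algebraMap_eq_smul_one] at this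
    rw [Finsupp.single_sub, map_sub, ← Finsupp.smul_single, map_smul, smul_eq_mul] at h3
    nlinarith [functional_single_one_le hG' k, sq_nonneg ‖T‖]
  have h4 := hG _ (single_add_mem_cone h k T)
  have h5 := hG _ (single_add_mem_cone h k (-T))
  rw [map_add, map_add] at h4 h5
  rw [Finsupp.single_neg, map_neg, star_neg, neg_mul_neg] at h5
  rw [abs_le]
  constructor <;> linarith

theorem norm_form_le (hG : ∀ f ∈ cone L H, 0 ≤ G f) {ρ : A →⋆ₐ[ℂ] L}
    {π : A →⋆ₙₐ[ℂ] (H →L[ℂ] H)} (hG' : ∀ g, G (mapKernel ρ g) = (pairing π g).re) (T : L)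
    (h k : H) : ‖form hG T h k‖ ≤
      (2 * ‖π 1‖ + 2 * (‖π 1‖ * ‖T‖ ^ 2)) * ‖h‖ * ‖k‖ := by
  refine norm_le_of_sesquilinear _ (fun h k => ?_) h k
  refine (Complex.norm_le_abs_re_add_abs_im _).trans ?_
  rw [form_re, form_im, abs_neg]
  have h1 := abs_functional_single_le hG hG' T h k
  have h2 := abs_functional_single_le hG hG' (Complex.I • T) h k
  rw [norm_smul, Complex.norm_I, one_mul] at h2
  linarith

end KernelExtension

open KernelExtension in
/-- A representation of a C⋆-algebra extends to a completely positive map on any larger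
C⋆-algebra (a case of Arveson's extension theorem). -/
theorem exists_kernelPositive_extension {A : Type*} [CStarAlgebra A] {L : Type*} [CStarAlgebra L]
    {H : Type*} [NormedAddCommGroup H] [InnerProductSpace ℂ H] [CompleteSpace H]
    (ρ : A →⋆ₐ[ℂ] L) (hρ : Function.Injective ρ) (π : A →⋆ₙₐ[ℂ] (H →L[ℂ] H)) :
    ∃ Φ : L →ₗ[ℂ] (H →L[ℂ] H), KernelPositive Φ ∧ ∀ a, Φ (ρ a) = π a := by
  let _ := CStarAlgebra.spectralOrder L
  have := CStarAlgebra.spectralOrderedRing L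
  obtain ⟨G, hG', hG⟩ := exists_functional ρ hρ π
  -- The Riesz representation places the operator in the first argument; the adjoint moves it to the
  -- second.
  let Φ₀ (T : L) : H →L[ℂ] H := ContinuousLinearMap.adjoint
    (InnerProductSpace.continuousLinearMapOfBilin
      ((form hG T).mkContinuous₂ _ (norm_form_le hG hG' T)))
  have h0 (T : L) (h k : H) : ⟪h, Φ₀ T k⟫_ℂ = form hG T h k := by
    rw [ContinuousLinearMap.adjoint_inner_right,
      InnerProductSpace.continuousLinearMapOfBilin_apply]
    rfl
  let Φ : L →ₗ[ℂ] (H →L[ℂ] H) :=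
    { toFun := Φ₀
      map_add' := fun S T => by
        ext k
        refine ext_inner_left ℂ fun h => ?_
        rw [add_apply, inner_add_right, h0, h0, h0, form_apply, form_apply, form_apply,
          Finsupp.single_add, map_add]
      map_smul' := fun z T => by
        ext k
        refine ext_inner_left ℂ fun h => ?_
        rw [smul_apply, inner_smul_right, h0, h0, form_apply, form_apply, ← Finsupp.smul_single,
          map_smul]
        rfl }
  refine ⟨Φ, fun n a h => ?_, fun a => ?_⟩
  · let f : H × H →₀ L := ∑ i, ∑ j, Finsupp.single (h i, h j) (star (a i) * a j)
    have hf : ∑ i, ∑ j, ⟪h i, Φ (star (a i) * a j) (h j)⟫_ℂ =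
        Module.Dual.extendRCLike (𝕜 := ℂ) G f := by
      simp only [f, map_sum]
      exact Finset.sum_congr rfl fun i _ => Finset.sum_congr rfl fun j _ => h0 _ _ _
    have hev (c : H →ₗ[ℂ] L) : ev c f = star (∑ i, a i * c (h i)) * ∑ i, a i * c (h i) := by
      simp only [f, map_sum, ev_single, star_sum, star_mul, Finset.sum_mul_sum, mul_assoc]
    rw [hf]
    refine Complex.nonneg_iff.mpr ⟨?_, ?_⟩
    · refine (hG f (mem_cone_of_ev_nonneg fun c => ?_)).trans_eq
        (Module.Dual.re_extendRCLike_apply (𝕜 := ℂ) G _).symm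
      rw [hev]
      exact star_mul_self_nonneg _
    -- The evaluations of `f` are self-adjoint, so those of `I • f` have zero real part and the
    -- functional vanishes there.
    · refine Eq.trans ?_ (Module.Dual.im_extendRCLike_apply (𝕜 := ℂ) G _).symm
      rw [functional_eq_zero hG fun c => ?_, neg_zero]
      rw [map_smul, hev, star_smul, star_mul, star_star]
      simp
  · ext k
    refine ext_inner_left ℂ fun h => ?_
    change ⟪h, Φ₀ (ρ a) k⟫_ℂ = _
    rw [h0]
    have h1 := hG' (Finsupp.single (h, k) a)
    have h2 := hG' (Finsupp.single (h, k) (Complex.I • a))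
    rw [mapKernel_single, pairing_single] at h1 h2
    refine Complex.ext ?_ ?_
    · rw [form_re, h1]
    · rw [form_im, ← map_smul ρ, h2, map_smul, smul_apply, inner_smul_right]
      simp

end Extension

end

section

/-! ### The automorphism induced on the free product -/

section FamilyAutomorphism

open AmalgamatedFreeProduct

/-- A permutation of the index set together with compatible isomorphisms of the algebras and an
automorphism of the amalgam, intertwining the conditional expectations. -/
structure FamilyAut {B : Type*} [CStarAlgebra B] [PartialOrder B] [StarOrderedRing B]
    {I : Type*} {A : I → Type*} [∀ i, CStarAlgebra (A i)] (P : ∀ i, CondExpInclusion B (A i)) where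
  /-- the permutation of the index set -/
  perm : Equiv.Perm I
  /-- the isomorphisms of the algebras -/
  iso : ∀ i, A i ≃⋆ₐ[ℂ] A (perm i)
  /-- the automorphism of the amalgam -/
  base : B ≃⋆ₐ[ℂ] B
  iso_incl : ∀ i b, iso i ((P i).incl b) = (P (perm i)).incl (base b)
  exp_iso : ∀ i a, (P (perm i)).exp (iso i a) = base ((P i).exp a)

namespace FamilyAut

variable {B : Type*} [CStarAlgebra B] [PartialOrder B] [StarOrderedRing B]
  {I : Type*} {A : I → Type*} [∀ i, CStarAlgebra (A i)] {P : ∀ i, CondExpInclusion B (A i)}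
  (θ : FamilyAut P)

/-- The action on letters. -/
def letterMap (x : Letter P) : Letter P :=
  ⟨θ.perm x.1, ⟨θ.iso x.1 x.2, by
    rw [LinearMap.mem_ker, θ.exp_iso, LinearMap.mem_ker.mp x.2.2, map_zero]⟩⟩

theorem letterMap_surjective : Function.Surjective θ.letterMap := by
  rintro ⟨j, c, hc⟩
  obtain ⟨i, rfl⟩ := θ.perm.surjective j
  obtain ⟨a, rfl⟩ : ∃ a, θ.iso i a = c := EquivLike.surjective (θ.iso i) c
  refine ⟨⟨i, a, ?_⟩, rfl⟩
  rw [LinearMap.mem_ker, θ.exp_iso] at hc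
  exact (map_eq_zero_iff θ.base (EquivLike.injective θ.base)).mp hc

/-- The action on words. -/
def wordMap (w : Word P) : Word P :=
  ⟨w.1.map θ.letterMap, by
    rw [List.isChain_map]
    exact w.2.imp fun x y h e => h (θ.perm.injective e)⟩

theorem wordMap_surjective : Function.Surjective θ.wordMap := by
  rintro ⟨w, hw⟩
  obtain ⟨v, rfl⟩ := List.map_surjective_iff.mpr θ.letterMap_surjective w
  refine ⟨⟨v, ?_⟩, rfl⟩
  rw [List.isChain_map] at hw
  exact hw.imp fun x y h e => h (congrArg θ.perm e)

/-- The action on the words that do not begin in a given algebra. -/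
def avoidMap (i : I) (w : AvoidingWord P i) : AvoidingWord P (θ.perm i) :=
  ⟨θ.wordMap w.1, fun x hx => by
    obtain ⟨⟨w, hw⟩, h⟩ := w
    cases w with
    | nil => simp [wordMap] at hx
    | cons y t =>
      have : x = θ.letterMap y := by simpa [wordMap] using hx.symm
      rw [this]
      exact fun e => h y (by simp) (θ.perm.injective e)⟩

theorem step_letterMap (x y : Letter P) (b : B) :
    step (θ.letterMap x) (θ.base b) (θ.letterMap y) = θ.base (step x b y) := by
  obtain ⟨i, a⟩ := x
  obtain ⟨j, c⟩ := y
  by_cases h : i = j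
  · subst h
    rw [letterMap, letterMap, step_mk, step_mk]
    simp only [← θ.iso_incl, ← map_star, ← map_mul, θ.exp_iso]
  · rw [step_of_ne (x := ⟨i, a⟩) (by exact h),
      step_of_ne (x := θ.letterMap ⟨i, a⟩) (by exact fun e => h (θ.perm.injective e)), map_zero]

theorem kernel_map (u v : List (Letter P)) (b : B) :
    kernel (u.map θ.letterMap) (θ.base b) (v.map θ.letterMap) = θ.base (kernel u b v) := by
  induction u generalizing v b with
  | nil => cases v <;> simp [kernel]
  | cons x u ih => cases v <;> simp [kernel, step_letterMap, ih]

/-- The permutation of indices is injective, so a word begins in `A i` exactly when its image begins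
in the algebra with the permuted index. -/
theorem split_wordMap (i : I) (w : Word P) :
    split (θ.perm i) (θ.wordMap w) = (θ.iso i (split i w).1, θ.avoidMap i (split i w).2) := by
  obtain ⟨w, hw⟩ := w
  cases w with
  | nil => simp [wordMap, split, avoidMap]
  | cons x u =>
    by_cases h : x.1 = i
    · obtain ⟨j, a⟩ := x
      obtain rfl : j = i := h
      have h1 : (θ.letterMap ⟨j, a⟩).1 = θ.perm j := rfl
      simp only [wordMap, List.map_cons, split, dif_pos, h1, Letter.at_self, avoidMap]
      exact Prod.ext (Letter.at_self (θ.perm j) (θ.letterMap ⟨j, a⟩).2) rfl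
    · have h1 : (θ.letterMap x).1 ≠ θ.perm i := fun e => h (θ.perm.injective e)
      simp only [wordMap, List.map_cons, split, dif_neg h, dif_neg h1, map_one, avoidMap]

/-- The action on the pre-Hilbert module. -/
noncomputable def preMap : PreFock P →ₗ[ℂ] PreFock P :=
  lift fun u => tensor (θ.wordMap u) ∘ₗ
    ({ toFun := θ.base, map_add' := map_add _, map_smul' := map_smul _ } : B →ₗ[ℂ] B)

theorem preMap_tensor (u : Word P) (b : B) :
    θ.preMap (tensor u b) = tensor (θ.wordMap u) (θ.base b) := by
  simp [preMap, lift_tensor]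

theorem preMap_surjective : Function.Surjective θ.preMap := fun f => by
  induction f using PreFock.induction with
  | h0 => exact ⟨0, map_zero _⟩
  | hadd f g hf hg =>
    obtain ⟨x, rfl⟩ := hf
    obtain ⟨y, rfl⟩ := hg
    exact ⟨x + y, map_add _ _ _⟩
  | ht u b =>
    obtain ⟨v, rfl⟩ := θ.wordMap_surjective u
    obtain ⟨c, rfl⟩ := θ.base.surjective b
    exact ⟨tensor v c, θ.preMap_tensor v c⟩

theorem sesq_preMap {k k' : Word P → Word P → B}
    (h : ∀ u v, k' (θ.wordMap u) (θ.wordMap v) = θ.base (k u v)) (f g : PreFock P) :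
    sesq k' (θ.preMap f) (θ.preMap g) = θ.base (sesq k f g) := by
  induction f using PreFock.induction with
  | h0 => rw [map_zero, sesq_zero_left, sesq_zero_left, map_zero]
  | hadd f f' hf hf' => rw [map_add, sesq_add_left, sesq_add_left, hf, hf', map_add]
  | ht u b =>
    induction g using PreFock.induction with
    | h0 => rw [map_zero, sesq_zero_right, sesq_zero_right, map_zero]
    | hadd g g' hg hg' => rw [map_add, sesq_add_right, sesq_add_right, hg, hg', map_add]
    | ht v c =>
      rw [preMap_tensor, preMap_tensor, sesq_tensor, sesq_tensor, h, map_mul, map_mul, map_star]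

theorem preInner_preMap (f g : PreFock P) :
    preInner (θ.preMap f) (θ.preMap g) = θ.base (preInner f g) :=
  θ.sesq_preMap (fun u v => by
    rw [← θ.kernel_map, map_one]
    rfl) f g

theorem form_preMap (i : I) (a : A i) (f g : PreFock P) :
    form (θ.perm i) (θ.iso i a) (θ.preMap f) (θ.preMap g) = θ.base (form i a f g) :=
  θ.sesq_preMap (fun u v => by
    rw [split_wordMap, split_wordMap, ← θ.kernel_map, ← θ.exp_iso, map_mul (θ.iso i),
      map_mul (θ.iso i), map_star (θ.iso i)]
    rfl) f g

theorem norm_base (b : B) : ‖θ.base b‖ = ‖b‖ :=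
  NonUnitalStarAlgHom.norm_map θ.base θ.base.injective b

theorem norm_iso (i : I) (a : A i) : ‖θ.iso i a‖ = ‖a‖ :=
  NonUnitalStarAlgHom.norm_map (θ.iso i) (θ.iso i).injective a

theorem norm_preMap (f : PreFock P) : ‖θ.preMap f‖ = ‖f‖ := by
  refine (sq_eq_sq₀ (norm_nonneg _) (norm_nonneg _)).mp ?_
  rw [PreFock.norm_sq, PreFock.norm_sq, preInner_preMap, norm_base]

/-- The action on the free product module. -/
noncomputable def fockMap : Fock P →L[ℂ] Fock P :=
  (θ.preMap.mkContinuous 1 fun f => by rw [norm_preMap, one_mul]).completion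

theorem fockMap_coe (f : PreFock P) : θ.fockMap (f : Fock P) = (θ.preMap f : PreFock P) := by
  simp [fockMap]

theorem continuous_base : Continuous θ.base :=
  AddMonoidHomClass.continuous_of_bound θ.base 1 fun b => by rw [norm_base, one_mul]

theorem fockInner_fockMap (x y : Fock P) :
    fockInner (θ.fockMap x) (θ.fockMap y) = θ.base (fockInner x y) := by
  have := θ.continuous_base
  induction x, y using UniformSpace.Completion.induction_on₂ with
  | hp => exact isClosed_eq (by fun_prop) (by fun_prop)
  | ih x y => rw [fockMap_coe, fockMap_coe, fockInner_coe, fockInner_coe, preInner_preMap]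

theorem norm_fockMap (x : Fock P) : ‖θ.fockMap x‖ = ‖x‖ := by
  refine (sq_eq_sq₀ (norm_nonneg _) (norm_nonneg _)).mp ?_
  rw [← norm_fockInner_self, ← norm_fockInner_self, fockInner_fockMap, norm_base]

theorem fockMap_surjective : Function.Surjective θ.fockMap := by
  have h1 : Isometry θ.fockMap := AddMonoidHomClass.isometry_of_norm _ θ.norm_fockMap
  have h2 : IsClosed (Set.range θ.fockMap) := h1.isClosedEmbedding.isClosed_range
  intro x
  induction x using UniformSpace.Completion.induction_on with
  | hp => exact h2
  | ih f =>
    obtain ⟨g, rfl⟩ := θ.preMap_surjective f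
    exact ⟨g, θ.fockMap_coe g⟩

/-- The isometry of the free product module. -/
noncomputable def fockEquiv : Fock P ≃ₗᵢ[ℂ] Fock P :=
  LinearIsometryEquiv.ofSurjective ⟨θ.fockMap.toLinearMap, θ.norm_fockMap⟩ θ.fockMap_surjective

theorem fockEquiv_coe (f : PreFock P) : θ.fockEquiv (f : Fock P) = (θ.preMap f : PreFock P) :=
  θ.fockMap_coe f

theorem fockInner_fockEquiv (x y : Fock P) :
    fockInner (θ.fockEquiv x) (θ.fockEquiv y) = θ.base (fockInner x y) :=
  θ.fockInner_fockMap x y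

/-- Conjugation by an isometry. -/
noncomputable def conjL (T : Fock P →L[ℂ] Fock P) : Fock P →L[ℂ] Fock P :=
  (θ.fockEquiv : Fock P →L[ℂ] Fock P) ∘L T ∘L (θ.fockEquiv.symm : Fock P →L[ℂ] Fock P)

theorem conjL_apply (T : Fock P →L[ℂ] Fock P) (x : Fock P) :
    θ.conjL T x = θ.fockEquiv (T (θ.fockEquiv.symm x)) := rfl

/-- The isometry changes inner products by `θ.base`. The twist appears on both sides, so conjugation
still carries adjoint pairs to adjoint pairs. -/
theorem fockInner_conjL {T S : Fock P →L[ℂ] Fock P}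
    (h : ∀ x y, fockInner (T x) y = fockInner x (S y)) (x y : Fock P) :
    fockInner (θ.conjL T x) y = fockInner x (θ.conjL S y) := by
  obtain ⟨x, rfl⟩ := θ.fockEquiv.surjective x
  obtain ⟨y, rfl⟩ := θ.fockEquiv.surjective y
  rw [conjL_apply, conjL_apply, θ.fockEquiv.symm_apply_apply, θ.fockEquiv.symm_apply_apply,
    fockInner_fockEquiv, fockInner_fockEquiv, h]

/-- Conjugation as a ⋆-homomorphism. -/
noncomputable def conjHom : Adjointable P →⋆ₐ[ℂ] Adjointable P where
  toFun T := ⟨θ.conjL T.1, θ.conjL (Adjointable.adj T),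
    θ.fockInner_conjL (Adjointable.fockInner_adj T)⟩
  map_one' := Subtype.ext (by ext x; simp [conjL_apply])
  map_mul' S T := Subtype.ext (by
    ext x
    simp [conjL_apply])
  map_zero' := Subtype.ext (by ext x; simp [conjL_apply])
  map_add' S T := Subtype.ext (by
    ext x
    simp [conjL_apply])
  commutes' z := Subtype.ext (by
    ext x
    simp [conjL_apply, Algebra.algebraMap_eq_smul_one])
  map_star' T := Subtype.ext ((Adjointable.adj_eq (P := P) ⟨θ.conjL T.1, _⟩
    (θ.fockInner_conjL (Adjointable.fockInner_adj T))).symm)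

theorem conjHom_apply (T : Adjointable P) (x : Fock P) :
    (θ.conjHom T).1 x = θ.fockEquiv (T.1 (θ.fockEquiv.symm x)) := rfl

theorem conjHom_injective : Function.Injective θ.conjHom := fun S T h => by
  refine Subtype.ext (ContinuousLinearMap.ext fun x => θ.fockEquiv.injective ?_)
  have := congrArg (fun R : Adjointable P => R.1 (θ.fockEquiv x)) h
  simpa only [conjHom_apply, θ.fockEquiv.symm_apply_apply] using this

theorem fockInner_symm (x y : Fock P) :
    fockInner (θ.fockEquiv.symm x) (θ.fockEquiv.symm y) = θ.base.symm (fockInner x y) := by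
  obtain ⟨x, rfl⟩ := θ.fockEquiv.surjective x
  obtain ⟨y, rfl⟩ := θ.fockEquiv.surjective y
  rw [fockInner_fockEquiv, θ.fockEquiv.symm_apply_apply, θ.fockEquiv.symm_apply_apply]
  exact (θ.base.symm_apply_apply _).symm

theorem conjHom_surjective : Function.Surjective θ.conjHom := fun T => by
  let c (S : Fock P →L[ℂ] Fock P) : Fock P →L[ℂ] Fock P :=
    (θ.fockEquiv.symm : Fock P →L[ℂ] Fock P) ∘L S ∘L (θ.fockEquiv : Fock P →L[ℂ] Fock P)
  have hc (S : Fock P →L[ℂ] Fock P) (x : Fock P) :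
    c S x = θ.fockEquiv.symm (S (θ.fockEquiv x)) := rfl
  refine ⟨⟨c T.1, c (Adjointable.adj T), fun x y => ?_⟩, Subtype.ext (ContinuousLinearMap.ext
    fun x => ?_)⟩
  · obtain ⟨x, rfl⟩ := θ.fockEquiv.symm.surjective x
    obtain ⟨y, rfl⟩ := θ.fockEquiv.symm.surjective y
    rw [hc, hc, fockInner_symm, fockInner_symm, θ.fockEquiv.apply_symm_apply,
      θ.fockEquiv.apply_symm_apply, Adjointable.fockInner_adj]
  · rw [conjHom_apply]
    change θ.fockEquiv (c T.1 _) = _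
    rw [hc, θ.fockEquiv.apply_symm_apply, θ.fockEquiv.apply_symm_apply]

theorem conjHom_rep (i : I) (a : A i) :
    θ.conjHom (rep P i a) = rep P (θ.perm i) (θ.iso i a) := by
  refine Subtype.ext (act_ext fun f g => ?_)
  obtain ⟨f, rfl⟩ := θ.preMap_surjective f
  obtain ⟨g, rfl⟩ := θ.preMap_surjective g
  have h1 : fockInner (θ.preMap f : Fock P) ((rep P (θ.perm i) (θ.iso i a)).1 (θ.preMap g)) =
      form (θ.perm i) (θ.iso i a) (θ.preMap f) (θ.preMap g) := fockInner_coe_act _ _ _ _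
  rw [h1, conjHom_apply, ← fockEquiv_coe, ← fockEquiv_coe, θ.fockEquiv.symm_apply_apply,
    fockInner_fockEquiv, form_preMap]
  exact congrArg θ.base (fockInner_coe_act _ _ _ _)

/-- Conjugation as an automorphism. -/
noncomputable def conjEquiv : Adjointable P ≃⋆ₐ[ℂ] Adjointable P :=
  StarAlgEquiv.ofBijective θ.conjHom ⟨θ.conjHom_injective, θ.conjHom_surjective⟩

theorem conjEquiv_rep (i : I) (a : A i) :
    θ.conjEquiv (rep P i a) = rep P (θ.perm i) (θ.iso i a) := θ.conjHom_rep i a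

theorem conjEquiv_symm_rep (i : I) (a : A i) :
    ∃ (j : I) (c : A j), θ.conjEquiv.symm (rep P i a) = rep P j c := by
  obtain ⟨j, rfl⟩ := θ.perm.surjective i
  obtain ⟨c, rfl⟩ : ∃ c, θ.iso j c = a := EquivLike.surjective (θ.iso j) a
  exact ⟨j, c, by rw [← conjEquiv_rep]; exact θ.conjEquiv.symm_apply_apply _⟩

omit θ in
theorem map_mem_algebra (φ : Adjointable P →⋆ₐ[ℂ] Adjointable P)
    (hφ : ∀ (i : I) (a : A i), ∃ (j : I) (c : A j), φ (rep P i a) = rep P j c)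
    {T : Adjointable P} (hT : T ∈ algebra P) : φ T ∈ algebra P := by
  have h : algebra P ≤ (algebra P).comap φ := by
    refine StarSubalgebra.topologicalClosure_minimal (StarAlgebra.adjoin_le ?_) ?_
    · intro x hx
      obtain ⟨i, a, rfl⟩ := Set.mem_iUnion.mp hx
      obtain ⟨j, c, h⟩ := hφ i a
      change φ (rep P i a) ∈ algebra P
      rw [h]
      exact StarSubalgebra.le_topologicalClosure _
        (StarAlgebra.subset_adjoin ℂ _ (Set.mem_iUnion.mpr ⟨j, c, rfl⟩))
    · have h1 : Continuous φ := AddMonoidHomClass.continuous_of_bound φ 1 fun T => by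
        rw [one_mul]
        exact NonUnitalStarAlgHom.norm_apply_le φ T
      have h2 : IsClosed (algebra P : Set (Adjointable P)) := inferInstance
      exact h2.preimage h1
  exact h hT

/-- The endomorphism of the reduced amalgamated free product. -/
noncomputable def freeProductHom : ReducedFreeProduct P →⋆ₐ[ℂ] ReducedFreeProduct P :=
  (θ.conjHom.comp (algebra P).subtype).codRestrict (algebra P) fun T =>
    map_mem_algebra θ.conjHom (fun i a => ⟨_, _, θ.conjHom_rep i a⟩) T.2

theorem coe_freeProductHom (T : ReducedFreeProduct P) :
    (θ.freeProductHom T : Adjointable P) = θ.conjHom T := rfl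

theorem freeProductHom_bijective : Function.Bijective θ.freeProductHom := by
  refine ⟨fun S T h => Subtype.ext (θ.conjHom_injective ?_), fun T => ?_⟩
  · rw [← coe_freeProductHom, h, coe_freeProductHom]
  · refine ⟨⟨θ.conjEquiv.symm T.1, map_mem_algebra θ.conjEquiv.symm.toStarAlgHom
      θ.conjEquiv_symm_rep T.2⟩, Subtype.ext ?_⟩
    rw [coe_freeProductHom]
    exact θ.conjEquiv.apply_symm_apply T.1

/-- The automorphism of the reduced amalgamated free product. -/
noncomputable def freeProductAut : ReducedFreeProduct P ≃⋆ₐ[ℂ] ReducedFreeProduct P :=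
  StarAlgEquiv.ofBijective θ.freeProductHom θ.freeProductHom_bijective

theorem freeProductAut_embed (i : I) (a : A i) :
    θ.freeProductAut (ReducedFreeProduct.embed P i a) =
      ReducedFreeProduct.embed P (θ.perm i) (θ.iso i a) :=
  Subtype.ext (θ.conjHom_rep i a)

end FamilyAut

end FamilyAutomorphism

/-! ### Generation by products of letters -/

section Induction

open AmalgamatedFreeProduct

variable {B : Type*} [CStarAlgebra B] [PartialOrder B] [StarOrderedRing B]
  {I : Type*} {A : I → Type*} [∀ i, CStarAlgebra (A i)] {P : ∀ i, CondExpInclusion B (A i)}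

/-- The reduced free product is the closed span of the products of elements of the algebras. -/
theorem ReducedFreeProduct.induction {p : ReducedFreeProduct P → Prop}
    (hclosed : IsClosed {x | p x}) (hone : p 1) (hadd : ∀ x y, p x → p y → p (x + y))
    (hsmul : ∀ (z : ℂ) x, p x → p (z • x))
    (hmul : ∀ x (i : I) (a : A i), p x → p (x * ReducedFreeProduct.embed P i a))
    (x : ReducedFreeProduct P) : p x := by
  set s : Set (Adjointable P) := ⋃ i, Set.range (rep P i) with hs
  -- The generating set is self-adjoint, so the star algebra it generates is the linear span of
  -- products of generators.
  have hss : s ∪ star s = s := by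
    refine Set.union_eq_self_of_subset_right fun x hx => ?_
    obtain ⟨i, a, h⟩ := Set.mem_iUnion.mp (Set.mem_star.mp hx)
    refine Set.mem_iUnion.mpr ⟨i, star a, ?_⟩
    rw [map_star, h, star_star]
  have hle (T : Adjointable P) (hT : T ∈ StarAlgebra.adjoin ℂ s) : T ∈ algebra P :=
    StarSubalgebra.le_topologicalClosure _ hT
  have h1 (T : Adjointable P) (hT : T ∈ Submonoid.closure s) : ∃ h : T ∈ algebra P, p ⟨T, h⟩ := by
    induction hT using Submonoid.closure_induction_right with
    | one => exact ⟨one_mem _, hone⟩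
    | mul_right T _ S hS hp =>
      obtain ⟨h, hp⟩ := hp
      obtain ⟨i, a, rfl⟩ := Set.mem_iUnion.mp hS
      exact ⟨_, hmul _ i a hp⟩
  have h2 (T : Adjointable P) (hT : T ∈ StarAlgebra.adjoin ℂ s) :
      ∃ h : T ∈ algebra P, p ⟨T, h⟩ := by
    have hT' : T ∈ Algebra.adjoin ℂ s := by
      rw [← hss, ← StarAlgebra.adjoin_toSubalgebra]
      exact hT
    rw [← Subalgebra.mem_toSubmodule, Algebra.adjoin_eq_span] at hT'
    clear hT
    induction hT' using Submodule.span_induction with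
    | mem T hT => exact h1 T hT
    | zero =>
      refine ⟨zero_mem _, ?_⟩
      have := hsmul 0 1 hone
      rwa [zero_smul] at this
    | add S T _ _ hS hT =>
      obtain ⟨h, hS⟩ := hS
      obtain ⟨h', hT⟩ := hT
      exact ⟨_, hadd _ _ hS hT⟩
    | smul z T _ hT =>
      obtain ⟨h, hT⟩ := hT
      exact ⟨_, hsmul z _ hT⟩
  have h3 : x ∈ closure {y : ReducedFreeProduct P | y.1 ∈ StarAlgebra.adjoin ℂ s} := by
    rw [Topology.IsInducing.subtypeVal.closure_eq_preimage_closure_image]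
    refine closure_mono ?_ x.2
    exact fun T hT => ⟨⟨T, hle T hT⟩, hT, rfl⟩
  refine closure_minimal (fun y hy => ?_) hclosed h3
  obtain ⟨_, hp⟩ := h2 y.1 hy
  exact hp

/-- The hypothesis `hs` is the induction principle for a generating set, stated abstractly so that
the proof does not involve the construction of the free product. -/
theorem StarAlgEquiv.ext_of_induction {X : Type*} [CStarAlgebra X] (s : Set X)
    (hs : ∀ p : X → Prop, IsClosed {x | p x} → p 1 → (∀ x y, p x → p y → p (x + y)) →
      (∀ (z : ℂ) x, p x → p (z • x)) → (∀ x, ∀ a ∈ s, p x → p (x * a)) → ∀ x, p x)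
    {φ ψ : X ≃⋆ₐ[ℂ] X} (h : ∀ a ∈ s, φ a = ψ a) : φ = ψ := by
  have hc (χ : X ≃⋆ₐ[ℂ] X) : Continuous χ :=
    AddMonoidHomClass.continuous_of_bound χ 1 fun T => by
      rw [one_mul]
      exact NonUnitalStarAlgHom.norm_apply_le χ T
  refine StarAlgEquiv.ext (hs _ (isClosed_eq (hc φ) (hc ψ)) ?_ ?_ ?_ ?_)
  · rw [map_one, map_one]
  · intro x y hx hy
    rw [map_add, map_add, hx, hy]
  · intro z x hx
    rw [map_smul, map_smul, hx]
  · intro x a ha hx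
    rw [map_mul, map_mul, hx, h a ha]

/-- Automorphisms of the reduced free product are determined by their values on the algebras. -/
theorem ReducedFreeProduct.aut_ext {φ ψ : ReducedFreeProduct P ≃⋆ₐ[ℂ] ReducedFreeProduct P}
    (h : ∀ (i : I) (a : A i),
      φ (ReducedFreeProduct.embed P i a) = ψ (ReducedFreeProduct.embed P i a)) : φ = ψ := by
  refine StarAlgEquiv.ext_of_induction
    {x | ∃ (i : I) (a : A i), x = ReducedFreeProduct.embed P i a} ?_ ?_
  · intro p h1 h2 h3 h4 h5
    exact ReducedFreeProduct.induction h1 h2 h3 h4 fun x i a => h5 x _ ⟨i, a, rfl⟩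
  · rintro _ ⟨i, a, rfl⟩
    exact h i a

end Induction

end

section

open scoped ComplexOrder InnerProductSpace

/-! ### The trace of the regular representation of a finite dimensional C⋆-algebra -/

section RegularTrace

variable {B : Type*} [CStarAlgebra B] [FiniteDimensional ℂ B]

variable (B) in
/-- The trace of the regular representation. -/
noncomputable def regularTrace : B →ₗ[ℂ] ℂ :=
  LinearMap.trace ℂ B ∘ₗ LinearMap.mul ℂ B

omit [FiniteDimensional ℂ B] in
theorem regularTrace_apply (b : B) :
    regularTrace B b = LinearMap.trace ℂ B (LinearMap.mulLeft ℂ b) := rfl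

omit [FiniteDimensional ℂ B] in
theorem regularTrace_mul_comm (b c : B) : regularTrace B (b * c) = regularTrace B (c * b) := by
  rw [regularTrace_apply, regularTrace_apply, LinearMap.mulLeft_mul, LinearMap.mulLeft_mul]
  exact LinearMap.trace_mul_comm ℂ _ _

theorem exists_norm_regularTrace_le : ∃ C : ℝ, 0 ≤ C ∧ ∀ b, ‖regularTrace B b‖ ≤ C * ‖b‖ :=
  ⟨‖LinearMap.toContinuousLinearMap (regularTrace B)‖, norm_nonneg _, fun b =>
    (LinearMap.toContinuousLinearMap (regularTrace B)).le_opNorm b⟩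

variable [PartialOrder B] [StarOrderedRing B]

/-- The eigenvalues of left multiplication by `b` lie in the spectrum of `b`, hence are nonnegative,
and the trace is their sum. One of them is `‖b‖`: if `‖b‖ - b` acts invertibly by left
multiplication, it is invertible. -/
theorem regularTrace_nonneg_and_norm_le {b : B} (hb : 0 ≤ b) :
    0 ≤ regularTrace B b ∧ ‖b‖ ≤ (regularTrace B b).re := by
  have h1 : regularTrace B b = (LinearMap.mulLeft ℂ b).charpoly.roots.sum :=
    Module.End.trace_eq_sum_roots_charpoly_of_splits (IsAlgClosed.splits _)
  have h2 (z : ℂ) (hz : z ∈ (LinearMap.mulLeft ℂ b).charpoly.roots) : 0 ≤ z := by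
    have h3 : z ∈ spectrum ℂ (LinearMap.mulLeft ℂ b) :=
      (Module.End.mem_spectrum_iff_isRoot_charpoly _ _).mpr (Polynomial.isRoot_of_mem_roots hz)
    have h4 : z ∈ spectrum ℂ b := AlgHom.spectrum_apply_subset (Algebra.lmul ℂ B) b h3
    have h5 := hb.isSelfAdjoint.mem_spectrum_eq_re h4
    have h6 : z.re ∈ spectrum ℝ b := by
      rw [h5] at h4
      exact spectrum.of_algebraMap_mem ℂ h4
    rw [h5]
    exact Complex.zero_le_real.mpr (spectrum_nonneg_of_nonneg hb h6)
  have h7 : 0 ≤ regularTrace B b := by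
    rw [h1]
    exact Multiset.sum_nonneg h2
  refine ⟨h7, ?_⟩
  cases subsingleton_or_nontrivial B with
  | inl h =>
    rw [Subsingleton.elim b 0]
    simp
  | inr h =>
    have h8 : (‖b‖ : ℂ) ∈ spectrum ℂ b :=
      spectrum.algebraMap_mem ℂ (CStarAlgebra.norm_mem_spectrum_of_nonneg hb)
    have h9 : (‖b‖ : ℂ) ∈ spectrum ℂ (LinearMap.mulLeft ℂ b) := by
      intro h
      refine h8 ?_
      have : algebraMap ℂ (Module.End ℂ B) (‖b‖ : ℂ) - LinearMap.mulLeft ℂ b =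
          Algebra.lmul ℂ B (algebraMap ℂ B (‖b‖ : ℂ) - b) := by
        rw [map_sub, AlgHom.commutes]
        rfl
      have h' : IsUnit (algebraMap ℂ (Module.End ℂ B) (‖b‖ : ℂ) - LinearMap.mulLeft ℂ b) := h
      rw [this] at h'
      exact Algebra.lmul_isUnit_iff.mp h'
    have h10 : (‖b‖ : ℂ) ∈ (LinearMap.mulLeft ℂ b).charpoly.roots :=
      (Polynomial.mem_roots (LinearMap.charpoly_monic _).ne_zero).mpr
        ((Module.End.mem_spectrum_iff_isRoot_charpoly _ _).mp h9)
    have h11 := Multiset.single_le_sum h2 _ h10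
    rw [← h1] at h11
    exact (Complex.le_def.mp h11).1

theorem regularTrace_star (b : B) : regularTrace B (star b) = star (regularTrace B b) := by
  obtain ⟨x, hx, -, h⟩ := CStarAlgebra.exists_sum_four_nonneg b
  have e (i : Fin 4) : star (regularTrace B (x i)) = regularTrace B (x i) :=
    Complex.conj_eq_iff_im.mpr
      (Complex.nonneg_iff.mp (regularTrace_nonneg_and_norm_le (hx i)).1).2.symm
  rw [h]
  simp only [star_sum, map_sum, map_smul, star_smul, (hx _).isSelfAdjoint.star_eq, e]

omit [PartialOrder B] [StarOrderedRing B] in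
theorem eq_of_regularTrace_mul {b c : B}
    (h : ∀ x, regularTrace B (x * b) = regularTrace B (x * c)) : b = c := by
  let _ := CStarAlgebra.spectralOrder B
  have := CStarAlgebra.spectralOrderedRing B
  have h1 := h (star (b - c))
  rw [← sub_eq_zero, ← map_sub, ← mul_sub] at h1
  have h2 := (regularTrace_nonneg_and_norm_le (star_mul_self_nonneg (b - c))).2
  rw [h1, Complex.zero_re] at h2
  exact sub_eq_zero.mp ((CStarRing.star_mul_self_eq_zero_iff _).mp (norm_le_zero_iff.mp h2))

omit [PartialOrder B] [StarOrderedRing B] in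
variable (B) in
/-- Dual bases for the trace of the regular representation. -/
theorem exists_dual_bases : ∃ (n : ℕ) (e d : Fin n → B),
    (∀ x y, ∑ i, regularTrace B (x * e i) * regularTrace B (d i * y) = regularTrace B (x * y)) ∧
      ∑ i, e i * d i = 1 := by
  let T : LinearMap.BilinForm ℂ B := (LinearMap.mul ℂ B).compr₂ (regularTrace B)
  have hT (x y : B) : T x y = regularTrace B (x * y) := rfl
  have hnd : T.Nondegenerate := by
    constructor
    · intro x hx
      refine eq_of_regularTrace_mul fun y => ?_
      rw [regularTrace_mul_comm, ← hT, hx, mul_zero, map_zero]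
    · intro x hx
      refine eq_of_regularTrace_mul fun y => ?_
      rw [← hT, hx, mul_zero, map_zero]
  let e := Module.finBasis ℂ B
  let d := T.dualBasis hnd e
  have hexp (y : B) (i) : regularTrace B (d i * y) = e.repr y i := by
    conv_lhs => rw [← e.sum_repr y, Finset.mul_sum]
    simp only [map_sum, mul_smul_comm, map_smul]
    rw [Finset.sum_eq_single i]
    · rw [← hT, LinearMap.BilinForm.apply_dualBasis_left, if_pos rfl, smul_eq_mul, mul_one]
    · intro j _ hj
      rw [← hT, LinearMap.BilinForm.apply_dualBasis_left, if_neg hj, smul_zero]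
    · simp
  refine ⟨_, e, d, fun x y => ?_, eq_of_regularTrace_mul fun b => ?_⟩
  · simp only [hexp]
    conv_rhs => rw [← e.sum_repr y, Finset.mul_sum]
    simp only [map_sum, mul_smul_comm, map_smul, smul_eq_mul]
    exact Finset.sum_congr rfl fun i _ => mul_comm _ _
  -- Written out in the basis `e`, the trace of left multiplication by `b` is `∑ τ(d i * b * e i) =
  -- τ(b * ∑ e i * d i)`, so the definition of the regular trace `τ` forces `∑ e i * d i = 1`.
  · rw [Finset.mul_sum, map_sum, mul_one, regularTrace_apply,
      LinearMap.trace_eq_matrix_trace ℂ e, Matrix.trace]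
    refine Finset.sum_congr rfl fun i _ => ?_
    rw [← mul_assoc, regularTrace_mul_comm, hexp, Matrix.diag_apply, LinearMap.toMatrix_apply]
    rfl

end RegularTrace

open AmalgamatedFreeProduct

/-! ### The free product module as a Hilbert space -/

section HilbertFock

variable {B : Type*} [CStarAlgebra B] [PartialOrder B] [StarOrderedRing B]
  {I : Type*} {A : I → Type*} [∀ i, CStarAlgebra (A i)] (P : ∀ i, CondExpInclusion B (A i))

theorem fockInner_self_nonneg {P : ∀ i, CondExpInclusion B (A i)} (x : Fock P) :
    0 ≤ fockInner x x := by
  induction x using UniformSpace.Completion.induction_on with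
  | hp => exact isClosed_le (by fun_prop) (by fun_prop)
  | ih x => rw [fockInner_coe]; exact preInner_self_nonneg x

/-- The free product module, as a Hilbert space for the inner product obtained from the trace of the
regular representation of `B`. -/
def HilbertFock : Type _ := Fock P

noncomputable instance : AddCommGroup (HilbertFock P) := inferInstanceAs (AddCommGroup (Fock P))
noncomputable instance : Module ℂ (HilbertFock P) := inferInstanceAs (Module ℂ (Fock P))

/-- The identity map to the Hilbert space. -/
noncomputable def toHilbertₗ : Fock P ≃ₗ[ℂ] HilbertFock P := LinearEquiv.refl ℂ (Fock P)

variable [FiniteDimensional ℂ B]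

noncomputable instance HilbertFock.core : InnerProductSpace.Core ℂ (HilbertFock P) where
  inner x y := regularTrace B (fockInner ((toHilbertₗ P).symm x) ((toHilbertₗ P).symm y))
  conj_inner_symm x y := by
    rw [← star_fockInner, regularTrace_star]
    exact star_star _
  re_inner_nonneg x :=
    (Complex.nonneg_iff.mp (regularTrace_nonneg_and_norm_le (fockInner_self_nonneg _)).1).1
  add_left x y z := by simp
  smul_left x y r := by simp
  definite x h := by
    have h1 := (regularTrace_nonneg_and_norm_le
      (fockInner_self_nonneg ((toHilbertₗ P).symm x))).2
    rw [h, Complex.zero_re, norm_fockInner_self] at h1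
    have h2 : (toHilbertₗ P).symm x = 0 := by
      rw [← norm_eq_zero]
      nlinarith [norm_nonneg ((toHilbertₗ P).symm x)]
    exact (toHilbertₗ P).symm.map_eq_zero_iff.mp h2

noncomputable instance : NormedAddCommGroup (HilbertFock P) :=
  InnerProductSpace.Core.toNormedAddCommGroup (cd := HilbertFock.core P)

noncomputable instance : InnerProductSpace ℂ (HilbertFock P) :=
  InnerProductSpace.ofCore (HilbertFock.core P).toCore

theorem inner_toHilbertₗ (x y : Fock P) :
    ⟪toHilbertₗ P x, toHilbertₗ P y⟫_ℂ = regularTrace B (fockInner x y) := rfl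

theorem norm_toHilbertₗ_sq (x : Fock P) :
    ‖toHilbertₗ P x‖ ^ 2 = (regularTrace B (fockInner x x)).re := by
  rw [← inner_self_eq_norm_sq (𝕜 := ℂ), inner_toHilbertₗ]
  rfl

/-- Together with `exists_norm_toHilbertₗ_le` this makes the two norms equivalent, so the Hilbert
space is complete without a further completion and has the same bounded operators. -/
theorem norm_le_norm_toHilbertₗ (x : Fock P) : ‖x‖ ≤ ‖toHilbertₗ P x‖ := by
  refine abs_le_of_sq_le_sq' ?_ (norm_nonneg _) |>.2
  rw [norm_toHilbertₗ_sq, ← norm_fockInner_self]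
  exact (regularTrace_nonneg_and_norm_le (fockInner_self_nonneg x)).2

theorem exists_norm_toHilbertₗ_le : ∃ C : ℝ, ∀ x : Fock P, ‖toHilbertₗ P x‖ ≤ C * ‖x‖ := by
  obtain ⟨C, hC, h⟩ := exists_norm_regularTrace_le (B := B)
  refine ⟨√C, fun x => abs_le_of_sq_le_sq' ?_ (by positivity) |>.2⟩
  rw [norm_toHilbertₗ_sq, mul_pow, Real.sq_sqrt hC, ← norm_fockInner_self]
  exact (Complex.re_le_norm _).trans (h _)

/-- The identity map to the Hilbert space, as a homeomorphism. -/
noncomputable def toHilbert : Fock P ≃L[ℂ] HilbertFock P where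
  toLinearEquiv := toHilbertₗ P
  continuous_toFun := by
    obtain ⟨C, hC⟩ := exists_norm_toHilbertₗ_le P
    exact AddMonoidHomClass.continuous_of_bound (toHilbertₗ P) C hC
  continuous_invFun := by
    refine AddMonoidHomClass.continuous_of_bound (toHilbertₗ P).symm 1 fun x => ?_
    have := norm_le_norm_toHilbertₗ P ((toHilbertₗ P).symm x)
    rwa [LinearEquiv.apply_symm_apply, ← one_mul ‖x‖] at this

theorem inner_toHilbert (x y : Fock P) :
    ⟪toHilbert P x, toHilbert P y⟫_ℂ = regularTrace B (fockInner x y) := rfl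

instance : CompleteSpace (HilbertFock P) :=
  (completeSpace_congr (e := (toHilbert P).toEquiv)
    (toHilbert P).isUniformEmbedding).mp inferInstance

/-- A bounded operator on the free product module, viewed on the Hilbert space. -/
noncomputable def hilbertConj (T : Fock P →L[ℂ] Fock P) : HilbertFock P →L[ℂ] HilbertFock P :=
  (toHilbert P : Fock P →L[ℂ] HilbertFock P) ∘L T ∘L
    ((toHilbert P).symm : HilbertFock P →L[ℂ] Fock P)

theorem hilbertConj_toHilbert (T : Fock P →L[ℂ] Fock P) (x : Fock P) :
    hilbertConj P T (toHilbert P x) = toHilbert P (T x) := by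
  simp [hilbertConj]

theorem hilbert_ext {S T : HilbertFock P →L[ℂ] HilbertFock P}
    (h : ∀ x : Fock P, S (toHilbert P x) = T (toHilbert P x)) : S = T := by
  ext x
  obtain ⟨x, rfl⟩ := (toHilbert P).surjective x
  exact h x

/-- The representation of the adjointable operators on the Hilbert space. -/
noncomputable def hilbertRep : Adjointable P →⋆ₐ[ℂ] (HilbertFock P →L[ℂ] HilbertFock P) where
  toFun T := hilbertConj P T.1
  map_one' := hilbert_ext P fun x => by rw [hilbertConj_toHilbert]; rfl
  map_mul' S T := hilbert_ext P fun x => by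
    rw [mul_apply_eq_comp, hilbertConj_toHilbert, hilbertConj_toHilbert, hilbertConj_toHilbert]
    rfl
  map_zero' := hilbert_ext P fun x => by
    rw [hilbertConj_toHilbert]
    exact map_zero _
  map_add' S T := hilbert_ext P fun x => by
    rw [add_apply, hilbertConj_toHilbert, hilbertConj_toHilbert, hilbertConj_toHilbert, ← map_add]
    rfl
  commutes' z := hilbert_ext P fun x => by
    rw [hilbertConj_toHilbert, Algebra.algebraMap_eq_smul_one, Algebra.algebraMap_eq_smul_one,
      smul_apply, one_apply_eq_self, ← map_smul]
    rfl
  map_star' T := by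
    rw [ContinuousLinearMap.star_eq_adjoint, ContinuousLinearMap.eq_adjoint_iff]
    intro x y
    obtain ⟨x, rfl⟩ := (toHilbert P).surjective x
    obtain ⟨y, rfl⟩ := (toHilbert P).surjective y
    rw [hilbertConj_toHilbert, hilbertConj_toHilbert, inner_toHilbert, inner_toHilbert,
      Adjointable.coe_star, Adjointable.adj_fockInner]

theorem hilbertRep_toHilbert (T : Adjointable P) (x : Fock P) :
    hilbertRep P T (toHilbert P x) = toHilbert P (T.1 x) := hilbertConj_toHilbert P T.1 x

theorem hilbertRep_injective : Function.Injective (hilbertRep P) := fun S T h => by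
  refine Subtype.ext (ContinuousLinearMap.ext fun x => (toHilbert P).injective ?_)
  rw [← hilbertRep_toHilbert, h, hilbertRep_toHilbert]

end HilbertFock

end

section

open CondExpInclusion

/-! ### Where to cut a word -/

section Cutting

/-- The length of the tail in the `s`-th way to cut a word with `n` letters into pieces of length
at most `N`. -/
def tailLength (N s : ℕ) : ℕ → ℕ
  | 0 => 0
  -- The result is the largest number below `n + 1` that is congruent to `s` modulo `N`, and `0` if
  -- there is none.
  | n + 1 => if n % N = s then n else tailLength N s n

theorem tailLength_le (N s n : ℕ) : tailLength N s n ≤ n := by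
  induction n with
  | zero => exact le_rfl
  | succ n ih =>
    rw [tailLength]
    split_ifs <;> omega

/-- A nonempty prefix has a nonempty head; thus a first letter from an algebra with index in `J`
always belongs to the head. -/
theorem tailLength_lt (N s : ℕ) {n : ℕ} (hn : n ≠ 0) : tailLength N s n < n := by
  obtain ⟨n, rfl⟩ := Nat.exists_eq_succ_of_ne_zero hn
  have := tailLength_le N s n
  rw [Nat.succ_eq_add_one, tailLength]
  split_ifs <;> omega

theorem le_tailLength_add {N s : ℕ} (hs : s < N) (n : ℕ) : n ≤ tailLength N s n + N := by
  -- The induction must remember that the cut position is congruent to `s`, unless `n` has not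
  -- passed `s` yet.
  suffices (tailLength N s n % N = s ∨ n ≤ s) ∧ n ≤ tailLength N s n + N from this.2
  induction n with
  | zero => simp
  | succ n ih =>
    rw [tailLength]
    split_ifs with h
    · omega
    · have h2 : n ≠ tailLength N s n + N ∨ tailLength N s n % N ≠ s := by
        by_contra! h3
        rw [h3.1, Nat.add_mod_right] at h
        exact h h3.2
      have h4 : n ≠ s := by
        rintro rfl
        exact h (Nat.mod_eq_of_lt hs)
      omega

/-- Lengthening the prefix by one moves the cut only for `s = n % N`. -/
theorem card_tailLength_ne_le (N n : ℕ) :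
    ((Finset.range N).filter fun s => tailLength N s (n + 1) ≠ tailLength N s n).card ≤ 1 := by
  refine (Finset.card_le_card (t := {n % N}) fun s hs => ?_).trans_eq (Finset.card_singleton _)
  rw [Finset.mem_filter, tailLength] at hs
  by_contra h
  rw [Finset.mem_singleton] at h
  rw [if_neg (Ne.symm h)] at hs
  exact hs.2 rfl

end Cutting

namespace AmalgamatedFreeProduct

/-! ### Cutting words into heads and tails -/

section Combinatorics

variable {B : Type*} [CStarAlgebra B] [PartialOrder B] [StarOrderedRing B]
  {I : Type*} {A : I → Type*} [∀ i, CStarAlgebra (A i)] {P : ∀ i, CondExpInclusion B (A i)}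

open Classical in
/-- The length of the maximal initial segment with letters from the algebras with index in `J`. -/
noncomputable def prefixLength (J : Set I) : List (Letter P) → ℕ
  | [] => 0
  | x :: u => if x.1 ∈ J then prefixLength J u + 1 else 0

theorem prefixLength_le (J : Set I) (u : List (Letter P)) : prefixLength J u ≤ u.length := by
  induction u with
  | nil => exact le_rfl
  | cons x u ih =>
    rw [prefixLength, List.length_cons]
    split_ifs <;> omega

theorem mem_of_mem_take {J : Set I} {u : List (Letter P)} {k : ℕ} (hk : k ≤ prefixLength J u) :
    ∀ x ∈ u.take k, x.1 ∈ J := by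
  induction u generalizing k with
  | nil => simp
  | cons y u ih =>
    cases k with
    | zero => simp
    | succ k =>
      rw [prefixLength] at hk
      split_ifs at hk with h
      · intro x hx
        rw [List.take_succ_cons, List.mem_cons] at hx
        obtain rfl | hx := hx
        · exact h
        · exact ih (by omega) x hx
      · omega

theorem prefixLength_append {J : Set I} {u v : List (Letter P)} (hu : ∀ x ∈ u, x.1 ∈ J) :
    prefixLength J (u ++ v) = u.length + prefixLength J v := by
  induction u with
  | nil => simp
  | cons x u ih =>
    rw [List.cons_append, prefixLength, if_pos (hu x (by simp)),
      ih fun y hy => hu y (List.mem_cons_of_mem x hy), List.length_cons]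
    omega

/-- A nonzero kernel forces the letters of the two words to come pairwise from the same algebras. -/
theorem prefixLength_eq_of_kernel_ne_zero (J : Set I) {u v : List (Letter P)} {b : B}
    (h : kernel u b v ≠ 0) : prefixLength J u = prefixLength J v := by
  induction u generalizing v b with
  | nil =>
    cases v with
    | nil => rfl
    | cons y v => exact absurd rfl h
  | cons x u ih =>
    cases v with
    | nil => exact absurd rfl h
    | cons y v =>
      have hxy : x.1 = y.1 := by
        by_contra hne
        rw [kernel, step_of_ne hne, kernel_zero] at h
        exact h rfl
      rw [prefixLength, prefixLength, hxy, ih h]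

theorem kernel_eq_zero_of_length_ne {u v : List (Letter P)} (b : B) (h : u.length ≠ v.length) :
    kernel u b v = 0 := by
  induction u generalizing v b with
  | nil =>
    cases v with
    | nil => exact absurd rfl h
    | cons y v => rfl
  | cons x u ih =>
    cases v with
    | nil => rfl
    | cons y v => exact ih _ fun e => h (by simp [e])

/-- The kernel is evaluated from the left, so the value of the initial segments is what gets
inserted between the remaining ones. -/
theorem kernel_append {p q : List (Letter P)} (u v : List (Letter P)) (b : B)
    (h : p.length = q.length) : kernel (p ++ u) b (q ++ v) = kernel u (kernel p b q) v := by
  induction p generalizing q b with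
  | nil =>
    rw [List.length_nil, eq_comm, List.length_eq_zero_iff] at h
    subst h
    rfl
  | cons x p ih =>
    cases q with
    | nil => simp at h
    | cons y q => exact ih _ (by simpa using h)

open Classical in
/-- The decomposition of a list of letters into its head in `A i` and the rest. -/
noncomputable def splitList (i : I) : List (Letter P) → A i × List (Letter P)
  | [] => (1, [])
  | x :: u => if x.1 = i then (x.at i, u) else (1, x :: u)

theorem split_eq_splitList (i : I) (w : Word P) :
    ((split i w).1, (split i w).2.1.1) = splitList i w.1 := by
  obtain ⟨u, hu⟩ := w
  cases u with
  | nil => rfl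
  | cons x u =>
    rw [splitList]
    by_cases h : x.1 = i <;> simp [split, h]

/-- The matrix coefficient of `a ∈ A i` between two words. -/
noncomputable def actKernel (i : I) (a : A i) (u v : List (Letter P)) : B :=
  kernel (splitList i u).2 ((P i).exp (star (splitList i u).1 * a * (splitList i v).1))
    (splitList i v).2

theorem form_eq_sesq (i : I) (a : A i) (f g : PreFock P) :
    form i a f g = sesq (fun u v => actKernel i a u.1 v.1) f g := by
  rw [form]
  congr 1
  funext u v
  rw [actKernel, ← split_eq_splitList, ← split_eq_splitList]

theorem prefixLength_splitList {J : Set I} {i : I} (hi : i ∈ J) (u : List (Letter P)) :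
    prefixLength J u = prefixLength J (splitList i u).2 ∨
      prefixLength J u = prefixLength J (splitList i u).2 + 1 := by
  cases u with
  | nil => exact Or.inl rfl
  | cons x u =>
    rw [splitList]
    split_ifs with h
    · right
      rw [prefixLength, if_pos (h ▸ hi)]
    · exact Or.inl rfl

/-- After splitting off a possible first letter in `A i`, both words have rests with equal prefix
lengths. -/
theorem prefixLength_le_of_actKernel_ne_zero {J : Set I} {i : I} (hi : i ∈ J) {a : A i}
    {u v : List (Letter P)} (h : actKernel i a u v ≠ 0) :
    prefixLength J u ≤ prefixLength J v + 1 ∧ prefixLength J v ≤ prefixLength J u + 1 := by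
  have h1 := prefixLength_eq_of_kernel_ne_zero J h
  have h2 := prefixLength_splitList hi u
  have h3 := prefixLength_splitList hi v
  omega

variable (J : Set I) (N s : ℕ)

/-- The length of the head of a word. -/
noncomputable def headLength (u : List (Letter P)) : ℕ :=
  prefixLength J u - tailLength N s (prefixLength J u)

/-- The head of a word. -/
noncomputable def Word.head (w : Word P) : Word P :=
  ⟨w.1.take (headLength J N s w.1), w.2.take _⟩

/-- The tail of a word. -/
noncomputable def Word.tail (w : Word P) : Word P :=
  ⟨w.1.drop (headLength J N s w.1), w.2.drop _⟩

theorem head_append_tail (w : Word P) : (Word.head J N s w).1 ++ (Word.tail J N s w).1 = w.1 :=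
  List.take_append_drop _ _

theorem length_head (w : Word P) : (Word.head J N s w).1.length = headLength J N s w.1 := by
  have := prefixLength_le J w.1
  rw [Word.head, List.length_take, headLength]
  omega

theorem length_head_le {s : ℕ} (hs : s < N) (w : Word P) : (Word.head J N s w).1.length ≤ N := by
  rw [length_head, headLength]
  have := le_tailLength_add hs (prefixLength J w.1)
  omega

theorem mem_of_mem_head (w : Word P) : ∀ x ∈ (Word.head J N s w).1, x.1 ∈ J :=
  mem_of_mem_take (Nat.sub_le _ _)

theorem prefixLength_tail (w : Word P) :
    prefixLength J (Word.tail J N s w).1 = tailLength N s (prefixLength J w.1) := by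
  have h := prefixLength_append (v := (Word.tail J N s w).1) (mem_of_mem_head J N s w)
  rw [head_append_tail, length_head, headLength] at h
  have := tailLength_le N s (prefixLength J w.1)
  omega

-- If the head is empty, then so is the `J`-prefix, and the word does not begin in `A i`.
variable {J} in
theorem splitList_head_tail {i : I} (hi : i ∈ J) (w : Word P) :
    splitList i w.1 = ((splitList i (Word.head J N s w).1).1,
      (splitList i (Word.head J N s w).1).2 ++ (Word.tail J N s w).1) := by
  have h1 := head_append_tail J N s w
  cases h : (Word.head J N s w).1 with
  | nil =>
    rw [h, List.nil_append] at h1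
    rw [splitList, List.nil_append, h1]
    cases hw : w.1 with
    | nil => rfl
    | cons x u =>
      rw [splitList, if_neg]
      intro hx
      have h2 := length_head J N s w
      have h3 : prefixLength J w.1 ≠ 0 := by
        rw [hw, prefixLength, if_pos (hx ▸ hi)]
        omega
      have h4 := tailLength_lt N s h3
      rw [h, List.length_nil, headLength] at h2
      omega
  | cons x u =>
    rw [← h1, h, List.cons_append, splitList, splitList]
    split_ifs <;> rfl

theorem prefixLength_splitList_head {i : I} (w : Word P) :
    prefixLength J ((splitList i (Word.head J N s w).1).2 ++ (Word.tail J N s w).1) =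
      (splitList i (Word.head J N s w).1).2.length + tailLength N s (prefixLength J w.1) := by
  rw [prefixLength_append, prefixLength_tail]
  intro x hx
  refine mem_of_mem_head J N s w x ?_
  cases h : (Word.head J N s w).1 with
  | nil =>
    rw [h] at hx
    exact hx
  | cons y u =>
    rw [h, splitList] at hx
    split_ifs at hx
    · exact List.mem_cons_of_mem _ hx
    · exact hx

-- If the rests of the heads have equal length, the kernels glue by `kernel_append`, and unequal
-- tail lengths give unequal prefix lengths of the tails, hence zero. If those rests differ in
-- length, the left side vanishes; with equal tail lengths the prefix lengths of the full rests then
-- differ, so the right side vanishes too.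
open Classical in
variable {J} in
theorem kernel_tail_actKernel_head {i : I} (hi : i ∈ J) (a : A i) (w w' : Word P) :
    kernel (Word.tail J N s w).1
        (actKernel i a (Word.head J N s w).1 (Word.head J N s w').1) (Word.tail J N s w').1 =
      if tailLength N s (prefixLength J w.1) = tailLength N s (prefixLength J w'.1) then
        actKernel i a w.1 w'.1 else 0 := by
  have e : actKernel i a w.1 w'.1 =
      kernel ((splitList i (Word.head J N s w).1).2 ++ (Word.tail J N s w).1)
        ((P i).exp (star (splitList i (Word.head J N s w).1).1 * a *
          (splitList i (Word.head J N s w').1).1))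
        ((splitList i (Word.head J N s w').1).2 ++ (Word.tail J N s w').1) := by
    rw [actKernel, splitList_head_tail N s hi w, splitList_head_tail N s hi w']
  by_cases hl : (splitList i (Word.head J N s w).1).2.length =
      (splitList i (Word.head J N s w').1).2.length
  · rw [e, kernel_append _ _ _ hl]
    split_ifs with ht
    · rfl
    · by_contra h
      have := prefixLength_eq_of_kernel_ne_zero J h
      rw [prefixLength_tail, prefixLength_tail] at this
      exact ht this
  · rw [actKernel, kernel_eq_zero_of_length_ne _ hl, kernel_zero]
    split_ifs with ht
    · by_contra h
      rw [eq_comm, e] at h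
      have := prefixLength_eq_of_kernel_ne_zero J h
      rw [prefixLength_splitList_head, prefixLength_splitList_head] at this
      omega
    · rfl

theorem kernel_tail_kernel_head (w w' : Word P) :
    kernel (Word.tail J N s w).1 (kernel (Word.head J N s w).1 1 (Word.head J N s w').1)
      (Word.tail J N s w').1 = kernel w.1 1 w'.1 := by
  by_cases hl : (Word.head J N s w).1.length = (Word.head J N s w').1.length
  · rw [← kernel_append _ _ _ hl, head_append_tail, head_append_tail]
  · rw [kernel_eq_zero_of_length_ne _ hl, kernel_zero]
    by_contra h
    have := prefixLength_eq_of_kernel_ne_zero J (Ne.symm h)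
    rw [length_head, length_head, headLength, headLength, this] at hl
    exact hl rfl

end Combinatorics

end AmalgamatedFreeProduct

end

section

open scoped CStarAlgebra ComplexOrder InnerProductSpace

/-! ### Completely positive maps built from a family of compressions -/

section BlockMap

variable {L : Type*} [CStarAlgebra L] {K : Type*} [NormedAddCommGroup K] [InnerProductSpace ℂ K]
  [CompleteSpace K] {E : Type*} [NormedAddCommGroup E] [InnerProductSpace ℂ E]

theorem exists_inner_eq_sum {F : Type*} [Finite F] (x : F → E) :
    ∃ (m : ℕ) (c : Fin m → F → ℂ), ∀ p q, ⟪x p, x q⟫_ℂ = ∑ k, star (c k p) * c k q := by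
  let S : Submodule ℂ E := Submodule.span ℂ (Set.range x)
  have : FiniteDimensional ℂ S := FiniteDimensional.span_of_finite ℂ (Set.finite_range x)
  let y (p : F) : S := ⟨x p, Submodule.subset_span (Set.mem_range_self p)⟩
  refine ⟨_, fun k p => ⟪stdOrthonormalBasis ℂ S k, y p⟫_ℂ, fun p q => ?_⟩
  refine ((stdOrthonormalBasis ℂ S).sum_inner_mul_inner (y p) (y q)).symm.trans ?_
  refine Finset.sum_congr rfl fun k _ => ?_
  rw [← inner_conj_symm]
  rfl

/-- The map `T ↦ c ∑ₛ ∑ᵣᵣ' ⟪fᵣ, T fᵣ'⟫ Φ(vₛᵣ* vₛᵣ')`. -/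
noncomputable def blockMap {κ ι : Type*} [Fintype κ] [Fintype ι] (Φ : L →ₗ[ℂ] (K →L[ℂ] K))
    (f : ι → E) (v : κ → ι → L) (c : ℂ) : (E →L[ℂ] E) →ₗ[ℂ] (K →L[ℂ] K) where
  toFun T := c • ∑ s, ∑ r, ∑ r', ⟪f r, T (f r')⟫_ℂ • Φ (star (v s r) * v s r')
  map_add' S T := by
    simp only [add_apply, inner_add_right, add_smul, Finset.sum_add_distrib, smul_add]
  map_smul' z T := by
    simp only [smul_apply, inner_smul_right, mul_smul, RingHom.id_apply, Finset.smul_sum]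
    refine Finset.sum_congr rfl fun s _ => Finset.sum_congr rfl fun r _ =>
      Finset.sum_congr rfl fun r' _ => ?_
    rw [smul_comm]

variable {κ ι : Type*} [Fintype κ] [Fintype ι]

omit [CompleteSpace K] in
theorem blockMap_apply (Φ : L →ₗ[ℂ] (K →L[ℂ] K)) (f : ι → E) (v : κ → ι → L) (c : ℂ)
    (T : E →L[ℂ] E) :
    blockMap Φ f v c T = c • ∑ s, ∑ r, ∑ r', ⟪f r, T (f r')⟫_ℂ • Φ (star (v s r) * v s r') := rfl

/-- The Gram matrix of the vectors `a i (f r)` is a sum of rank one matrices, by coordinates in an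
orthonormal basis of their span. Absorbing the coordinates into the vectors `h i` leaves sums of
positive forms of `Φ`. -/
theorem kernelPositive_blockMap [CompleteSpace E] {Φ : L →ₗ[ℂ] (K →L[ℂ] K)} (hΦ : KernelPositive Φ) (f : ι → E)
    (v : κ → ι → L) {c : ℂ} (hc : 0 ≤ c) : KernelPositive (blockMap Φ f v c) := by
  intro n a h
  obtain ⟨m, g, hg⟩ := exists_inner_eq_sum fun p : Fin n × ι => a p.1 (f p.2)
  have e (i j : Fin n) (r r' : ι) : ⟪f r, (star (a i) * a j) (f r')⟫_ℂ =
      ∑ k, star (g k (i, r)) * g k (j, r') := by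
    rw [← hg (i, r) (j, r'), mul_apply_eq_comp, ContinuousLinearMap.star_eq_adjoint,
      ContinuousLinearMap.adjoint_inner_right]
  have e2 : ∑ i, ∑ j, ⟪h i, blockMap Φ f v c (star (a i) * a j) (h j)⟫_ℂ =
      c * ∑ s, ∑ k, ∑ p : Fin n × ι, ∑ q : Fin n × ι,
        ⟪g k p • h p.1, Φ (star (v s p.2) * v s q.2) (g k q • h q.1)⟫_ℂ := by
    have e3 (s : κ) : ∑ k, ∑ p : Fin n × ι, ∑ q : Fin n × ι,
        ⟪g k p • h p.1, Φ (star (v s p.2) * v s q.2) (g k q • h q.1)⟫_ℂ =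
        ∑ i, ∑ j, ∑ r, ∑ r', ∑ k, (star (g k (i, r)) * g k (j, r')) *
          ⟪h i, Φ (star (v s r) * v s r') (h j)⟫_ℂ := by
      rw [← Finset.sum_comm_cycle]
      simp only [Fintype.sum_prod_type, map_smul, inner_smul_left, inner_smul_right]
      refine Finset.sum_congr rfl fun i _ => ?_
      rw [Finset.sum_comm]
      refine Finset.sum_congr rfl fun j _ => Finset.sum_congr rfl fun r _ =>
        Finset.sum_congr rfl fun r' _ => Finset.sum_congr rfl fun k _ => ?_
      rw [mul_left_comm, mul_assoc]
      rfl
    simp only [e3, blockMap_apply, e, smul_apply, sum_apply, inner_smul_right, inner_sum,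
      ← Finset.mul_sum, Finset.sum_mul]
    congr 1
    rw [Finset.sum_comm_cycle]
  rw [e2]
  refine mul_nonneg hc (Finset.sum_nonneg fun s _ => Finset.sum_nonneg fun k _ => ?_)
  exact hΦ.sum_nonneg (fun p : Fin n × ι => v s p.2) fun p => g k p • h p.1

end BlockMap

end

section

open scoped CStarAlgebra ComplexOrder InnerProductSpace

namespace AmalgamatedFreeProduct

/-! ### The space spanned by the short words and its dimension -/

section WordSpace

variable {B : Type*} [CStarAlgebra B] [PartialOrder B] [StarOrderedRing B]
  {I : Type*} {A : I → Type*} [∀ i, CStarAlgebra (A i)] {P : ∀ i, CondExpInclusion B (A i)}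

theorem PreFock.additive_zero {M : Type*} [AddCommGroup M] {F : PreFock P → M}
    (h : ∀ f g, F (f + g) = F f + F g) : F 0 = 0 := by
  simpa using h 0 0

/-- Biadditivity suffices, since the tensors with arbitrary coefficients in `B` generate the module
additively. -/
theorem eq_sesq {k : Word P → Word P → B} {F : PreFock P → PreFock P → B}
    (hl : ∀ f f' g, F (f + f') g = F f g + F f' g) (hr : ∀ f g g', F f (g + g') = F f g + F f g')
    (ht : ∀ u b v c, F (tensor u b) (tensor v c) = star b * k u v * c) (f g : PreFock P) :
    F f g = sesq k f g := by
  induction f using PreFock.induction with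
  | h0 => rw [sesq_zero_left, PreFock.additive_zero (F := fun f => F f g) fun f f' => hl f f' g]
  | hadd f f' hf hf' => rw [hl, sesq_add_left, hf, hf']
  | ht u b =>
    induction g using PreFock.induction with
    | h0 => rw [sesq_zero_right, PreFock.additive_zero (F := fun g => F _ g) fun g g' => hr _ g g']
    | hadd g g' hg hg' => rw [hr, sesq_add_right, hg, hg']
    | ht v c => rw [ht, sesq_tensor]

theorem fockInner_coe_rightMul (x : Fock P) (b : B) (f : PreFock P) :
    fockInner x (rightMul b f : PreFock P) = fockInner x (f : Fock P) * b := by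
  induction x using UniformSpace.Completion.induction_on with
  | hp => exact isClosed_eq (by fun_prop) (by fun_prop)
  | ih x => rw [fockInner_coe, fockInner_coe, preInner_rightMul]

theorem act_coe_tensor (i : I) (a : LinearMap.ker (P i).exp) (u : AvoidingWord P i) (b : B) :
    act P i a ((tensor u.1 b : PreFock P) : Fock P) = (tensor (consWord i a u) b : PreFock P) := by
  refine fock_ext_pre fun f => ?_
  have h : split i u.1 = (1, u) := by
    obtain ⟨⟨u, hu⟩, hi⟩ := u
    cases u with
    | nil => rfl
    | cons x u => exact dif_neg (hi x (by simp))
  have h0 : preInner f (leftMul 0 u.1) = 0 := by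
    rw [← star_preInner, preInner_leftMul_zero, star_zero]
  rw [act_coe, preAct_tensor, h, mul_one, merge, center_coe, LinearMap.mem_ker.mp a.2,
    fockInner_coe, fockInner_coe, preInner_rightMul, preInner_add_right, h0, add_zero,
    ← preInner_rightMul, rightMul_tensor, one_mul]

/-- The action of `A i`, linear in both variables. -/
noncomputable def actₗ (i : I) : A i →ₗ[ℂ] Fock P →ₗ[ℂ] Fock P :=
  LinearMap.mk₂ ℂ (fun a x => act P i a x)
    (fun a a' x => congrArg (fun T : Adjointable P => T.1 x) (map_add (rep P i) a a'))
    (fun z a x => congrArg (fun T : Adjointable P => T.1 x) (map_smul (rep P i) z a))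
    (fun _ x y => map_add _ x y) (fun z _ x => map_smul _ z x)

variable [∀ i, FiniteDimensional ℂ (A i)]

/-- Each `A i` contributes the image of `A i ⊗ W`. The dimension factor is thus linear in `∑ dim A
i`, which later keeps the growth in the number of iterates polynomial. -/
theorem exists_act_mem (J : Finset I) (W : Submodule ℂ (Fock P)) [FiniteDimensional ℂ W] :
    ∃ W' : Submodule ℂ (Fock P), FiniteDimensional ℂ W' ∧ W ≤ W' ∧
      (∀ i ∈ J, ∀ a : A i, ∀ x ∈ W, act P i a x ∈ W') ∧
      Module.finrank ℂ W' ≤ (1 + ∑ i ∈ J, Module.finrank ℂ (A i)) * Module.finrank ℂ W := by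
  classical
  induction J using Finset.induction_on with
  | empty => exact ⟨W, inferInstance, le_rfl, by simp, by simp⟩
  | insert i J hi ih =>
    obtain ⟨W', h1, h2, h3, h4⟩ := ih
    let R := LinearMap.range (TensorProduct.lift ((actₗ (P := P) i).compl₂ W.subtype))
    refine ⟨W' ⊔ R, inferInstance, h2.trans le_sup_left, fun j hj a x hx => ?_, ?_⟩
    · obtain rfl | hj := Finset.mem_insert.mp hj
      · refine Submodule.mem_sup_right ⟨TensorProduct.tmul ℂ a ⟨x, hx⟩, ?_⟩
        rw [TensorProduct.lift.tmul]
        rfl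
      · exact Submodule.mem_sup_left (h3 j hj a x hx)
    · have h5 := Submodule.finrank_add_le_finrank_add_finrank W' R
      have h6 : Module.finrank ℂ R ≤ Module.finrank ℂ (A i) * Module.finrank ℂ W := by
        rw [← Module.finrank_tensorProduct]
        exact LinearMap.finrank_range_le _
      rw [Finset.sum_insert hi]
      nlinarith

/-- The words of length at most `N` with letters from the algebras with index in `J`. -/
def IsShort (J : Set I) (N : ℕ) (u : Word P) : Prop := u.1.length ≤ N ∧ ∀ x ∈ u.1, x.1 ∈ J

omit [∀ i, FiniteDimensional ℂ (A i)] in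
theorem isShort_head (J : Set I) {N s : ℕ} (hs : s < N) (w : Word P) :
    IsShort J N (Word.head J N s w) := ⟨length_head_le J N hs w, mem_of_mem_head J N s w⟩

-- A word with one more letter is obtained by letting its first letter act on the rest, so
-- `exists_act_mem` is applied `N` times, starting from the empty word with coefficients in `B`.
variable (P) in
theorem exists_wordSpace [FiniteDimensional ℂ B] (J : Finset I) (N : ℕ) :
    ∃ W : Submodule ℂ (Fock P), FiniteDimensional ℂ W ∧
      (∀ u : Word P, IsShort J N u → ∀ b, ((tensor u b : PreFock P) : Fock P) ∈ W) ∧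
      Module.finrank ℂ W ≤
        (1 + ∑ i ∈ J, Module.finrank ℂ (A i)) ^ N * Module.finrank ℂ B := by
  induction N with
  | zero =>
    let R := LinearMap.range ((UniformSpace.Completion.toComplL (𝕜 := ℂ)
      (E := PreFock P)).toLinearMap ∘ₗ tensor ⟨[], List.isChain_nil⟩)
    refine ⟨R, inferInstance, fun u hu b => ⟨b, ?_⟩, ?_⟩
    · obtain ⟨u, h⟩ := u
      obtain rfl := List.length_eq_zero_iff.mp (Nat.le_zero.mp hu.1)
      rfl
    · rw [pow_zero, one_mul]
      exact LinearMap.finrank_range_le _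
  | succ N ih =>
    obtain ⟨W, h1, h2, h3⟩ := ih
    obtain ⟨W', h4, h5, h6, h7⟩ := exists_act_mem J W
    refine ⟨W', h4, fun u hu b => ?_, h7.trans ?_⟩
    · obtain ⟨u, h⟩ := u
      cases u with
      | nil => exact h5 (h2 _ ⟨by simp, by simp⟩ b)
      | cons x u =>
        obtain ⟨i, a⟩ := x
        let v : AvoidingWord P i := ⟨⟨u, h.tail⟩, by
          cases u with
          | nil => simp
          | cons y t =>
            intro z hz
            obtain rfl : y = z := by simpa using hz
            exact (List.isChain_cons_cons.mp h).1.symm⟩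
        have hv : IsShort J N v.1 := ⟨by simpa using hu.1, fun y hy =>
          hu.2 y (List.mem_cons_of_mem _ hy)⟩
        have := h6 i (hu.2 ⟨i, a⟩ (by simp)) a _ (h2 _ hv b)
        rwa [act_coe_tensor] at this
    · rw [pow_succ, mul_comm _ (1 + _), mul_assoc]
      gcongr

end WordSpace

end AmalgamatedFreeProduct

end

section

open scoped CStarAlgebra ComplexOrder InnerProductSpace

namespace AmalgamatedFreeProduct

/-! ### Frames for the short words and the cutting operators -/

section Frame

variable {B : Type*} [CStarAlgebra B] [PartialOrder B] [StarOrderedRing B]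
  {I : Type*} {A : I → Type*} [∀ i, CStarAlgebra (A i)] {P : ∀ i, CondExpInclusion B (A i)}

variable (P) in
/-- The elementary tensor of a word in the completed module. -/
noncomputable def wordVec (u : Word P) : Fock P := (tensor u 1 : PreFock P)

theorem fockInner_tensor (x : Fock P) (u : Word P) (b : B) :
    fockInner x (tensor u b : PreFock P) = fockInner x (wordVec P u) * b := by
  rw [wordVec, ← fockInner_coe_rightMul, rightMul_tensor, one_mul]

theorem fockInner_tensor_left (x : Fock P) (u : Word P) (b : B) :
    fockInner ((tensor u b : PreFock P) : Fock P) x = star b * fockInner (wordVec P u) x := by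
  rw [← star_fockInner, fockInner_tensor, star_mul, star_fockInner]

theorem fockInner_wordVec (u v : Word P) : fockInner (wordVec P u) (wordVec P v) =
    kernel u.1 1 v.1 := by
  rw [wordVec, wordVec, fockInner_coe, preInner_tensor, star_one, one_mul, mul_one]

theorem fockInner_wordVec_act (i : I) (a : A i) (u v : Word P) :
    fockInner (wordVec P u) (act P i a (wordVec P v)) = actKernel i a u.1 v.1 := by
  rw [wordVec, wordVec, fockInner_coe_act, form_eq_sesq, sesq_tensor, star_one, one_mul, mul_one]

variable [FiniteDimensional ℂ B]

/-- A finite family which satisfies Parseval's identity on the span of the short words, for the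
scalar inner product. -/
def IsWordFrame (J : Set I) (N : ℕ) {ι : Type*} [Fintype ι] (g : ι → Fock P) : Prop :=
  ∀ u : Word P, IsShort J N u → ∀ b z,
    ∑ r, regularTrace B (fockInner ((tensor u b : PreFock P) : Fock P) (g r)) *
      regularTrace B (fockInner (g r) z) =
      regularTrace B (fockInner ((tensor u b : PreFock P) : Fock P) z)

namespace IsWordFrame

variable {J : Set I} {N : ℕ} {ι : Type*} [Fintype ι] {g : ι → Fock P} (hg : IsWordFrame J N g)
include hg

/-- Parseval's identity holds with every coefficient `b`, and the trace form on `B` is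
nondegenerate. -/
theorem sum_trace_smul {u : Word P} (hu : IsShort J N u) (z : Fock P) :
    ∑ r, regularTrace B (fockInner (g r) z) • fockInner (wordVec P u) (g r) =
      fockInner (wordVec P u) z := by
  refine eq_of_regularTrace_mul fun x => ?_
  have := hg u hu (star x) z
  simp only [fockInner_tensor_left, star_star] at this
  rw [← this, Finset.mul_sum, map_sum]
  refine Finset.sum_congr rfl fun r _ => ?_
  rw [mul_smul_comm, map_smul, smul_eq_mul, mul_comm]

theorem sum_trace_smul' {u : Word P} (hu : IsShort J N u) (z : Fock P) :
    ∑ r, regularTrace B (fockInner z (g r)) • fockInner (g r) (wordVec P u) =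
      fockInner z (wordVec P u) := by
  rw [← star_fockInner, ← hg.sum_trace_smul hu z, star_sum]
  refine Finset.sum_congr rfl fun r _ => ?_
  rw [star_smul, ← regularTrace_star, star_fockInner, star_fockInner]

/-- This passes from the scalar to the `B`-valued Parseval identity. After testing with the trace
`τ`, dual bases split `τ(⟪g r, z⟫ x ⟪u, g r⟫)` into `∑ τ(⟪g r, z e⟫) τ(d x ⟪u, g r⟫)`. The scalar
identity sums over `r`, and `∑ e d = 1` removes the bases. -/
theorem sum_mul_coe {u : Word P} (hu : IsShort J N u) (z : PreFock P) :
    ∑ r, fockInner (wordVec P u) (g r) * fockInner (g r) (z : Fock P) =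
      fockInner (wordVec P u) (z : Fock P) := by
  obtain ⟨n, e, d, h1, h2⟩ := exists_dual_bases B
  refine eq_of_regularTrace_mul fun x => ?_
  have h3 (r : ι) : regularTrace B (x * (fockInner (wordVec P u) (g r) * fockInner (g r) (z : Fock P))) =
      ∑ k, regularTrace B (fockInner (g r) (rightMul (e k) z : PreFock P)) *
        regularTrace B (d k * (x * fockInner (wordVec P u) (g r))) := by
    rw [← mul_assoc, regularTrace_mul_comm, ← h1]
    simp only [fockInner_coe_rightMul]
  have h4 (k : Fin n) :
      ∑ r, regularTrace B (fockInner (g r) (rightMul (e k) z : PreFock P)) *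
        regularTrace B (d k * (x * fockInner (wordVec P u) (g r))) =
      regularTrace B (x * fockInner (wordVec P u) (z : Fock P) * (e k * d k)) := by
    have := hg.sum_trace_smul hu (rightMul (e k) z : PreFock P)
    rw [← mul_assoc, regularTrace_mul_comm _ (d k), mul_assoc x, ← fockInner_coe_rightMul, ← this,
      Finset.mul_sum, Finset.mul_sum, map_sum]
    refine Finset.sum_congr rfl fun r _ => ?_
    rw [mul_smul_comm, mul_smul_comm, map_smul, smul_eq_mul]
  rw [Finset.mul_sum, map_sum]
  simp only [h3]
  rw [Finset.sum_comm]
  simp only [h4]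
  rw [← map_sum, ← Finset.mul_sum, h2, mul_one]

theorem sum_mul {u : Word P} (hu : IsShort J N u) (z : Fock P) :
    ∑ r, fockInner (wordVec P u) (g r) * fockInner (g r) z = fockInner (wordVec P u) z := by
  induction z using UniformSpace.Completion.induction_on with
  | hp => exact isClosed_eq (by fun_prop) (by fun_prop)
  | ih z => exact hg.sum_mul_coe hu z

/-- The sum over `r'` uses the scalar identity, after moving `a` to the other side of the inner
product; the sum over `r` uses the `B`-valued one. -/
theorem sum_sum_mul (i : I) (a : A i) {u v : Word P} (hu : IsShort J N u) (hv : IsShort J N v) :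
    ∑ r, ∑ r', regularTrace B (fockInner (g r) (act P i a (g r'))) •
      (fockInner (wordVec P u) (g r) * fockInner (g r') (wordVec P v)) =
      actKernel i a u.1 v.1 := by
  have h (r : ι) : ∑ r', regularTrace B (fockInner (g r) (act P i a (g r'))) •
      (fockInner (wordVec P u) (g r) * fockInner (g r') (wordVec P v)) =
      fockInner (wordVec P u) (g r) * fockInner (g r) (act P i a (wordVec P v)) := by
    simp only [← mul_smul_comm]
    rw [← Finset.mul_sum, ← star_star a, ← fockInner_act, ← hg.sum_trace_smul' hv]
    simp only [fockInner_act]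
  simp only [h]
  rw [← fockInner_wordVec_act]
  exact hg.sum_mul hu _

end IsWordFrame

variable (J : Set I) (N s : ℕ)

/-- The map which cuts a word and replaces its head by the inner product with `x`. -/
noncomputable def cutMap (x : Fock P) : PreFock P →ₗ[ℂ] PreFock P :=
  rightLift fun w => leftMul (fockInner x (wordVec P (Word.head J N s w))) (Word.tail J N s w)

omit [FiniteDimensional ℂ B] in
theorem preInner_cutMap_tensor (x y : Fock P) (u v : Word P) (b c : B) :
    preInner (cutMap J N s x (tensor u b)) (cutMap J N s y (tensor v c)) =
      star b * kernel (Word.tail J N s u).1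
        (fockInner (wordVec P (Word.head J N s u)) x * fockInner y (wordVec P (Word.head J N s v)))
        (Word.tail J N s v).1 * c := by
  rw [cutMap, cutMap, rightLift_tensor, rightLift_tensor, preInner_rightMul,
    preInner_rightMul_left, preInner_leftMul, star_fockInner]

omit [FiniteDimensional ℂ B] in
theorem kernel_sum {F : Type*} (t : Finset F) (u v : List (Letter P)) (b : F → B) :
    kernel u (∑ k ∈ t, b k) v = ∑ k ∈ t, kernel u (b k) v :=
  map_sum (AddMonoidHom.mk' (fun b => kernel u b v) (kernel_add u v)) b t

variable {J N s} {ι : Type*} [Fintype ι] {g : ι → Fock P}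

/-- Heads are short words, so the frame identity recovers their inner products, which are inserted
between the tails. -/
theorem IsWordFrame.sum_preInner_cutMap (hg : IsWordFrame J N g) (hs : s < N) (f h : PreFock P) :
    ∑ r, preInner (cutMap J N s (g r) f) (cutMap J N s (g r) h) = preInner f h := by
  refine eq_sesq (k := fun u v => kernel u.1 1 v.1) (F := fun f h =>
    ∑ r, preInner (cutMap J N s (g r) f) (cutMap J N s (g r) h)) ?_ ?_ ?_ f h
  · intro f f' h
    simp only [map_add, preInner_add_left, Finset.sum_add_distrib]
  · intro f h h'
    simp only [map_add, preInner_add_right, Finset.sum_add_distrib]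
  · intro u b v c
    simp only [preInner_cutMap_tensor]
    rw [← Finset.sum_mul, ← Finset.mul_sum, ← kernel_sum, hg.sum_mul (isShort_head J hs u),
      fockInner_wordVec, kernel_tail_kernel_head]

-- Compressing `a` to the frame and undoing the cut loses exactly the coefficients between words
-- with different tail lengths.
open Classical in
theorem IsWordFrame.sum_sum_preInner_cutMap (hg : IsWordFrame J N g) (hs : s < N) {i : I}
    (hi : i ∈ J) (a : A i) (f h : PreFock P) :
    ∑ r, ∑ r', regularTrace B (fockInner (g r) (act P i a (g r'))) •
      preInner (cutMap J N s (g r) f) (cutMap J N s (g r') h) =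
    sesq (fun u v => if tailLength N s (prefixLength J u.1) = tailLength N s (prefixLength J v.1)
      then actKernel i a u.1 v.1 else 0) f h := by
  refine eq_sesq (F := fun f h =>
    ∑ r, ∑ r', regularTrace B (fockInner (g r) (act P i a (g r'))) •
      preInner (cutMap J N s (g r) f) (cutMap J N s (g r') h)) ?_ ?_ ?_ f h
  · intro f f' h
    simp only [map_add, preInner_add_left, Finset.sum_add_distrib, smul_add]
  · intro f h h'
    simp only [map_add, preInner_add_right, Finset.sum_add_distrib, smul_add]
  · intro u b v c
    have e (z : ℂ) (x : B) (p q : List (Letter P)) :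
        z • (star b * kernel p x q * c) = star b * kernel p (z • x) q * c := by
      rw [kernel_smul, mul_smul_comm, smul_mul_assoc]
    simp only [preInner_cutMap_tensor, e, ← Finset.sum_mul, ← Finset.mul_sum, ← kernel_sum]
    rw [hg.sum_sum_mul i a (isShort_head J hs u) (isShort_head J hs v),
      kernel_tail_actKernel_head N s hi]

theorem IsWordFrame.norm_cutMap_le (hg : IsWordFrame J N g) (hs : s < N) (r : ι) (f : PreFock P) :
    ‖cutMap J N s (g r) f‖ ≤ 1 * ‖f‖ := by
  rw [one_mul]
  refine abs_le_of_sq_le_sq' ?_ f.norm_nonneg' |>.2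
  rw [PreFock.norm_sq, PreFock.norm_sq, ← hg.sum_preInner_cutMap hs f f]
  refine CStarAlgebra.norm_le_norm_of_nonneg_of_le (preInner_self_nonneg _) ?_
  exact Finset.single_le_sum (f := fun r => preInner (cutMap J N s (g r) f) (cutMap J N s (g r) f))
    (fun r _ => preInner_self_nonneg _) (Finset.mem_univ r)

/-- The cutting operators on the Hilbert space. -/
noncomputable def IsWordFrame.cutOp (hg : IsWordFrame J N g) (s : Fin N) (r : ι) :
    HilbertFock P →L[ℂ] HilbertFock P :=
  hilbertConj P ((cutMap J N s (g r)).mkContinuous 1 (hg.norm_cutMap_le s.2 r)).completion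

theorem IsWordFrame.cutOp_coe (hg : IsWordFrame J N g) (s : Fin N) (r : ι) (f : PreFock P) :
    hg.cutOp s r (toHilbert P (f : Fock P)) =
      toHilbert P ((cutMap J N s (g r) f : PreFock P) : Fock P) := by
  rw [cutOp, hilbertConj_toHilbert]
  congr 1
  simp

theorem IsWordFrame.inner_star_cutOp_mul (hg : IsWordFrame J N g) (s : Fin N) (r r' : ι)
    (f h : PreFock P) :
    ⟪toHilbert P (f : Fock P), (star (hg.cutOp s r) * hg.cutOp s r') (toHilbert P (h : Fock P))⟫_ℂ =
      regularTrace B (preInner (cutMap J N s (g r) f) (cutMap J N s (g r') h)) := by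
  rw [mul_apply_eq_comp, ContinuousLinearMap.star_eq_adjoint,
    ContinuousLinearMap.adjoint_inner_right, hg.cutOp_coe, hg.cutOp_coe, inner_toHilbert,
    fockInner_coe]

theorem hilbert_ext_inner {S T : HilbertFock P →L[ℂ] HilbertFock P}
    (h : ∀ f g : PreFock P, ⟪toHilbert P (f : Fock P), S (toHilbert P (g : Fock P))⟫_ℂ =
      ⟪toHilbert P (f : Fock P), T (toHilbert P (g : Fock P))⟫_ℂ) : S = T := by
  refine hilbert_ext P fun y => ext_inner_left ℂ fun x => ?_
  obtain ⟨x, rfl⟩ := (toHilbert P).surjective x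
  induction x, y using UniformSpace.Completion.induction_on₂ with
  | hp => exact isClosed_eq (by fun_prop) (by fun_prop)
  | ih x y => exact h x y

theorem IsWordFrame.sum_star_cutOp_mul (hg : IsWordFrame J N g) (s : Fin N) :
    ∑ r, star (hg.cutOp s r) * hg.cutOp s r = 1 := by
  refine hilbert_ext_inner fun f h => ?_
  rw [sum_apply, inner_sum]
  simp only [hg.inner_star_cutOp_mul]
  rw [← map_sum, hg.sum_preInner_cutMap s.2, one_apply_eq_self, inner_toHilbert, fockInner_coe]

end Frame

end AmalgamatedFreeProduct

end

/-! ### Averaging over the cuts -/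

section

open scoped CStarAlgebra ComplexOrder InnerProductSpace

/-- The bound is tested with the multiple of `T y` that has the norm of `y`. -/
theorem norm_le_of_norm_inner_le {H : Type*} [NormedAddCommGroup H] [InnerProductSpace ℂ H]
    {T : H →L[ℂ] H} {C : ℝ} (hC : 0 ≤ C)
    (h : ∀ x y, ‖⟪x, T y⟫_ℂ‖ ≤ C * (‖x‖ ^ 2 + ‖y‖ ^ 2)) : ‖T‖ ≤ 2 * C := by
  refine T.opNorm_le_bound (by positivity) fun y => ?_
  by_cases hT : T y = 0
  · rw [hT, norm_zero]
    positivity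
  have hT' : 0 < ‖T y‖ := norm_pos_iff.mpr hT
  have hy : 0 < ‖y‖ := norm_pos_iff.mpr fun e => hT (by rw [e, map_zero])
  have h1 := h (((‖y‖ / ‖T y‖ : ℝ) : ℂ) • T y) y
  rw [inner_smul_left, norm_mul, inner_self_eq_norm_sq_to_K, norm_smul, Complex.conj_ofReal,
    Complex.norm_real, norm_div, norm_norm, norm_norm, div_mul_cancel₀ _ hT'.ne', norm_pow] at h1
  have h2 : ‖((‖T y‖ : ℝ) : ℂ)‖ = ‖T y‖ := by simp
  change ‖y‖ / ‖T y‖ * ‖((‖T y‖ : ℝ) : ℂ)‖ ^ 2 ≤ _ at h1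
  rw [h2, pow_two, ← mul_assoc, div_mul_cancel₀ _ hT'.ne', pow_two] at h1
  nlinarith

/-- Each product is at most half the sum of the squares, and every index has at most two neighbours.
-/
theorem sum_neighbour_mul_le (M : ℕ) (x y : ℕ → ℝ) :
    ∑ m ∈ Finset.range M, ∑ n ∈ Finset.range M, (if m = n + 1 ∨ n = m + 1 then x m * y n else 0) ≤
      ∑ m ∈ Finset.range M, x m ^ 2 + ∑ n ∈ Finset.range M, y n ^ 2 := by
  have key (m : ℕ) (c : ℝ) (hc : 0 ≤ c) :
      ∑ n ∈ Finset.range M, (if m = n + 1 ∨ n = m + 1 then c else 0) ≤ 2 * c := by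
    rw [← Finset.sum_filter, Finset.sum_const, nsmul_eq_mul]
    gcongr
    -- For `m = 0` the truncated `m - 1` only enlarges the set on the right.
    have : (Finset.range M).filter (fun n => m = n + 1 ∨ n = m + 1) ⊆ {m - 1, m + 1} := by
      intro n hn
      rw [Finset.mem_filter] at hn
      rw [Finset.mem_insert, Finset.mem_singleton]
      omega
    exact_mod_cast (Finset.card_le_card this).trans Finset.card_le_two
  have h1 (m n : ℕ) : (if m = n + 1 ∨ n = m + 1 then x m * y n else 0) ≤
      (if m = n + 1 ∨ n = m + 1 then x m ^ 2 / 2 else 0) +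
        (if m = n + 1 ∨ n = m + 1 then y n ^ 2 / 2 else 0) := by
    split_ifs
    · nlinarith [sq_nonneg (x m - y n)]
    · simp
  refine (Finset.sum_le_sum fun m _ => Finset.sum_le_sum fun n _ => h1 m n).trans ?_
  simp only [Finset.sum_add_distrib]
  refine add_le_add (Finset.sum_le_sum fun m _ => ?_) ?_
  · exact (key m _ (by positivity)).trans_eq (by ring)
  · rw [Finset.sum_comm]
    refine Finset.sum_le_sum fun n _ => ?_
    simp only [or_comm (b := n = _)]
    exact (key n _ (by positivity)).trans_eq (by ring)

/-- The number of ways of cutting for which two lengths have different tails. -/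
def tailDefect (N m n : ℕ) : ℕ :=
  ((Finset.range N).filter fun s => tailLength N s m ≠ tailLength N s n).card

theorem tailDefect_le {N m n : ℕ} (h : m ≤ n + 1) (h' : n ≤ m + 1) :
    tailDefect N m n ≤ if m = n + 1 ∨ n = m + 1 then 1 else 0 := by
  split_ifs with hm
  · obtain rfl | rfl := hm
    · exact card_tailLength_ne_le N n
    · rw [tailDefect]
      simp only [ne_comm (b := tailLength N _ (m + 1))]
      exact card_tailLength_ne_le N m
  · obtain rfl : m = n := by omega
    simp [tailDefect]

/-- A proportion `1 - tailDefect / N` of the cuts agrees. -/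
theorem sum_tailLength_eq {N : ℕ} (hN : N ≠ 0) {V : Type*} [AddCommGroup V] [Module ℂ V] (m n : ℕ)
    (x : V) :
    (N : ℂ)⁻¹ • ∑ s : Fin N, (if tailLength N s m = tailLength N s n then x else 0) - x =
      -(((N : ℂ)⁻¹ * tailDefect N m n) • x) := by
  have h1 : ((Finset.range N).filter fun s => tailLength N s m = tailLength N s n).card +
      tailDefect N m n = N := by
    rw [tailDefect, Finset.card_filter_add_card_filter_not, Finset.card_range]
  have h2 : (((Finset.range N).filter fun s => tailLength N s m = tailLength N s n).card : ℂ) =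
      N - tailDefect N m n := by
    rw [eq_sub_iff_add_eq]
    exact_mod_cast h1
  have hN' : (N : ℂ) ≠ 0 := Nat.cast_ne_zero.mpr hN
  rw [Fin.sum_univ_eq_sum_range fun s => if tailLength N s m = tailLength N s n then x else 0,
    ← Finset.sum_filter, Finset.sum_const, ← Nat.cast_smul_eq_nsmul ℂ, h2, smul_smul, mul_sub,
    inv_mul_cancel₀ hN', sub_smul, one_smul]
  abel

namespace AmalgamatedFreeProduct

/-! ### The grading by prefix length and the error estimate -/

section Grading

variable {B : Type*} [CStarAlgebra B] [PartialOrder B] [StarOrderedRing B]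
  {I : Type*} {A : I → Type*} [∀ i, CStarAlgebra (A i)] {P : ∀ i, CondExpInclusion B (A i)}

/-- The component spanned by the words whose maximal initial segment with letters from the algebras
with index in `J` has length `n`. -/
noncomputable def gradePart (J : Set I) (n : ℕ) : PreFock P →ₗ[ℂ] PreFock P :=
  lift fun w => if prefixLength J w.1 = n then tensor w else 0

variable (J : Set I)

theorem gradePart_tensor (n : ℕ) (u : Word P) (b : B) :
    gradePart J n (tensor u b) = if prefixLength J u.1 = n then tensor u b else 0 := by
  rw [gradePart, lift_tensor]
  split_ifs <;> rfl

theorem eventually_sum_gradePart (f : PreFock P) :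
    ∀ᶠ M in Filter.atTop, ∑ n ∈ Finset.range M, gradePart J n f = f := by
  induction f using PreFock.induction with
  | h0 => simp
  | hadd f g hf hg =>
    filter_upwards [hf, hg] with M h1 h2
    simp only [map_add, Finset.sum_add_distrib, h1, h2]
  | ht u b =>
    filter_upwards [Filter.eventually_gt_atTop (prefixLength J u.1)] with M hM
    simp only [gradePart_tensor]
    rw [Finset.sum_ite_eq, if_pos (Finset.mem_range.mpr hM)]

theorem sesq_gradePart (k : Word P → Word P → B) (m n : ℕ) (f g : PreFock P) :
    sesq k (gradePart J m f) (gradePart J n g) =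
      sesq (fun u v => if prefixLength J u.1 = m ∧ prefixLength J v.1 = n then k u v else 0) f g := by
  refine eq_sesq (F := fun f g => sesq k (gradePart J m f) (gradePart J n g)) ?_ ?_ ?_ f g
  · intro f f' g
    simp only [map_add, sesq_add_left]
  · intro f g g'
    simp only [map_add, sesq_add_right]
  · intro u b v c
    by_cases hu : prefixLength J u.1 = m
    · by_cases hv : prefixLength J v.1 = n
      · simp [gradePart_tensor, hu, hv, sesq_tensor]
      · simp [gradePart_tensor, hv, sesq_zero_right]
    · simp [gradePart_tensor, hu, sesq_zero_left]

theorem sesq_zero_kernel (f g : PreFock P) : sesq (fun _ _ : Word P => (0 : B)) f g = 0 :=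
  (eq_sesq (F := fun _ _ : PreFock P => (0 : B)) (by simp) (by simp) (by simp) f g).symm

theorem sesq_smul_kernel (z : ℂ) (k : Word P → Word P → B) (f g : PreFock P) :
    sesq (fun u v => z • k u v) f g = z • sesq k f g :=
  (eq_sesq (F := fun f g => z • sesq k f g) (by simp [sesq_add_left]) (by simp [sesq_add_right])
    (fun u b v c => by rw [sesq_tensor, mul_smul_comm, smul_mul_assoc]) f g).symm

theorem sesq_add_kernel (k l : Word P → Word P → B) (f g : PreFock P) :
    sesq (fun u v => k u v + l u v) f g = sesq k f g + sesq l f g :=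
  (eq_sesq (F := fun f g => sesq k f g + sesq l f g)
    (fun _ _ _ => by simp only [sesq_add_left]; abel)
    (fun _ _ _ => by simp only [sesq_add_right]; abel)
    (fun u b v c => by rw [sesq_tensor, sesq_tensor, mul_add, add_mul]) f g).symm

theorem sesq_sum_kernel {F : Type*} (t : Finset F) (k : F → Word P → Word P → B) (f g : PreFock P) :
    sesq (fun u v => ∑ s ∈ t, k s u v) f g = ∑ s ∈ t, sesq (k s) f g := by
  classical
  induction t using Finset.induction_on with
  | empty => simp only [Finset.sum_empty, sesq_zero_kernel]
  | insert s t hs ih => simp only [Finset.sum_insert hs, sesq_add_kernel, ih]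

theorem sesq_sum_sum (k : Word P → Word P → B) {F : Type*} (t : Finset F) (f g : F → PreFock P) :
    sesq k (∑ m ∈ t, f m) (∑ n ∈ t, g n) = ∑ m ∈ t, ∑ n ∈ t, sesq k (f m) (g n) := by
  have h1 (h : PreFock P) : sesq k (∑ m ∈ t, f m) h = ∑ m ∈ t, sesq k (f m) h :=
    map_sum (AddMonoidHom.mk' (fun x => sesq k x h) fun x y => sesq_add_left k x y h) f t
  rw [h1]
  refine Finset.sum_congr rfl fun m _ => ?_
  exact map_sum (AddMonoidHom.mk' (fun x => sesq k (f m) x) fun x y => sesq_add_right k _ x y) g t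

theorem preInner_gradePart_of_ne {m n : ℕ} (h : m ≠ n) (f g : PreFock P) :
    preInner (gradePart J m f) (gradePart J n g) = 0 := by
  rw [preInner, sesq_gradePart]
  refine (congrArg (fun k => sesq k f g) ?_).trans (sesq_zero_kernel f g)
  funext u v
  split_ifs with huv
  · by_contra hk
    have := prefixLength_eq_of_kernel_ne_zero J hk
    omega
  · rfl

variable [FiniteDimensional ℂ B]

theorem eventually_sum_norm_gradePart (f : PreFock P) : ∀ᶠ M in Filter.atTop,
    ∑ n ∈ Finset.range M, ‖toHilbert P (gradePart J n f : PreFock P)‖ ^ 2 =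
      ‖toHilbert P (f : Fock P)‖ ^ 2 := by
  filter_upwards [eventually_sum_gradePart J f] with M hM
  have h (f : PreFock P) : ‖toHilbert P (f : Fock P)‖ ^ 2 =
      (regularTrace B (preInner f f)).re := by
    rw [← fockInner_coe]
    exact norm_toHilbertₗ_sq P _
  simp only [h]
  conv_rhs => rw [← hM, preInner, sesq_sum_sum]
  rw [map_sum, Complex.re_sum]
  refine Finset.sum_congr rfl fun m hm => ?_
  rw [Finset.sum_eq_single m, preInner]
  · intro n _ hn
    exact preInner_gradePart_of_ne J hn.symm f f
  · exact fun h => absurd hm h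

variable {J}

theorem hilbertRep_rep (i : I) (a : A i) (x : Fock P) :
    hilbertRep P (rep P i a) (toHilbert P x) = toHilbert P (act P i a x) :=
  hilbertRep_toHilbert P (rep P i a) x

theorem norm_regularTrace_form_le (i : I) (a : A i) (f g : PreFock P) :
    ‖regularTrace B (form i a f g)‖ ≤
      ‖a‖ * (‖toHilbert P (f : Fock P)‖ * ‖toHilbert P (g : Fock P)‖) := by
  rw [← fockInner_coe_act, ← inner_toHilbert]
  have h2 : ‖hilbertRep P (rep P i a)‖ ≤ ‖a‖ :=
    (NonUnitalStarAlgHom.norm_apply_le (hilbertRep P) _).trans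
      (NonUnitalStarAlgHom.norm_apply_le (rep P i) a)
  rw [← hilbertRep_rep]
  calc _ ≤ ‖toHilbert P (f : Fock P)‖ * ‖hilbertRep P (rep P i a) (toHilbert P (g : Fock P))‖ :=
        norm_inner_le_norm _ _
    _ ≤ ‖toHilbert P (f : Fock P)‖ * (‖a‖ * ‖toHilbert P (g : Fock P)‖) := by
        gcongr
        exact (ContinuousLinearMap.le_opNorm _ _).trans (by gcongr)
    _ = _ := by ring

/-- Relative to the grading by prefix length, `a` has only entries at distance at most one. There
the defect is `0` on the diagonal and at most `1` off it, so a sum over neighbouring grades remains.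
-/
theorem norm_regularTrace_sesq_tailDefect_le {i : I} (hi : i ∈ J) (a : A i) (N : ℕ)
    (f g : PreFock P) :
    ‖regularTrace B (sesq (fun u v => (tailDefect N (prefixLength J u.1) (prefixLength J v.1) : ℂ) •
      actKernel i a u.1 v.1) f g)‖ ≤
      ‖a‖ * (‖toHilbert P (f : Fock P)‖ ^ 2 + ‖toHilbert P (g : Fock P)‖ ^ 2) := by
  set k : Word P → Word P → B := fun u v =>
    (tailDefect N (prefixLength J u.1) (prefixLength J v.1) : ℂ) • actKernel i a u.1 v.1 with hk
  have h1 (m n : ℕ) : sesq k (gradePart J m f) (gradePart J n g) =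
      (tailDefect N m n : ℂ) • form i a (gradePart J m f) (gradePart J n g) := by
    rw [form_eq_sesq, sesq_gradePart, sesq_gradePart, ← sesq_smul_kernel]
    congr 1
    funext u v
    split_ifs with h
    · simp only [hk, h.1, h.2]
    · rw [smul_zero]
  have h2 (m n : ℕ) (hmn : ¬ (m ≤ n + 1 ∧ n ≤ m + 1)) :
      form i a (gradePart J m f) (gradePart J n g) = 0 := by
    rw [form_eq_sesq, sesq_gradePart]
    refine (congrArg (fun k => sesq k f g) ?_).trans (sesq_zero_kernel f g)
    funext u v
    split_ifs with h
    · by_contra hne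
      have := prefixLength_le_of_actKernel_ne_zero hi hne
      omega
    · rfl
  let x (m : ℕ) : ℝ := ‖toHilbert P (gradePart J m f : PreFock P)‖
  let y (m : ℕ) : ℝ := ‖toHilbert P (gradePart J m g : PreFock P)‖
  have h3 (m n : ℕ) : ‖regularTrace B (sesq k (gradePart J m f) (gradePart J n g))‖ ≤
      ‖a‖ * if m = n + 1 ∨ n = m + 1 then x m * y n else 0 := by
    rw [h1, map_smul, norm_smul, Complex.norm_natCast]
    by_cases hmn : m ≤ n + 1 ∧ n ≤ m + 1
    · have h4 := tailDefect_le (N := N) hmn.1 hmn.2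
      split_ifs at h4 ⊢ with h5
      · have h6 : (tailDefect N m n : ℝ) ≤ 1 := by exact_mod_cast h4
        exact (mul_le_of_le_one_left (norm_nonneg _) h6).trans (norm_regularTrace_form_le i a _ _)
      · rw [Nat.le_zero.mp h4]
        simp
    · rw [h2 m n hmn, if_neg (by omega)]
      simp
  -- One bound `M` captures all the nonzero components of `f` and of `g`.
  obtain ⟨M, h4, h5, h6, h7⟩ := ((eventually_sum_gradePart J f).and
    ((eventually_sum_gradePart J g).and ((eventually_sum_norm_gradePart J f).and
      (eventually_sum_norm_gradePart J g)))).exists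
  rw [← h6, ← h7]
  conv_lhs => rw [← h4, ← h5, sesq_sum_sum, map_sum]
  simp only [map_sum]
  refine (norm_sum_le _ _).trans ?_
  refine (Finset.sum_le_sum fun m _ => (norm_sum_le _ _).trans
    (Finset.sum_le_sum fun n _ => h3 m n)).trans ?_
  simp only [← Finset.mul_sum]
  gcongr
  exact sum_neighbour_mul_le M x y

theorem norm_le_of_norm_inner_toHilbert_le {T : HilbertFock P →L[ℂ] HilbertFock P} {C : ℝ}
    (hC : 0 ≤ C) (h : ∀ f g : PreFock P,
      ‖⟪toHilbert P (f : Fock P), T (toHilbert P (g : Fock P))⟫_ℂ‖ ≤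
        C * (‖toHilbert P (f : Fock P)‖ ^ 2 + ‖toHilbert P (g : Fock P)‖ ^ 2)) : ‖T‖ ≤ 2 * C := by
  refine norm_le_of_norm_inner_le hC fun x y => ?_
  obtain ⟨x, rfl⟩ := (toHilbert P).surjective x
  obtain ⟨y, rfl⟩ := (toHilbert P).surjective y
  induction x, y using UniformSpace.Completion.induction_on₂ with
  | hp => exact isClosed_le (by fun_prop) (by fun_prop)
  | ih f g => exact h f g

/-- Averaging the `N` cuts multiplies each coefficient of `a` by the proportion of cuts that agree
on the two words. The error is `-1/N` times the form bounded in
`norm_regularTrace_sesq_tailDefect_le`; the factor `2` comes from passing from forms to norms. -/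
theorem IsWordFrame.norm_blockMap_sub_le {N : ℕ} (hN : N ≠ 0) {ι : Type*} [Fintype ι]
    {g : ι → Fock P} (hg : IsWordFrame J N g) {i : I} (hi : i ∈ J) (a : A i)
    {T : HilbertFock P →L[ℂ] HilbertFock P}
    (hT : ∀ x, T (toHilbert P x) = toHilbert P (act P i a x)) :
    ‖blockMap LinearMap.id (fun r => toHilbert P (g r)) hg.cutOp (N : ℂ)⁻¹
        T - T‖ ≤ 2 * ((N : ℝ)⁻¹ * ‖a‖) := by
  classical
  refine norm_le_of_norm_inner_toHilbert_le (by positivity) fun f h => ?_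
  have e1 (r r' : ι) : ⟪toHilbert P (g r), T (toHilbert P (g r'))⟫_ℂ =
      regularTrace B (fockInner (g r) (act P i a (g r'))) := by
    rw [hT, inner_toHilbert]
  have e2 : ⟪toHilbert P (f : Fock P),
      (blockMap LinearMap.id (fun r => toHilbert P (g r)) hg.cutOp (N : ℂ)⁻¹
        T - T) (toHilbert P (h : Fock P))⟫_ℂ =
      -((N : ℂ)⁻¹ * regularTrace B (sesq (fun u v =>
        (tailDefect N (prefixLength J u.1) (prefixLength J v.1) : ℂ) •
          actKernel i a u.1 v.1) f h)) := by
    have e3 : ⟪toHilbert P (f : Fock P),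
        T (toHilbert P (h : Fock P))⟫_ℂ =
        regularTrace B (sesq (fun u v => actKernel i a u.1 v.1) f h) := by
      rw [hT, inner_toHilbert, ← form_eq_sesq, ← fockInner_coe_act]
    have e4 (s : Fin N) : ∑ r, ∑ r', regularTrace B (fockInner (g r) (act P i a (g r'))) *
        regularTrace B (preInner (cutMap J N s (g r) f) (cutMap J N s (g r') h)) =
        regularTrace B (sesq (fun u v =>
          if tailLength N s (prefixLength J u.1) = tailLength N s (prefixLength J v.1)
          then actKernel i a u.1 v.1 else 0) f h) := by
      rw [← hg.sum_sum_preInner_cutMap s.2 hi a f h]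
      simp only [map_sum, map_smul, smul_eq_mul]
    rw [sub_apply, inner_sub_right, e3, blockMap_apply]
    simp only [LinearMap.id_apply, smul_apply, sum_apply, inner_smul_right, inner_sum, e1,
      hg.inner_star_cutOp_mul, e4]
    rw [← map_sum, ← sesq_sum_kernel, ← smul_eq_mul, ← smul_eq_mul, ← map_smul, ← map_smul,
      ← map_sub, ← map_neg, ← sesq_smul_kernel, ← sesq_smul_kernel]
    refine congrArg _ ?_
    rw [sub_eq_iff_eq_add, ← neg_one_smul ℂ (sesq _ f h), ← sesq_smul_kernel, ← sesq_add_kernel]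
    congr 1
    funext u v
    rw [← sub_eq_iff_eq_add, sum_tailLength_eq hN, smul_smul, smul_smul, neg_one_mul, neg_mul,
      neg_smul]
  rw [e2, norm_neg, norm_mul, norm_inv, Complex.norm_natCast, mul_assoc]
  gcongr
  exact norm_regularTrace_sesq_tailDefect_le hi a N f h

end Grading

end AmalgamatedFreeProduct

end

section

open scoped CStarAlgebra ComplexOrder InnerProductSpace

/-! ### Factoring through a matrix algebra -/

section Factorization

variable {X : Type*} [CStarAlgebra X] {E : Type*} [NormedAddCommGroup E] [InnerProductSpace ℂ E]
  [CompleteSpace E] {H : Type*} [NormedAddCommGroup H] [InnerProductSpace ℂ H] [CompleteSpace H]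

/-- The compression of a representation to a subspace. -/
noncomputable def compression {K : Type*} [NormedAddCommGroup K] [InnerProductSpace ℂ K]
    [CompleteSpace K] (ρ : X →⋆ₐ[ℂ] (E →L[ℂ] E)) (U : K →L[ℂ] E) : X →ₗ[ℂ] (K →L[ℂ] K) where
  toFun a := U.adjoint ∘L ρ a ∘L U
  map_add' a b := by
    ext x
    simp
  map_smul' z a := by
    ext x
    simp

theorem inner_compression {K : Type*} [NormedAddCommGroup K] [InnerProductSpace ℂ K]
    [CompleteSpace K] (ρ : X →⋆ₐ[ℂ] (E →L[ℂ] E)) (U : K →L[ℂ] E) (a : X) (x y : K) :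
    ⟪x, compression ρ U a y⟫_ℂ = ⟪U x, ρ a (U y)⟫_ℂ :=
  ContinuousLinearMap.adjoint_inner_right U x _

theorem kernelPositive_compression {K : Type*} [NormedAddCommGroup K] [InnerProductSpace ℂ K]
    [CompleteSpace K] (ρ : X →⋆ₐ[ℂ] (E →L[ℂ] E)) (U : K →L[ℂ] E) :
    KernelPositive (compression ρ U) := by
  intro n a h
  have e : ∑ i, ∑ j, ⟪h i, compression ρ U (star (a i) * a j) (h j)⟫_ℂ =
      ⟪∑ i, ρ (a i) (U (h i)), ∑ j, ρ (a j) (U (h j))⟫_ℂ := by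
    rw [sum_inner]
    refine Finset.sum_congr rfl fun i _ => ?_
    rw [inner_sum]
    refine Finset.sum_congr rfl fun j _ => ?_
    rw [inner_compression, map_mul, map_star, mul_apply_eq_comp,
      ContinuousLinearMap.star_eq_adjoint, ContinuousLinearMap.adjoint_inner_right]
  rw [e, inner_self_eq_norm_sq_to_K]
  exact pow_nonneg (Complex.zero_le_real.mpr (norm_nonneg (∑ i, ρ (a i) (U (h i))))) 2

theorem compression_one_le {K : Type*} [NormedAddCommGroup K] [InnerProductSpace ℂ K]
    [CompleteSpace K] (ρ : X →⋆ₐ[ℂ] (E →L[ℂ] E)) (U : K →L[ℂ] E) (hU : ∀ x, ‖U x‖ ≤ ‖x‖) :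
    compression ρ U 1 ≤ 1 := by
  rw [← sub_nonneg]
  refine opNonneg_of_inner fun x => ?_
  rw [sub_apply, inner_sub_right, inner_compression, map_one, one_apply_eq_self, one_apply_eq_self,
    inner_self_eq_norm_sq_to_K, inner_self_eq_norm_sq_to_K, sub_nonneg]
  have := hU x
  have h2 : ‖U x‖ ^ 2 ≤ ‖x‖ ^ 2 := by gcongr
  exact_mod_cast h2

theorem map_one_le_one (π : X →⋆ₙₐ[ℂ] (H →L[ℂ] H)) : π 1 ≤ 1 := by
  have h1 : star (π 1) = π 1 := by rw [← map_star, star_one]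
  have h2 : π 1 * π 1 = π 1 := by rw [← map_mul, one_mul]
  have h3 : star (1 - π 1) * (1 - π 1) = 1 - π 1 := by
    rw [star_sub, star_one, h1, sub_mul, one_mul, mul_sub, mul_one, h2, sub_self, sub_zero]
  rw [← sub_nonneg, ← h3]
  exact star_mul_self_nonneg _

omit [CompleteSpace H] in
theorem KernelPositive.comp_starAlgHom {L : Type*} [CStarAlgebra L] {φ : L →ₗ[ℂ] (H →L[ℂ] H)}
    (hφ : KernelPositive φ) (ρ : X →⋆ₐ[ℂ] L) : KernelPositive (φ ∘ₗ ρ.toAlgHom.toLinearMap) := by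
  intro n a h
  refine (hφ n (fun i => ρ (a i)) h).trans_eq ?_
  refine Finset.sum_congr rfl fun i _ => Finset.sum_congr rfl fun j _ => ?_
  change _ = ⟪h i, φ (ρ (star (a i) * a j)) (h j)⟫_ℂ
  rw [map_mul ρ, StarHomClass.map_star ρ]

/-- A factorization of a perturbation of `π` through a matrix algebra. -/
theorem exists_factorization [PartialOrder X] [StarOrderedRing X] (ρ : X →⋆ₐ[ℂ] (E →L[ℂ] E))
    (hρ : Function.Injective ρ) (π : X →⋆ₙₐ[ℂ] (H →L[ℂ] H)) {N : ℕ} (hN : N ≠ 0) {ι : Type*}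
    [Fintype ι] (x : ι → E) (hx : ∀ c : EuclideanSpace ℂ ι, ‖∑ r, c r • x r‖ ≤ ‖c‖)
    (v : Fin N → ι → (E →L[ℂ] E)) (hv : ∀ s, ∑ r, star (v s r) * v s r = 1) :
    ∃ (f : X →CP (EuclideanSpace ℂ ι →L[ℂ] EuclideanSpace ℂ ι))
      (g : (EuclideanSpace ℂ ι →L[ℂ] EuclideanSpace ℂ ι) →CP (H →L[ℂ] H))
      (θ : X →ₗ[ℂ] (H →L[ℂ] H)), (∀ a, ‖f a‖ ≤ ‖a‖) ∧ (∀ d, ‖g d‖ ≤ ‖d‖) ∧ KernelPositive θ ∧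
      θ 1 ≤ 1 ∧ (∀ a, g (f a) = θ a) ∧
      ∀ a, ‖θ a - π a‖ ≤ ‖blockMap LinearMap.id x v (N : ℂ)⁻¹ (ρ a) - ρ a‖ := by
  classical
  obtain ⟨Φ, hΦ, hΦπ⟩ := exists_kernelPositive_extension ρ hρ π
  have hΦ1 : Φ 1 ≤ 1 := by
    rw [← map_one ρ, hΦπ]
    exact map_one_le_one π
  -- `U` sends the standard basis to the vectors `x r` and is a contraction by `hx`; the map into
  -- matrices is compression by `U`.
  let U : EuclideanSpace ℂ ι →L[ℂ] E := LinearMap.toContinuousLinearMap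
    (∑ r, (EuclideanSpace.proj r : EuclideanSpace ℂ ι →L[ℂ] ℂ).toLinearMap.smulRight (x r))
  have hU (c : EuclideanSpace ℂ ι) : U c = ∑ r, c r • x r := by
    simp [U]
  have hUe (r : ι) : U (EuclideanSpace.single r 1) = x r := by
    rw [hU, Finset.sum_eq_single r]
    · simp
    · intro b _ hb
      simp [hb]
    · simp
  have hc : (0 : ℂ) ≤ (N : ℂ)⁻¹ := by
    rw [← Complex.ofReal_natCast, ← Complex.ofReal_inv]
    exact Complex.zero_le_real.mpr (by positivity)
  have hf := kernelPositive_compression ρ U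
  have hf1 := compression_one_le ρ U fun c => by
    rw [hU]
    exact hx c
  let g := blockMap Φ (fun r : ι => (EuclideanSpace.single r 1 : EuclideanSpace ℂ ι)) v (N : ℂ)⁻¹
  have hg : KernelPositive g := kernelPositive_blockMap hΦ _ v hc
  have hg1 : g 1 ≤ 1 := by
    have : g 1 = Φ 1 := by
      -- At the identity only `r = r'` survives, and `hv` makes each of the `N` cuts contribute `Φ
      -- 1`.
      have h1 (s : Fin N) : ∑ r, ∑ r', ⟪(EuclideanSpace.single r 1 : EuclideanSpace ℂ ι),
          (1 : EuclideanSpace ℂ ι →L[ℂ] EuclideanSpace ℂ ι) (EuclideanSpace.single r' 1)⟫_ℂ •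
            Φ (star (v s r) * v s r') = Φ 1 := by
        rw [← hv s, map_sum]
        refine Finset.sum_congr rfl fun r _ => ?_
        rw [Finset.sum_eq_single r]
        · simp
        · intro r' _ hr
          simp [EuclideanSpace.inner_single_left, hr]
        · simp
      simp only [g, blockMap_apply, h1]
      rw [Finset.sum_const, Finset.card_univ, Fintype.card_fin, ← Nat.cast_smul_eq_nsmul ℂ,
        smul_smul, inv_mul_cancel₀ (Nat.cast_ne_zero.mpr hN), one_smul]
    rw [this]
    exact hΦ1
  have hgf (a : X) : g (compression ρ U a) = blockMap Φ x v (N : ℂ)⁻¹ (ρ a) := by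
    simp only [g, blockMap_apply, inner_compression, hUe]
  have hθ := (kernelPositive_blockMap hΦ x v hc).comp_starAlgHom ρ
  refine ⟨hf.toCP, hg.toCP, blockMap Φ x v (N : ℂ)⁻¹ ∘ₗ ρ.toAlgHom.toLinearMap, fun a => ?_,
    fun d => ?_, hθ, ?_, fun a => ?_, fun a => ?_⟩
  · rw [hf.toCP_apply]
    exact hf.norm_le hf1 a
  · rw [hg.toCP_apply]
    exact hg.norm_le hg1 d
  · have : (blockMap Φ x v (N : ℂ)⁻¹ ∘ₗ ρ.toAlgHom.toLinearMap) 1 = g (compression ρ U 1) :=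
      (hgf 1).symm
    rw [this]
    exact (hg.map_mono hf1).trans hg1
  · rw [hf.toCP_apply, hg.toCP_apply, hgf]
    rfl
  -- Since `Φ ∘ ρ = π`, the error in `π` is the image under the contraction `Φ` of the error in the
  -- concrete representation `ρ`.
  · have : (blockMap Φ x v (N : ℂ)⁻¹ ∘ₗ ρ.toAlgHom.toLinearMap) a - π a =
        Φ (blockMap LinearMap.id x v (N : ℂ)⁻¹ (ρ a) - ρ a) := by
      rw [map_sub, hΦπ]
      simp only [blockMap_apply, map_smul, map_sum, LinearMap.id_apply]
      rfl
    rw [this]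
    exact hΦ.norm_le hΦ1 _

end Factorization

/-! ### Bounds for the rank -/

section Rank

theorem cstarRank_le_finrank (D : Type*) [CStarAlgebra D] [FiniteDimensional ℂ D] :
    cstarRank D ≤ Module.finrank ℂ D := by
  refine csSup_le' ?_
  rintro d ⟨S, -, rfl⟩
  exact Submodule.finrank_le S.toSubalgebra.toSubmodule

theorem one_le_cstarRank (D : Type*) [CStarAlgebra D] [FiniteDimensional ℂ D] [Nontrivial D] :
    1 ≤ cstarRank D := by
  have h : Module.finrank ℂ (⊥ : StarSubalgebra ℂ D) ≤ cstarRank D := by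
    refine le_csSup ⟨Module.finrank ℂ D, ?_⟩ ⟨⊥, ?_, rfl⟩
    · rintro d ⟨S, -, rfl⟩
      exact Submodule.finrank_le S.toSubalgebra.toSubmodule
    · intro x hx y hy
      obtain ⟨a, rfl⟩ := StarSubalgebra.mem_bot.mp hx
      exact Algebra.commutes a y
  refine le_trans ?_ h
  have : Module.Finite ℂ (⊥ : StarSubalgebra ℂ D) :=
    inferInstanceAs (Module.Finite ℂ (⊥ : StarSubalgebra ℂ D).toSubalgebra.toSubmodule)
  exact Module.finrank_pos

variable {A : Type*} [CStarAlgebra A] [PartialOrder A] [StarOrderedRing A]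
  {H : Type*} [NormedAddCommGroup H] [InnerProductSpace ℂ H] [CompleteSpace H]

theorem one_le_cpRank (π : A →⋆ₙₐ[ℂ] (H →L[ℂ] H)) (ω : Set A) (δ : ℝ) : 1 ≤ cpRank π ω δ := by
  refine le_sInf ?_
  rintro r ⟨D, _, _, _, f, g, _, _, -, -, -, rfl⟩
  exact_mod_cast one_le_cstarRank D

/-- The crude bound of the rank by the dimension suffices for polynomial growth. The index type
`Option (Fin m)` keeps the matrix algebra nonzero when `m = 0`. -/
theorem cpRank_le (π : A →⋆ₙₐ[ℂ] (H →L[ℂ] H)) {ω : Set A} {δ : ℝ} (m : ℕ)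
    (f : A →CP (EuclideanSpace ℂ (Option (Fin m)) →L[ℂ] EuclideanSpace ℂ (Option (Fin m))))
    (g : (EuclideanSpace ℂ (Option (Fin m)) →L[ℂ] EuclideanSpace ℂ (Option (Fin m))) →CP
      (H →L[ℂ] H)) (hf : ∀ a, ‖f a‖ ≤ ‖a‖) (hg : ∀ d, ‖g d‖ ≤ ‖d‖)
    (h : ∀ a ∈ ω, ‖g (f a) - π a‖ < δ) : cpRank π ω δ ≤ ((m + 1) ^ 2 : ℕ) := by
  have h1 : cpRank π ω δ ≤ (cstarRank (EuclideanSpace ℂ (Option (Fin m)) →L[ℂ]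
      EuclideanSpace ℂ (Option (Fin m))) : ℕ∞) :=
    sInf_le ⟨_, inferInstance, inferInstance, inferInstance, f, g,
      inferInstance, inferInstance, hf, hg, h, rfl⟩
  refine h1.trans (Nat.cast_le.mpr ((cstarRank_le_finrank _).trans_eq ?_))
  rw [← (LinearMap.toContinuousLinearMap (𝕜 := ℂ) (E := EuclideanSpace ℂ (Option (Fin m)))
    (F' := EuclideanSpace ℂ (Option (Fin m)))).finrank_eq, Module.finrank_linearMap]
  simp [pow_two]

end Rank

end

section

open scoped CStarAlgebra ComplexOrder InnerProductSpace Topology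

/-! ### From generators to all elements -/

section AsymptoticallyMultiplicative

variable {X : Type*} [CStarAlgebra X] {H : Type*} [NormedAddCommGroup H] [InnerProductSpace ℂ H]
  [CompleteSpace H] {T : Type*}

theorem KernelPositive.norm_apply_sub_le {θ : X →ₗ[ℂ] (H →L[ℂ] H)} (hθ : KernelPositive θ)
    (h1 : θ 1 ≤ 1) (π : X →⋆ₙₐ[ℂ] (H →L[ℂ] H)) (a : X) : ‖θ a - π a‖ ≤ 2 * ‖a‖ := by
  have h2 := hθ.norm_le h1 a
  have h3 := NonUnitalStarAlgHom.norm_apply_le π a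
  have := norm_sub_le (θ a) (π a)
  linarith

/-- Products with asymptotically multiplicative elements are controlled. -/
theorem KernelPositive.tendsto_mul {l : Filter T} {θ : T → X →ₗ[ℂ] (H →L[ℂ] H)}
    (hθ : ∀ t, KernelPositive (θ t)) (h1 : ∀ t, θ t 1 ≤ 1) (π : X →⋆ₙₐ[ℂ] (H →L[ℂ] H))
    {x y : T → X} {C : ℝ} (hC : ∀ t, ‖x t‖ ≤ C) (hC' : ∀ t, ‖y t‖ ≤ C)
    (hx : Filter.Tendsto (fun t => ‖θ t (x t) - π (x t)‖) l (𝓝 0))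
    (hy : Filter.Tendsto (fun t => ‖θ t (y t) - π (y t)‖) l (𝓝 0))
    (hyy : Filter.Tendsto (fun t => ‖θ t (star (y t) * y t) - π (star (y t) * y t)‖) l (𝓝 0)) :
    Filter.Tendsto (fun t => ‖θ t (x t * y t) - π (x t * y t)‖) l (𝓝 0) := by
  have hsqrt : Filter.Tendsto (fun t => C * √(‖θ t (star (y t) * y t) - π (star (y t) * y t)‖ +
      2 * C * ‖θ t (y t) - π (y t)‖)) l (𝓝 0) := by
    have := (hyy.add (hy.const_mul (2 * C))).sqrt.const_mul C
    simpa using this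
  have hsum := hsqrt.add ((hx.const_mul C).add (hy.const_mul C))
  rw [mul_zero, add_zero, add_zero] at hsum
  refine squeeze_zero (fun t => norm_nonneg _) (fun t => ?_) hsum
  have hC0 : 0 ≤ C := (norm_nonneg _).trans (hC t)
  have hxn := hC t
  have hyn := hC' t
  have hθx := ((hθ t).norm_le (h1 t) (x t)).trans hxn
  have hθy := ((hθ t).norm_le (h1 t) (y t)).trans hyn
  have hπx := (NonUnitalStarAlgHom.norm_apply_le π (x t)).trans hxn
  have hπy := (NonUnitalStarAlgHom.norm_apply_le π (y t)).trans hyn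
  -- As `π` is multiplicative, the defect of `θ` at `y` is controlled by its distance to `π` at `y`
  -- and at `star y * y`.
  have h2 : ‖θ t (star (y t) * y t) - star (θ t (y t)) * θ t (y t)‖ ≤
      ‖θ t (star (y t) * y t) - π (star (y t) * y t)‖ + 2 * C * ‖θ t (y t) - π (y t)‖ := by
    have e : θ t (star (y t) * y t) - star (θ t (y t)) * θ t (y t) =
        (θ t (star (y t) * y t) - π (star (y t) * y t)) -
          (star (θ t (y t) - π (y t)) * θ t (y t) + star (π (y t)) * (θ t (y t) - π (y t))) := by
      rw [map_mul π, StarHomClass.map_star π, star_sub, sub_mul, mul_sub]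
      abel
    rw [e]
    refine (norm_sub_le _ _).trans (add_le_add_right ((norm_add_le _ _).trans ?_) _)
    have e1 := norm_mul_le (star (θ t (y t) - π (y t))) (θ t (y t))
    have e2 := norm_mul_le (star (π (y t))) (θ t (y t) - π (y t))
    rw [norm_star] at e1 e2
    have e3 := mul_le_mul_of_nonneg_left hθy (norm_nonneg (θ t (y t) - π (y t)))
    have e4 := mul_le_mul_of_nonneg_right hπy (norm_nonneg (θ t (y t) - π (y t)))
    linarith
  have h3 : ‖θ t (x t * y t) - θ t (x t) * θ t (y t)‖ ≤
      C * √(‖θ t (star (y t) * y t) - π (star (y t) * y t)‖ +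
        2 * C * ‖θ t (y t) - π (y t)‖) := by
    refine abs_le_of_sq_le_sq' ?_ (by positivity) |>.2
    rw [mul_pow, Real.sq_sqrt (by positivity)]
    refine ((hθ t).norm_defect_sq_le (h1 t) (x t) (y t)).trans ?_
    gcongr
  have e : θ t (x t * y t) - π (x t * y t) = (θ t (x t * y t) - θ t (x t) * θ t (y t)) +
      ((θ t (x t) - π (x t)) * θ t (y t) + π (x t) * (θ t (y t) - π (y t))) := by
    rw [map_mul π, sub_mul, mul_sub]
    abel
  rw [e]
  refine (norm_add_le _ _).trans (add_le_add h3 ((norm_add_le _ _).trans (add_le_add ?_ ?_)))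
  · refine (norm_mul_le _ _).trans ?_
    rw [mul_comm]
    gcongr
  · refine (norm_mul_le _ _).trans ?_
    gcongr

/-- The differences between `θ t` and `π` on `φ t x` are Lipschitz in `x` with constant `2`,
uniformly in `t`. -/
theorem isClosed_setOf_tendsto {l : Filter T} {θ : T → X →ₗ[ℂ] (H →L[ℂ] H)}
    (hθ : ∀ t, KernelPositive (θ t)) (h1 : ∀ t, θ t 1 ≤ 1) (π : X →⋆ₙₐ[ℂ] (H →L[ℂ] H))
    (φ : T → X →⋆ₐ[ℂ] X) :
    IsClosed {x | Filter.Tendsto (fun t => ‖θ t (φ t x) - π (φ t x)‖) l (𝓝 0)} := by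
  rw [← isSeqClosed_iff_isClosed]
  intro u x hu hx
  rw [Set.mem_ofPred_eq, Metric.tendsto_nhds]
  intro ε hε
  obtain ⟨n, hn⟩ := ((Metric.tendsto_nhds.mp hx) (ε / 4) (by positivity)).exists
  filter_upwards [Metric.tendsto_nhds.mp (hu n) (ε / 2) (by positivity)] with t ht
  rw [Real.dist_0_eq_abs, abs_norm] at ht ⊢
  have e : θ t (φ t x) - π (φ t x) = (θ t (φ t (u n)) - π (φ t (u n))) -
      (θ t (φ t (u n - x)) - π (φ t (u n - x))) := by
    simp only [map_sub]
    abel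
  have h2 := (hθ t).norm_apply_sub_le (h1 t) π (φ t (u n - x))
  have h3 := NonUnitalStarAlgHom.norm_apply_le (φ t) (u n - x)
  rw [dist_eq_norm] at hn
  rw [e]
  have h4 := norm_sub_le (θ t (φ t (u n)) - π (φ t (u n)))
    (θ t (φ t (u n - x)) - π (φ t (u n - x)))
  linarith

/-- If the maps `θ t` asymptotically agree with `π` on the images of the elements of a generating
set, then they asymptotically agree with `π` on the images of all elements. -/
theorem tendsto_of_induction (s : Set X)
    (hs : ∀ p : X → Prop, IsClosed {x | p x} → p 1 → (∀ x y, p x → p y → p (x + y)) →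
      (∀ (z : ℂ) x, p x → p (z • x)) → (∀ x, ∀ a ∈ s, p x → p (x * a)) → ∀ x, p x)
    (hs1 : 1 ∈ s) (hss : ∀ a ∈ s, star a * a ∈ s)
    {l : Filter T} {θ : T → X →ₗ[ℂ] (H →L[ℂ] H)}
    (hθ : ∀ t, KernelPositive (θ t)) (h1 : ∀ t, θ t 1 ≤ 1) (π : X →⋆ₙₐ[ℂ] (H →L[ℂ] H))
    (φ : T → X →⋆ₐ[ℂ] X)
    (hl : ∀ a ∈ s, Filter.Tendsto (fun t => ‖θ t (φ t a) - π (φ t a)‖) l (𝓝 0)) (x : X) :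
    Filter.Tendsto (fun t => ‖θ t (φ t x) - π (φ t x)‖) l (𝓝 0) := by
  refine hs (fun x => Filter.Tendsto (fun t => ‖θ t (φ t x) - π (φ t x)‖) l (𝓝 0))
    (isClosed_setOf_tendsto hθ h1 π φ) (hl 1 hs1) ?_ ?_ ?_ x
  · intro x y hx hy
    have := hx.add hy
    rw [add_zero] at this
    refine squeeze_zero (fun t => norm_nonneg _) (fun t => ?_) this
    have e : θ t (φ t (x + y)) - π (φ t (x + y)) =
        (θ t (φ t x) - π (φ t x)) + (θ t (φ t y) - π (φ t y)) := by
      simp only [map_add]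
      abel
    rw [e]
    exact norm_add_le _ _
  · intro z x hx
    have := hx.const_mul ‖z‖
    rw [mul_zero] at this
    refine this.congr fun t => ?_
    rw [map_smul, map_smul, map_smul, ← smul_sub, norm_smul]
  -- Only the right factor must have small defect, so agreement at `a` and `star a * a` suffices;
  -- nothing is needed about `star x * x`.
  · intro x a ha hx
    have h2 := hl _ (hss a ha)
    simp only [map_mul (φ _), map_star] at h2 ⊢
    exact KernelPositive.tendsto_mul hθ h1 π
      (fun t => (NonUnitalStarAlgHom.norm_apply_le (φ t) x).trans (le_max_left _ ‖a‖))
      (fun t => (NonUnitalStarAlgHom.norm_apply_le (φ t) a).trans (le_max_right _ _))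
      hx (hl a ha) h2

end AsymptoticallyMultiplicative

open AmalgamatedFreeProduct

/-! ### Approximation of the algebras with index in a finite set -/

section WordFrame

variable {B : Type*} [CStarAlgebra B] [PartialOrder B] [StarOrderedRing B] [FiniteDimensional ℂ B]
  {I : Type*} {A : I → Type*} [∀ i, CStarAlgebra (A i)] {P : ∀ i, CondExpInclusion B (A i)}

-- The frame is an orthonormal basis of the word space for the scalar inner product. The extra index
-- `none` carries the zero vector, which affects neither Parseval's identity nor the contraction
-- bound.
variable (P) in
theorem exists_isWordFrame [∀ i, FiniteDimensional ℂ (A i)] (J : Finset I) (N : ℕ) :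
    ∃ m ≤ (1 + ∑ i ∈ J, Module.finrank ℂ (A i)) ^ N * Module.finrank ℂ B,
      ∃ g : Option (Fin m) → Fock P, IsWordFrame (J : Set I) N g ∧
        ∀ c : EuclideanSpace ℂ (Option (Fin m)), ‖∑ r, c r • toHilbert P (g r)‖ ≤ ‖c‖ := by
  obtain ⟨W, hW, h1, h2⟩ := exists_wordSpace P J N
  let W' : Submodule ℂ (HilbertFock P) := W.map (toHilbert P).toLinearEquiv.toLinearMap
  let b := stdOrthonormalBasis ℂ W'
  let x : Option (Fin (Module.finrank ℂ W')) → HilbertFock P := fun r => r.elim 0 fun k => b k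
  have hx (r) : toHilbert P ((toHilbert P).symm (x r)) = x r := (toHilbert P).apply_symm_apply _
  refine ⟨Module.finrank ℂ W', ?_, fun r => (toHilbert P).symm (x r), ?_, ?_⟩
  · exact (Submodule.finrank_map_le _ W).trans h2
  · intro u hu y z
    have hw : toHilbert P ((tensor u y : PreFock P) : Fock P) ∈ W' := ⟨_, h1 u hu y, rfl⟩
    simp only [← inner_toHilbert, hx]
    rw [Fintype.sum_option]
    simp only [x, Option.elim, inner_zero_right, zero_mul, zero_add]
    have h3 : toHilbert P ((tensor u y : PreFock P) : Fock P) =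
        ∑ k, ⟪(b k : HilbertFock P), toHilbert P ((tensor u y : PreFock P) : Fock P)⟫_ℂ •
          (b k : HilbertFock P) := by
      have := congrArg Subtype.val (b.sum_repr' ⟨_, hw⟩)
      rw [Submodule.coe_sum] at this
      exact this.symm
    conv_rhs => rw [h3]
    rw [sum_inner]
    refine Finset.sum_congr rfl fun k _ => ?_
    rw [inner_smul_left, inner_conj_symm]
  · intro c
    simp only [hx]
    rw [Fintype.sum_option]
    simp only [x, Option.elim, smul_zero, zero_add]
    have h4 : ∑ k, c (some k) • (b k : HilbertFock P) =
        ((b.repr.symm (WithLp.toLp 2 fun k => c (some k)) : W') : HilbertFock P) := by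
      rw [← b.sum_repr_symm, Submodule.coe_sum]
      rfl
    rw [h4, ← Submodule.coe_norm, LinearIsometryEquiv.norm_map, EuclideanSpace.norm_eq,
      EuclideanSpace.norm_eq]
    refine Real.sqrt_le_sqrt ?_
    rw [Fintype.sum_option]
    exact le_add_of_nonneg_left (sq_nonneg _)

variable (P) in
/-- The reduced free product, acting on the Hilbert space. -/
noncomputable def freeProductRep :
    ReducedFreeProduct P →⋆ₐ[ℂ] (HilbertFock P →L[ℂ] HilbertFock P) :=
  (hilbertRep P).comp (algebra P).subtype

theorem freeProductRep_injective : Function.Injective (freeProductRep P) :=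
  (hilbertRep_injective P).comp Subtype.val_injective

theorem freeProductRep_embed (i : I) (a : A i) (x : Fock P) :
    freeProductRep P (ReducedFreeProduct.embed P i a) (toHilbert P x) =
      toHilbert P (act P i a x) := hilbertRep_rep i a x

theorem exists_approximation [∀ i, FiniteDimensional ℂ (A i)] {H : Type*} [NormedAddCommGroup H]
    [InnerProductSpace ℂ H] [CompleteSpace H] (π : ReducedFreeProduct P →⋆ₙₐ[ℂ] (H →L[ℂ] H))
    (J : Finset I) {N : ℕ} (hN : N ≠ 0) :
    ∃ m ≤ (1 + ∑ i ∈ J, Module.finrank ℂ (A i)) ^ N * Module.finrank ℂ B,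
      ∃ (f : ReducedFreeProduct P →CP
          (EuclideanSpace ℂ (Option (Fin m)) →L[ℂ] EuclideanSpace ℂ (Option (Fin m))))
        (g : (EuclideanSpace ℂ (Option (Fin m)) →L[ℂ] EuclideanSpace ℂ (Option (Fin m))) →CP
          (H →L[ℂ] H))
        (θ : ReducedFreeProduct P →ₗ[ℂ] (H →L[ℂ] H)), (∀ a, ‖f a‖ ≤ ‖a‖) ∧ (∀ d, ‖g d‖ ≤ ‖d‖) ∧
        KernelPositive θ ∧ θ 1 ≤ 1 ∧ (∀ a, g (f a) = θ a) ∧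
        ∀ i ∈ J, ∀ a : A i,
          ‖θ (ReducedFreeProduct.embed P i a) - π (ReducedFreeProduct.embed P i a)‖ ≤
            2 * ((N : ℝ)⁻¹ * ‖a‖) := by
  obtain ⟨m, hm, x, hx, hx1⟩ := exists_isWordFrame P J N
  obtain ⟨f, g, θ, h1, h2, h3, h4, h5, h6⟩ := exists_factorization (freeProductRep P)
    freeProductRep_injective π hN (fun r => toHilbert P (x r)) hx1 hx.cutOp hx.sum_star_cutOp_mul
  refine ⟨m, hm, f, g, θ, h1, h2, h3, h4, h5, fun i hi a => (h6 _).trans ?_⟩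
  exact hx.norm_blockMap_sub_le hN hi a fun y => freeProductRep_embed i a y

end WordFrame

end

section

open scoped CStarAlgebra ComplexOrder InnerProductSpace Topology

/-! ### Polynomial sequences have no exponential growth -/

section Growth

theorem expGrowthSup_natCast_pow_le (p : ℕ) :
    ExpGrowth.expGrowthSup (fun n : ℕ => (n : ENNReal) ^ p) ≤ 0 := by
  rw [ExpGrowth.expGrowthSup_le_iff]
  intro b hb
  obtain ⟨r, hr0, hrb⟩ := EReal.lt_iff_exists_real_btwn.mp hb
  have hr : 0 < r := by exact_mod_cast hr0
  have h1 := (isLittleO_pow_exp_pos_mul_atTop p hr).comp_tendsto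
    (tendsto_natCast_atTop_atTop (R := ℝ))
  filter_upwards [h1.bound one_pos] with n hn
  have h2 : (n : ℝ) ^ p ≤ Real.exp (r * n) := by
    simpa [abs_of_pos (Real.exp_pos _)] using hn
  have h3 : ((r : EReal) * n) ≤ b * n := by
    gcongr
  refine le_trans ?_ (EReal.exp_monotone h3)
  have h4 : (r : EReal) * n = ((r * n : ℝ) : EReal) := by
    push_cast
    rfl
  rw [h4, EReal.exp_coe]
  refine le_trans ?_ (ENNReal.ofReal_le_ofReal h2)
  rw [ENNReal.ofReal_pow (Nat.cast_nonneg n), ENNReal.ofReal_natCast]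

theorem expGrowthSup_eq_zero_of_le {u : ℕ → ENNReal} (c p : ℕ) (h1 : ∀ n, 1 ≤ u n)
    (h2 : ∀ n ≠ 0, u n ≤ (c * n ^ p : ℕ)) : ExpGrowth.expGrowthSup u = 0 := by
  refine le_antisymm ?_ ?_
  · refine (ExpGrowth.expGrowthSup_le_of_eventually_le (ENNReal.natCast_ne_top c) ?_).trans
      (expGrowthSup_natCast_pow_le p)
    filter_upwards [Filter.eventually_ne_atTop 0] with n hn
    exact_mod_cast h2 n hn
  · rw [← ExpGrowth.expGrowthSup_const (b := 1) one_ne_zero ENNReal.one_ne_top]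
    exact ExpGrowth.expGrowthSup_monotone h1

theorem sum_biUnion_le_sum {κ I : Type*} [DecidableEq I] (s : Finset κ) (t : κ → Finset I)
    (w : I → ℕ) : ∑ i ∈ s.biUnion t, w i ≤ ∑ k ∈ s, ∑ i ∈ t k, w i := by
  classical
  induction s using Finset.induction_on with
  | empty => simp
  | insert k s hk ih =>
    rw [Finset.biUnion_insert, Finset.sum_insert hk]
    have := Finset.sum_union_inter (s₁ := t k) (s₂ := s.biUnion t) (f := w)
    omega

end Growth

/-! ### Uniformity in the iterates and vanishing of the entropy -/

section Entropy

open AmalgamatedFreeProduct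

theorem StarAlgEquiv.exists_coe_eq_iterate {X : Type*} [CStarAlgebra X] (γ : X ≃⋆ₐ[ℂ] X) (k : ℕ) :
    ∃ φ : X →⋆ₐ[ℂ] X, ∀ x, φ x = γ^[k] x := by
  induction k with
  | zero => exact ⟨StarAlgHom.id ℂ X, fun x => rfl⟩
  | succ k ih =>
    obtain ⟨φ, hφ⟩ := ih
    refine ⟨φ.comp (γ : X →⋆ₐ[ℂ] X), fun x => ?_⟩
    rw [Function.iterate_succ_apply, ← hφ]
    rfl

namespace FamilyAut

variable {B : Type*} [CStarAlgebra B] [PartialOrder B] [StarOrderedRing B]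
  {I : Type*} {A : I → Type*} [∀ i, CStarAlgebra (A i)] {P : ∀ i, CondExpInclusion B (A i)}
  (θ : FamilyAut P)

theorem exists_iterate_embed (k : ℕ) (i : I) (a : A i) :
    ∃ a' : A ((θ.perm ^ k) i), ‖a'‖ = ‖a‖ ∧
      θ.freeProductAut^[k] (ReducedFreeProduct.embed P i a) =
        ReducedFreeProduct.embed P ((θ.perm ^ k) i) a' := by
  induction k with
  | zero => exact ⟨a, rfl, rfl⟩
  | succ k ih =>
    obtain ⟨a', h1, h2⟩ := ih
    rw [pow_succ', Equiv.Perm.mul_apply]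
    refine ⟨θ.iso _ a', by rw [θ.norm_iso, h1], ?_⟩
    rw [Function.iterate_succ_apply', h2, θ.freeProductAut_embed]

theorem finrank_perm_pow (k : ℕ) (i : I) :
    Module.finrank ℂ (A ((θ.perm ^ k) i)) = Module.finrank ℂ (A i) := by
  induction k with
  | zero => rfl
  | succ k ih =>
    rw [pow_succ', Equiv.Perm.mul_apply, ← ih]
    exact (AlgEquivClass.toAlgEquiv (R := ℂ)
      (θ.iso ((θ.perm ^ k) i))).toLinearEquiv.finrank_eq.symm

variable {H : Type*} [NormedAddCommGroup H] [InnerProductSpace ℂ H] [CompleteSpace H]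
  (π : ReducedFreeProduct P →⋆ₙₐ[ℂ] (H →L[ℂ] H))

/-- Completely positive maps which almost agree with `π` on the algebras with index in `J`,
together with the number of iterations of the automorphism. -/
structure Approximation where
  /-- the number of iterations -/
  iter : ℕ
  /-- the cutting length -/
  len : ℕ
  /-- the set of indices -/
  indices : Finset I
  /-- the map -/
  map : ReducedFreeProduct P →ₗ[ℂ] (H →L[ℂ] H)
  pos : KernelPositive map
  map_one_le : map 1 ≤ 1
  norm_embed_sub_le : ∀ i ∈ indices, ∀ a : A i,
    ‖map (ReducedFreeProduct.embed P i a) - π (ReducedFreeProduct.embed P i a)‖ ≤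
      2 * ((len : ℝ)⁻¹ * ‖a‖)

/-- The filter of long cuts and large sets of indices, pulled back by the iterated permutation. -/
def approximationFilter : Filter (Approximation π) :=
  -- The number of iterations is left free, so whatever holds eventually holds uniformly in it.
  Filter.atTop.comap fun t =>
    (t.len, t.indices.map ((θ.perm ^ t.iter).symm.toEmbedding))

/-- The iterate moves `a` to an element of the same norm in the algebra with index `(θ.perm ^ k) i`,
so the error is at most `2‖a‖/N` whatever the iterate, once that index belongs to the set. -/
theorem tendsto_approximation_embed (i : I) (a : A i) :
    Filter.Tendsto (fun t : Approximation π =>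
      ‖t.map (θ.freeProductAut^[t.iter] (ReducedFreeProduct.embed P i a)) -
        π (θ.freeProductAut^[t.iter] (ReducedFreeProduct.embed P i a))‖)
      (θ.approximationFilter π) (𝓝 0) := by
  classical
  have h0 : Filter.Tendsto (fun t : Approximation π =>
      (t.len, t.indices.map ((θ.perm ^ t.iter).symm.toEmbedding)))
      (θ.approximationFilter π) Filter.atTop := Filter.tendsto_comap
  have h1 : Filter.Tendsto (fun t : Approximation π => t.len)
      (θ.approximationFilter π) Filter.atTop :=
    (Filter.tendsto_atTop_atTop.mpr fun n => ⟨(n, ∅), fun x hx => hx.1⟩ :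
      Filter.Tendsto (Prod.fst : ℕ × Finset I → ℕ) Filter.atTop Filter.atTop).comp h0
  have h2 : Filter.Tendsto (fun t : Approximation π => 2 * ((t.len : ℝ)⁻¹ * ‖a‖))
      (θ.approximationFilter π) (𝓝 0) := by
    have := ((tendsto_inv_atTop_nhds_zero_nat (𝕜 := ℝ).comp h1).mul_const ‖a‖).const_mul 2
    simpa using this
  refine squeeze_zero' (Filter.Eventually.of_forall fun t => norm_nonneg _) ?_ h2
  filter_upwards [h0.eventually (Filter.eventually_ge_atTop (0, {i}))] with t ht
  obtain ⟨a', h3, h4⟩ := θ.exists_iterate_embed t.iter i a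
  rw [h4, ← h3]
  refine t.norm_embed_sub_le _ ?_ a'
  have h5 : i ∈ t.indices.map ((θ.perm ^ t.iter).symm.toEmbedding) :=
    ht.2 (Finset.mem_singleton_self i)
  rw [Finset.mem_map_equiv, Equiv.symm_symm] at h5
  exact h5

theorem tendsto_approximation [Nonempty I] (x : ReducedFreeProduct P) :
    Filter.Tendsto (fun t : Approximation π =>
      ‖t.map (θ.freeProductAut^[t.iter] x) - π (θ.freeProductAut^[t.iter] x)‖)
      (θ.approximationFilter π) (𝓝 0) := by
  choose φ hφ using fun t : Approximation π =>
    StarAlgEquiv.exists_coe_eq_iterate θ.freeProductAut t.iter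
  simp only [← hφ]
  refine tendsto_of_induction {x | ∃ (i : I) (a : A i), x = ReducedFreeProduct.embed P i a}
    ?_ ?_ ?_ (fun t => t.pos) (fun t => t.map_one_le) π φ ?_ x
  · intro p h1 h2 h3 h4 h5
    exact ReducedFreeProduct.induction h1 h2 h3 h4 fun x i a => h5 x _ ⟨i, a, rfl⟩
  · exact ⟨Classical.arbitrary I, 1, (map_one _).symm⟩
  · rintro _ ⟨i, a, rfl⟩
    exact ⟨i, star a * a, by rw [map_mul, map_star]⟩
  · rintro _ ⟨i, a, rfl⟩
    simp only [hφ]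
    exact θ.tendsto_approximation_embed π i a

/-- This is convergence along the filter spelled out: the cutting length `N` and the index set `F`
serve all iterates at once. -/
theorem exists_norm_sub_lt [Nonempty I] (ω : Finset (ReducedFreeProduct P)) {δ : ℝ} (hδ : 0 < δ) :
    ∃ (N : ℕ) (F : Finset I), N ≠ 0 ∧ ∀ t : Approximation π, t.len = N →
      (∀ i ∈ F, (θ.perm ^ t.iter) i ∈ t.indices) → ∀ x ∈ ω,
      ‖t.map (θ.freeProductAut^[t.iter] x) - π (θ.freeProductAut^[t.iter] x)‖ < δ := by
  classical
  have h1 : ∀ᶠ t in θ.approximationFilter π, ∀ x ∈ ω,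
      ‖t.map (θ.freeProductAut^[t.iter] x) - π (θ.freeProductAut^[t.iter] x)‖ < δ :=
    (Filter.eventually_all_finset ω).mpr fun x _ =>
      (θ.tendsto_approximation π x).eventually_lt_const hδ
  obtain ⟨⟨N, F⟩, hNF⟩ := Filter.eventually_atTop.mp (Filter.eventually_comap.mp h1)
  refine ⟨N + 1, F, N.succ_ne_zero, fun t ht hF => hNF _ ⟨?_, fun i hi => ?_⟩ t rfl⟩
  · exact ht ▸ N.le_succ
  · rw [Finset.mem_map_equiv, Equiv.symm_symm]
    exact hF i hi

variable [FiniteDimensional ℂ B] [∀ i, FiniteDimensional ℂ (A i)]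

/-- One approximation for the union `J` of the translates of `F` serves every `k < n`. The
dimensions over `J` sum to at most `n * C`, so with `N` fixed the matrix size is polynomial of
degree at most `N` in `n`. -/
theorem exists_cpRank_le [Nonempty I] (ω : Finset (ReducedFreeProduct P)) {δ : ℝ} (hδ : 0 < δ) :
    ∃ c p : ℕ, ∀ n ≠ 0,
      cpRank π (⋃ k ∈ Finset.range n, θ.freeProductAut^[k] '' (ω : Set (ReducedFreeProduct P))) δ ≤
        (c * n ^ p : ℕ) := by
  classical
  obtain ⟨N, F, hN, h⟩ := θ.exists_norm_sub_lt π ω hδ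
  set C := ∑ i ∈ F, Module.finrank ℂ (A i) with hC
  set d := Module.finrank ℂ B with hd
  -- The matrix size is at most `((1 + C) ^ N * d + 1) * n ^ N`, and the rank is bounded by its
  -- square.
  refine ⟨((1 + C) ^ N * d + 1) ^ 2, N * 2, fun n hn => ?_⟩
  let J : Finset I := (Finset.range n).biUnion fun k => F.image (θ.perm ^ k)
  have hJ : ∑ i ∈ J, Module.finrank ℂ (A i) ≤ n * C := by
    refine (sum_biUnion_le_sum _ _ _).trans_eq ?_
    have e (k : ℕ) : ∑ i ∈ F.image (θ.perm ^ k), Module.finrank ℂ (A i) = C := by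
      rw [Finset.sum_image (θ.perm ^ k).injective.injOn]
      exact Finset.sum_congr rfl fun i _ => θ.finrank_perm_pow k i
    rw [Finset.sum_congr rfl fun k _ => e k, Finset.sum_const, Finset.card_range, smul_eq_mul]
  obtain ⟨m, hm, f, g, ψ, h1, h2, h3, h4, h5, h6⟩ := exists_approximation π J hN
  refine (cpRank_le π m f g h1 h2 fun a ha => ?_).trans ?_
  · obtain ⟨k, hk, x, hx, rfl⟩ : ∃ k < n, ∃ x ∈ ω, θ.freeProductAut^[k] x = a := by
      obtain ⟨k, hk, x, hx, rfl⟩ := Set.mem_iUnion₂.mp ha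
      exact ⟨k, Finset.mem_range.mp hk, x, hx, rfl⟩
    rw [h5]
    refine h ⟨k, N, J, ψ, h3, h4, h6⟩ rfl (fun i hi => ?_) x hx
    exact Finset.mem_biUnion.mpr ⟨k, Finset.mem_range.mpr hk, Finset.mem_image_of_mem _ hi⟩
  · refine Nat.cast_le.mpr ?_
    rw [pow_mul, ← mul_pow]
    have hn1 : 1 ≤ n := Nat.one_le_iff_ne_zero.mpr hn
    refine Nat.pow_le_pow_left ?_ 2
    calc m + 1 ≤ (1 + n * C) ^ N * d + 1 := by
          refine Nat.add_le_add_right (hm.trans ?_) 1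
          gcongr
      -- Here `n ≥ 1` absorbs both summands `1`.
      _ ≤ ((1 + C) * n) ^ N * d + n ^ N := by
          refine Nat.add_le_add ?_ (Nat.one_le_pow _ _ hn1)
          gcongr
          nlinarith
      _ = ((1 + C) ^ N * d + 1) * n ^ N := by
          rw [mul_pow]
          ring

/-- The entropy of an automorphism of a reduced amalgamated free product of finite dimensional
algebras that permutes the algebras is zero. -/
theorem topologicalEntropy_freeProductAut [Nonempty I] :
    topologicalEntropy π θ.freeProductAut = 0 := by
  have h (ω : Finset (ReducedFreeProduct P)) {δ : ℝ} (hδ : 0 < δ) :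
      cpEntropyAt π θ.freeProductAut (ω : Set (ReducedFreeProduct P)) δ = 0 := by
    obtain ⟨c, p, hcp⟩ := θ.exists_cpRank_le π ω hδ
    refine expGrowthSup_eq_zero_of_le c p (fun n => ?_) fun n hn => ?_
    · exact_mod_cast one_le_cpRank π _ δ
    · exact_mod_cast hcp n hn
  refine le_antisymm (iSup_le fun ω => iSup_le fun δ => iSup_le fun hδ => (h ω hδ).le) ?_
  -- Any single pair `ω`, `δ` bounds the supremum from below by zero.
  rw [← h ∅ one_pos]
  exact le_iSup_of_le ∅ (le_iSup_of_le 1 (le_iSup_of_le one_pos le_rfl))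

end FamilyAut

end Entropy

end

theorem theorem1 {B : Type*} [CStarAlgebra B] [PartialOrder B] [StarOrderedRing B]
    [FiniteDimensional ℂ B]
    {I : Type*} [Nonempty I] {A : I → Type*} [∀ i, CStarAlgebra (A i)]
    [∀ i, FiniteDimensional ℂ (A i)]
    (P : ∀ i, CondExpInclusion B (A i)) (hP : ∀ i, (P i).FaithfulGNS)
    (σ : Equiv.Perm I) (α : ∀ i, A i ≃⋆ₐ[ℂ] A (σ i)) (β : B ≃⋆ₐ[ℂ] B)
    (hβ : ∀ i b, α i ((P i).incl b) = (P (σ i)).incl (β b))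
    (hα : ∀ i a, (P (σ i)).incl ((P (σ i)).exp (α i a)) = α i ((P i).incl ((P i).exp a))) :
    ∃ γ : ReducedFreeProduct P ≃⋆ₐ[ℂ] ReducedFreeProduct P,
      (∀ i a, γ (ReducedFreeProduct.embed P i a) =
        ReducedFreeProduct.embed P (σ i) (α i a)) ∧
      (∀ γ' : ReducedFreeProduct P ≃⋆ₐ[ℂ] ReducedFreeProduct P,
        (∀ i a, γ' (ReducedFreeProduct.embed P i a) =
          ReducedFreeProduct.embed P (σ i) (α i a)) → γ' = γ) ∧
      ∀ {H : Type*} [NormedAddCommGroup H] [InnerProductSpace ℂ H] [CompleteSpace H]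
        (π : ReducedFreeProduct P →⋆ₙₐ[ℂ] (H →L[ℂ] H)), Function.Injective π →
        topologicalEntropy π γ = 0 := by
  let θ : FamilyAut P := ⟨σ, α, β, hβ, fun i a => by
    -- The hypothesis compares elements of `A (σ i)`. Applying the expectation, a left inverse of
    -- the inclusion, turns it into an identity in `B` involving `β`.
    have := congrArg (P (σ i)).exp (hα i a)
    rwa [(P (σ i)).exp_incl, hβ, (P (σ i)).exp_incl] at this⟩
  refine ⟨θ.freeProductAut, θ.freeProductAut_embed, fun γ' h => ?_, fun π _ =>
    θ.topologicalEntropy_freeProductAut π⟩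
  exact ReducedFreeProduct.aut_ext fun i a => (h i a).trans (θ.freeProductAut_embed i a).symm
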